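/- **Definitions.** For an undirected weighted graph $\mathbf G=(V,E,m)$ with edge weights $m\ge 0$, let $\deg(v)=\sum_{v'}m(v,v')$ and let $\mathbf W_{v,v'}=m(v,v')/\deg(v)$ be its random walk matrix, with eigenvalues $1=\lambda_1\ge\lambda_2\ge\cdots\ge\lambda_{|V|}$ counted with multiplicity; the spectral expansion of $\mathbf G$ is $\lambda(\mathbf G)=\max\{|\lambda_2|,|\lambda_{|V|}|\}$. Let $r\ge 1$, $b\ge 1$, $n\ge 2^{r+1}$ be integers and $q=2^b$. View $\mathbb F_q^n\otimes_{\mathbb F_q}\mathbb F_q^n$ as the space of $n\times n$ matrices over $\mathbb F_q$ (with $u\otimes v=uv^{\top}$), regarded as an $\mathbb F_2$-vector space. Let $G\in\mathbb F_2^{(2^{r+1}-1)\times(r+1)}$ be the generator matrix of the Hadamard code, whose $k$-th row, $1\le k\le 2^{r+1}-1$, is the binary representation of $2^{r+1}-k$ with the most significant bit first. Let $X=X^{r,b,n}$ be the collection of $\mathbb F_2$-subspaces defined as follows. The rank-$r$ faces of $X$ are the $(r+1)$-dimensional $\mathbb F_2$-subspaces of the form $\operatorname{im}(EG)$, where $E$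 is the matrix with columns $e^{(1)}_1\otimes e^{(2)}_1,\dots,e^{(1)}_{2^{r+1}-1}\otimes e^{(2)}_{2^{r+1}-1}$ for vectors $e^{(\ell)}_k\in\mathbb F_q^n$ such that, for each $\ell\in\{1,2\}$, the vectors $e^{(\ell)}_1,\dots,e^{(\ell)}_{2^{r+1}-1}$ are linearly independent over $\mathbb F_q$. The faces of $X$ are all $\mathbb F_2$-subspaces of rank-$r$ faces, ordered by inclusion; the rank of a face $x$ is $\dim_{\mathbb F_2}(x)-1$; $X(i)$ denotes the set of rank-$i$ faces; and $m_X$ is the uniform weight function, i.e. $m_X(x)=1/|X(i)|$ for $x\in X(i)$. For a face $x\in X$, the link $X_x$ is the poset $\{x'\in X: x\subseteq x'\}$ with rank function $\operatorname{rank}(x')-\operatorname{rank}(x)-1$ and with weights proportional to $m_X$ and normalized to sum to $1$ on the faces of each rank. The 1-skeleton graph $\mathbf G_Y$ of a weighted graded poset $Y$ has vertex set $Y(0)$, and two distinct vertices $y,y'$ that are both dominated by some $y_1\in Y(1)$ are joined by an edge of weight $\sum_{y_1\in Y(1):\,y,y'\prec y_1}m_Y(y_1)$. The rank-$i$ local expansion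 of $X$ is $$\lambda^{(i)}(X)=\max_{x\in X(i)}\lambda(\mathbf G_{X_x}).$$ **Theorem.** For all integers $r\ge 1$, $b\ge 1$, $n\ge 2^{r+1}$, with $q=2^b$ and $X=X^{r,b,n}$, $$\lambda^{(r-2)}(X)\le\frac{11}{q}.$$ -/

import Mathlib

/-! ### Expansion of weighted graphs -/

/-- The random walk matrix `W v v' = m v v' / deg v` of the undirected weighted graph on `V` whose
edge weights are `m`, where `deg v = ∑ v', m v v'`. Here `m v v' = 0` if `v v'` is not an edge. -/
noncomputable def randomWalkMatrix {V : Type*} [Fintype V] (m : Matrix V V ℝ) : Matrix V V ℝ :=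
  Matrix.of fun v v' => m v v' / ∑ u, m v u

open scoped Classical in
/-- The eigenvalues `λ₁ ≥ λ₂ ≥ ⋯ ≥ λ_{|V|}` (with multiplicity) of the random walk matrix of the
undirected weighted graph with edge weights `m`, in decreasing order. -/
noncomputable def walkEigenvalues {V : Type*} [Finite V] (m : Matrix V V ℝ) : List ℝ :=
  letI : Fintype V := Fintype.ofFinite V
  (randomWalkMatrix m).charpoly.roots.sort (fun a b => b ≤ a)

/-- The spectral expansion `λ(G) = max {|λ₂|, |λ_{|V|}|}` of a weighted graph. -/
noncomputable def spectralExpansion {V : Type*} [Finite V] (m : Matrix V V ℝ) : ℝ :=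
  max |(walkEigenvalues m).getD 1 0| |(walkEigenvalues m).getLastD 0|

/-! ### Weighted posets, links, 1-skeletons and local expansion -/

/-- The data of a graded weighted poset: a set of faces in a partially ordered type (with the
induced order), an integer rank and a real weight for each face. -/
structure WeightedPoset (α : Type*) [PartialOrder α] where
  faces : Set α
  rank : α → ℤ
  weight : α → ℝ

namespace WeightedPoset

variable {α : Type*} [PartialOrder α]

/-- `X(i)`, the set of rank-`i` faces. -/
def level (X : WeightedPoset α) (i : ℤ) : Set α :=
  {x | x ∈ X.faces ∧ X.rank x = i}

/-- The link of `x`: all faces that dominate `x`, with the rank shifted by `rank x + 1` and with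
the weights normalized to total weight one on the faces of each rank. -/
noncomputable def link (X : WeightedPoset α) (x : α) : WeightedPoset α where
  faces := {y | y ∈ X.faces ∧ x ≤ y}
  rank y := X.rank y - X.rank x - 1
  weight y := X.weight y /
    ∑ᶠ z ∈ {z | (z ∈ X.faces ∧ x ≤ z) ∧ X.rank z = X.rank y}, X.weight z

open scoped Classical in
/-- The edge weights of the 1-skeleton graph: its vertices are the rank-`0` faces, and two distinct
vertices are joined with weight equal to the total weight of the rank-`1` faces dominating both. -/
noncomputable def skeletonGraph (X : WeightedPoset α) : Matrix (X.level 0) (X.level 0) ℝ :=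
  Matrix.of fun v v' =>
    if v = v' then 0 else ∑ᶠ e ∈ {e | e ∈ X.level 1 ∧ (v : α) < e ∧ (v' : α) < e}, X.weight e

/-- The rank-`i` local expansion `λ⁽ⁱ⁾(X)`: the maximum of the spectral expansions of the
1-skeleton graphs of the links of the rank-`i` faces. -/
noncomputable def localExpansion [Finite α] (X : WeightedPoset α) (i : ℤ) : ℝ :=
  ⨆ x : X.level i, spectralExpansion (X.link (x : α)).skeletonGraph

end WeightedPoset

/-! ### Grassmannian complexes -/

/-- A `K`-Grassmannian complex in the ambient space `E`: a downward closed set of subspaces. -/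
structure GrassmannianComplex (K E : Type*) [Field K] [AddCommGroup E] [Module K E] where
  faces : Set (Submodule K E)
  down_closed : ∀ ⦃x y : Submodule K E⦄, y ∈ faces → x ≤ y → x ∈ faces

namespace GrassmannianComplex

variable {K E : Type*} [Field K] [AddCommGroup E] [Module K E]

/-- A Grassmannian complex as a poset under inclusion, with `rank x = dim x - 1` and the uniform
weight function: on the faces of each rank, the weights are those of the uniform distribution. -/
noncomputable def toWeightedPoset (X : GrassmannianComplex K E) :
    WeightedPoset (Submodule K E) where
  faces := X.faces
  rank x := (Module.finrank K x : ℤ) - 1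
  weight x :=
    1 / (Nat.card {y : Submodule K E // y ∈ X.faces ∧ Module.finrank K y = Module.finrank K x} : ℝ)

end GrassmannianComplex

/-! ### The complex `X^{r,b,n}` -/

/-- The generator matrix of the Hadamard code of length `2^(r+1) - 1`. Its `k`-th row, for
`1 ≤ k ≤ 2^(r+1) - 1`, is the binary representation of `2^(r+1) - k`, most significant bit first.
(Rows and columns are indexed from `0` here, so the index `k` stands for row `k + 1`.) -/
def hadamardGenerator (r : ℕ) : Matrix (Fin (2 ^ (r + 1) - 1)) (Fin (r + 1)) (ZMod 2) :=
  Matrix.of fun k j => if (2 ^ (r + 1) - ((k : ℕ) + 1)).testBit (r - (j : ℕ)) then 1 else 0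

/-- The ambient space `𝔽_q^n ⊗ 𝔽_q^n`, `q = 2^b`, in the form of the `n × n` matrices over `𝔽_q`,
where the pure tensor `u ⊗ v` is the matrix `u vᵀ`. It is regarded as a space over `𝔽₂`. -/
abbrev MatrixSpace (b n : ℕ) : Type := Matrix (Fin n) (Fin n) (GaloisField 2 b)

/-- The `𝔽₂`-linear map given by the matrix `E` whose columns are the tensors
`e₁ k ⊗ e₂ k`. -/
noncomputable def tensorColumns {b n N : ℕ} (e₁ e₂ : Fin N → Fin n → GaloisField 2 b) :
    (Fin N → ZMod 2) →ₗ[ZMod 2] MatrixSpace b n :=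
  Fintype.linearCombination (ZMod 2) fun k => Matrix.vecMulVec (e₁ k) (e₂ k)

/-- The rank-`r` faces of `X^{r,b,n}`: the `(r+1)`-dimensional `𝔽₂`-subspaces of the form
`im (E G)` with `G` the Hadamard generator matrix and `E` with columns `e₁ k ⊗ e₂ k`, where the
vectors `e₁ k` are linearly independent over `𝔽_q`, and so are the vectors `e₂ k`. -/
def topFaces (r b n : ℕ) : Set (Submodule (ZMod 2) (MatrixSpace b n)) :=
  {x | Module.finrank (ZMod 2) x = r + 1 ∧
    ∃ e₁ e₂ : Fin (2 ^ (r + 1) - 1) → Fin n → GaloisField 2 b,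
      LinearIndependent (GaloisField 2 b) e₁ ∧ LinearIndependent (GaloisField 2 b) e₂ ∧
      x = LinearMap.range (tensorColumns e₁ e₂ ∘ₗ (hadamardGenerator r).mulVecLin)}

/-- The `𝔽₂`-Grassmannian complex `X^{r,b,n}`: all subspaces of its rank-`r` faces. -/
def matrixComplex (r b n : ℕ) : GrassmannianComplex (ZMod 2) (MatrixSpace b n) where
  faces := {x | ∃ y ∈ topFaces r b n, x ≤ y}
  down_closed := fun _ _ ⟨z, hz, hyz⟩ hxy => ⟨z, hz, hxy.trans hyz⟩

/-! Pairs (g, h) of invertible matrices act on matrices by M ↦ g M h⁻¹. The rows of the Hadamard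
matrix are distinct and run through all nonzero functionals, so every injective linear
parametrisation of every top face is a translate of a single model: the diagonal matrices with
entries ⟨label i, s⟩, where each nonzero label in F₂^(r-1) × F₂² is carried by exactly one
coordinate (`exists_pairAct_modelMap_eq`).

Let x be a face of dimension r - 1. The pairs that carry the model of x to x in a fixed
parametrisation, its frames, form a left coset of the pointwise stabiliser H of the model of x, and
a uniformly random frame yields a uniformly random ordered edge (v, v') of the 1-skeleton of the
link. A function of v, read on frames, is invariant under right translation by a subgroup H_z of H,
a function of v' by a subgroup H_w, where H_z and H_w also fix one further diagonal matrix, z or w.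
By `spectralExpansion_le_of_fibers` and `abs_sum_mul_le_of_coset` the theorem becomes a statement on
orthogonal representations: on H_w-fixed vectors with no H-fixed component, the projection P_z to
the H_z-fixed vectors has norm at most 11/q.

The first component of its label is the type of a coordinate. H is built from one copy of GL₄ for
each nonzero type, acting alike on both tensor factors, and from a normal part in which the columns
and the rows of type zero move independently. In a GL₄, the groups H_w and H_z contain two
transversal Levi subgroups GL₂ × GL₂, and `norm_fixProj_leviSet_sub_le` gives 6/q + 2/q². In type
zero, z and w are e_p ⊗ e_p + e_q ⊗ e_q and e_p ⊗ e_p + e_s ⊗ e_s, and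
`norm_fixProj_le_of_mem_fixedSpace` gives 1/q + 4/q² + 4/q³. The parts contribute orthogonal
components which stay orthogonal under P_z, so the bounds combine by a maximum rather than a sum and
do not depend on r (`norm_fixProj_sub_blockStab_le`).

Smallness has two sources. Conjugates of a subgroup, any two of which generate an abelian group,
give orthogonal deviations and hence a Bessel inequality (`card_mul_norm_fixProj_sub_sq_le`).
Averages over the vectors not vanishing on S' and over those not vanishing on a larger set S nearly
agree (`norm_fixProj_colFix_sub_le`). -/

/-! ### Projections onto fixed vectors -/

section FixedVectors

variable {V G : Type*} [NormedAddCommGroup V] [InnerProductSpace ℝ V] [FiniteDimensional ℝ V]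
  [Group G]

/-- The vectors fixed by all elements of a subset `S` of a group acting by linear isometries. -/
def fixedSpace (ρ : G →* (V ≃ₗᵢ[ℝ] V)) (S : Set G) : Submodule ℝ V where
  carrier := {v | ∀ g ∈ S, ρ g v = v}
  add_mem' hv hw g hg := by rw [map_add, hv g hg, hw g hg]
  zero_mem' g _ := map_zero _
  smul_mem' c v hv g hg := by rw [map_smul, hv g hg]

/-- The orthogonal projection onto the vectors fixed by `S`. -/
noncomputable def fixProj (ρ : G →* (V ≃ₗᵢ[ℝ] V)) (S : Set G) : V →L[ℝ] V :=
  (fixedSpace ρ S).starProjection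

variable (ρ : G →* (V ≃ₗᵢ[ℝ] V)) {S T : Set G}

omit [FiniteDimensional ℝ V] in
theorem rep_mul_apply (g h : G) (v : V) : ρ (g * h) v = ρ g (ρ h v) := by
  rw [map_mul]; rfl

omit [FiniteDimensional ℝ V] in
theorem mem_fixedSpace {v : V} : v ∈ fixedSpace ρ S ↔ ∀ g ∈ S, ρ g v = v := Iff.rfl

omit [FiniteDimensional ℝ V] in
theorem fixedSpace_anti (h : S ⊆ T) : fixedSpace ρ T ≤ fixedSpace ρ S :=
  fun _ hv g hg => hv g (h hg)

theorem fixProj_mem (v : V) : fixProj ρ S v ∈ fixedSpace ρ S :=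
  Submodule.starProjection_apply_mem _ v

theorem apply_fixProj {g : G} (hg : g ∈ S) (v : V) : ρ g (fixProj ρ S v) = fixProj ρ S v :=
  fixProj_mem ρ v g hg

theorem fixProj_eq_self {v : V} (hv : v ∈ fixedSpace ρ S) : fixProj ρ S v = v :=
  Submodule.starProjection_eq_self_iff.2 hv

theorem norm_fixProj_le (v : V) : ‖fixProj ρ S v‖ ≤ ‖v‖ :=
  Submodule.norm_starProjection_apply_le _ v

theorem inner_fixProj_left (v w : V) :
    inner ℝ (fixProj ρ S v) w = inner ℝ v (fixProj ρ S w) :=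
  Submodule.inner_starProjection_left_eq_right _ v w

theorem fixProj_eq_of_mem {v w : V} (hw : w ∈ fixedSpace ρ S)
    (h : ∀ u ∈ fixedSpace ρ S, inner ℝ (v - w) u = 0) : fixProj ρ S v = w :=
  Submodule.eq_starProjection_of_mem_of_inner_eq_zero hw h

theorem inner_sub_fixProj {v w : V} (hw : w ∈ fixedSpace ρ S) :
    inner ℝ (v - fixProj ρ S v) w = 0 :=
  Submodule.starProjection_inner_eq_zero v w hw

theorem fixProj_fixProj_of_subset (h : S ⊆ T) (v : V) :
    fixProj ρ S (fixProj ρ T v) = fixProj ρ T v :=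
  fixProj_eq_self ρ (fixedSpace_anti ρ h (fixProj_mem ρ v))

theorem fixProj_fixProj_of_le (h : fixedSpace ρ T ≤ fixedSpace ρ S) (v : V) :
    fixProj ρ T (fixProj ρ S v) = fixProj ρ T v := by
  refine ext_inner_right ℝ fun w => ?_
  rw [inner_fixProj_left, inner_fixProj_left, fixProj_eq_self ρ (h (fixProj_mem ρ w)),
    inner_fixProj_left]

theorem fixProj_fixProj_of_subset' (h : S ⊆ T) (v : V) :
    fixProj ρ T (fixProj ρ S v) = fixProj ρ T v :=
  fixProj_fixProj_of_le ρ (fixedSpace_anti ρ h) v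

theorem norm_fixProj_anti (h : S ⊆ T) (v : V) : ‖fixProj ρ T v‖ ≤ ‖fixProj ρ S v‖ := by
  rw [← fixProj_fixProj_of_subset' ρ h]
  exact norm_fixProj_le ρ _

theorem apply_fixProj_comm {g : G} (h : ∀ s ∈ S, g * s * g⁻¹ ∈ S) (h' : ∀ s ∈ S, g⁻¹ * s * g ∈ S)
    (v : V) : ρ g (fixProj ρ S v) = fixProj ρ S (ρ g v) := by
  symm
  refine fixProj_eq_of_mem ρ (fun s hs => ?_) fun u hu => ?_
  · have h1 := apply_fixProj ρ (h' s hs) v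
    calc ρ s (ρ g (fixProj ρ S v)) = ρ g (ρ (g⁻¹ * s * g) (fixProj ρ S v)) := by
          simp only [← rep_mul_apply]; congr 2; group
      _ = _ := by rw [h1]
  · have h2 : ρ g⁻¹ u ∈ fixedSpace ρ S := fun s hs => by
      have h1 := hu _ (h s hs)
      calc ρ s (ρ g⁻¹ u) = ρ g⁻¹ (ρ (g * s * g⁻¹) u) := by
            simp only [← rep_mul_apply]; congr 2; group
        _ = _ := by rw [h1]
    have h3 : ρ g (ρ g⁻¹ u) = u := by
      rw [← rep_mul_apply]; simp
    rw [← map_sub, ← h3, LinearIsometryEquiv.inner_map_map]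
    exact inner_sub_fixProj ρ h2

theorem fixProj_apply_of_mem {g : G} (hg : g ∈ S) (v : V) :
    fixProj ρ S (ρ g v) = fixProj ρ S v := by
  refine ext_inner_right ℝ fun w => ?_
  rw [inner_fixProj_left, inner_fixProj_left]
  nth_rewrite 1 [← apply_fixProj ρ hg w]
  rw [LinearIsometryEquiv.inner_map_map]

theorem fixProj_comp {G' : Type*} [Group G'] (φ : G' →* G) (S : Set G') :
    fixProj (ρ.comp φ) S = fixProj ρ (φ '' S) := by
  have h : fixedSpace (ρ.comp φ) S = fixedSpace ρ (φ '' S) := by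
    ext v; simp [mem_fixedSpace]
  simp only [fixProj, h]

/-- Conjugation transports the projections. -/
theorem fixProj_conj (g : G) (v : V) (hv : ρ g v = v) :
    fixProj ρ ((fun s => g * s * g⁻¹) '' S) v = ρ g (fixProj ρ S v) := by
  have hg (u : V) : ρ g (ρ g⁻¹ u) = u := by
    rw [← rep_mul_apply]; simp
  refine fixProj_eq_of_mem ρ ?_ fun u hu => ?_
  · rintro _ ⟨s, hs, rfl⟩
    calc ρ (g * s * g⁻¹) (ρ g (fixProj ρ S v)) = ρ g (ρ s (fixProj ρ S v)) := by
          simp only [← rep_mul_apply]; congr 2; group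
      _ = _ := by rw [apply_fixProj ρ hs]
  · have h2 : ρ g⁻¹ u ∈ fixedSpace ρ S := fun s hs => by
      have h1 := hu _ ⟨s, hs, rfl⟩
      calc ρ s (ρ g⁻¹ u) = ρ g⁻¹ (ρ (g * s * g⁻¹) u) := by
            simp only [← rep_mul_apply]; congr 2; group
        _ = _ := by rw [h1]
    nth_rewrite 1 [← hv]
    rw [← map_sub, ← hg u, LinearIsometryEquiv.inner_map_map]
    exact inner_sub_fixProj ρ h2

/-- If `T` normalises `S`, then the projection for `S` preserves the vectors fixed by `T`. -/
theorem fixProj_mem_of_normalizes (h : ∀ g ∈ T, ∀ s ∈ S, g * s * g⁻¹ ∈ S)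
    (h' : ∀ g ∈ T, ∀ s ∈ S, g⁻¹ * s * g ∈ S) {v : V} (hv : v ∈ fixedSpace ρ T) :
    fixProj ρ S v ∈ fixedSpace ρ T := fun g hg => by
  rw [apply_fixProj_comm ρ (h g hg) (h' g hg), hv g hg]

/-- P_S preserves the range of P_T, so P_T P_S P_T = P_S P_T; taking adjoints gives commutation. -/
theorem fixProj_comm_of_normalizes (h : ∀ g ∈ T, ∀ s ∈ S, g * s * g⁻¹ ∈ S)
    (h' : ∀ g ∈ T, ∀ s ∈ S, g⁻¹ * s * g ∈ S) (v : V) :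
    fixProj ρ S (fixProj ρ T v) = fixProj ρ T (fixProj ρ S v) := by
  have key (u : V) : fixProj ρ T (fixProj ρ S (fixProj ρ T u)) = fixProj ρ S (fixProj ρ T u) :=
    fixProj_eq_self ρ (fixProj_mem_of_normalizes ρ h h' (fixProj_mem ρ u))
  refine ext_inner_right ℝ fun w => ?_
  rw [← key, inner_fixProj_left, inner_fixProj_left, inner_fixProj_left, key,
    inner_fixProj_left, inner_fixProj_left]

theorem fixProj_comm_of_commute (h : ∀ g ∈ T, ∀ s ∈ S, g * s = s * g) (v : V) :
    fixProj ρ S (fixProj ρ T v) = fixProj ρ T (fixProj ρ S v) := by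
  refine fixProj_comm_of_normalizes ρ (fun g hg s hs => ?_) (fun g hg s hs => ?_) v
  · rwa [h g hg s hs, mul_inv_cancel_right]
  · rwa [mul_assoc, ← h g hg s hs, inv_mul_cancel_left]

theorem fixProj_mem_of_commute (h : ∀ g ∈ T, ∀ s ∈ S, g * s = s * g) {v : V}
    (hv : v ∈ fixedSpace ρ T) : fixProj ρ S v ∈ fixedSpace ρ T := by
  rw [← fixProj_eq_self ρ hv, fixProj_comm_of_commute ρ h]
  exact fixProj_mem ρ _

theorem fixProj_fixProj_of_commute (h : ∀ g ∈ T, ∀ s ∈ S, g * s = s * g) (v : V) :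
    fixProj ρ S (fixProj ρ T v) = fixProj ρ (S ∪ T) v := by
  have hmem : fixProj ρ S (fixProj ρ T v) ∈ fixedSpace ρ (S ∪ T) := by
    rintro g (hg | hg)
    · exact apply_fixProj ρ hg _
    · exact fixProj_mem_of_commute ρ h (fixProj_mem ρ v) g hg
  rw [← fixProj_eq_self ρ hmem, fixProj_fixProj_of_subset' ρ Set.subset_union_left,
    fixProj_fixProj_of_subset' ρ Set.subset_union_right]

/-- If `v` is fixed by elements `h i` which normalise an abelian `R` and move `N ⊆ R` to subsets any
two of which generate `R`, then the projections of `v` for `N` and `R` are close. -/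
theorem card_mul_norm_fixProj_sub_sq_le {I : Type*} [Fintype I] (h : I → G) {N R : Set G} {v : V}
    (hv : ∀ i, ρ (h i) v = v) (hR : ∀ i, ∀ r ∈ R, h i * r * (h i)⁻¹ ∈ R)
    (hR' : ∀ i, ∀ r ∈ R, (h i)⁻¹ * r * h i ∈ R) (hN : N ⊆ R)
    (hcomm : ∀ r ∈ R, ∀ r' ∈ R, r * r' = r' * r)
    (hgen : ∀ i j, i ≠ j → ∀ r ∈ R, ∃ a ∈ N, ∃ b ∈ N,
      r = (h i * a * (h i)⁻¹) * (h j * b * (h j)⁻¹)) :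
    (Fintype.card I : ℝ) * ‖fixProj ρ N v - fixProj ρ R v‖ ^ 2 ≤ ‖v‖ ^ 2 := by
  set C : I → Set G := fun i => (fun s => h i * s * (h i)⁻¹) '' N with hC
  have hCR (i : I) : C i ⊆ R := by
    rintro _ ⟨s, hs, rfl⟩
    exact hR i s (hN hs)
  set x : I → V := fun i => fixProj ρ (C i) v - fixProj ρ R v with hx
  have hx' (i : I) : x i = ρ (h i) (fixProj ρ N v - fixProj ρ R v) := by
    rw [map_sub, ← fixProj_conj ρ (h i) v (hv i), apply_fixProj_comm ρ (hR i) (hR' i), hv i]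
  -- The two commuting projections compose to a vector fixed by C i and by C j, hence by their
  -- products, which exhaust R.
  have hprod (i j : I) (hij : i ≠ j) : fixProj ρ (C i) (fixProj ρ (C j) v) = fixProj ρ R v := by
    have h1 : fixProj ρ (C i) (fixProj ρ (C j) v) ∈ fixedSpace ρ R := by
      intro r hr
      obtain ⟨a, ha, b, hb, rfl⟩ := hgen i j hij r hr
      have hb' : h j * b * (h j)⁻¹ ∈ C j := ⟨b, hb, rfl⟩
      have ha' : h i * a * (h i)⁻¹ ∈ C i := ⟨a, ha, rfl⟩
      rw [rep_mul_apply,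
        fixProj_mem_of_commute ρ (fun g hg s hs => hcomm g (hCR j hg) s (hCR i hs))
          (fixProj_mem ρ v) _ hb', apply_fixProj ρ ha']
    rw [← fixProj_eq_self ρ h1, fixProj_fixProj_of_subset' ρ (hCR i),
      fixProj_fixProj_of_subset' ρ (hCR j)]
  have hself (S : Set G) : inner ℝ (fixProj ρ S v) (fixProj ρ S v) = inner ℝ v (fixProj ρ S v) := by
    rw [inner_fixProj_left, fixProj_fixProj_of_subset ρ subset_rfl]
  have hRl (i : I) : inner ℝ (fixProj ρ R v) (fixProj ρ (C i) v) = inner ℝ v (fixProj ρ R v) := by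
    rw [inner_fixProj_left, fixProj_fixProj_of_subset' ρ (hCR i)]
  have hRr (i : I) : inner ℝ (fixProj ρ (C i) v) (fixProj ρ R v) = inner ℝ v (fixProj ρ R v) := by
    rw [inner_fixProj_left, fixProj_fixProj_of_subset ρ (hCR i)]
  have horth (i j : I) (hij : i ≠ j) : inner ℝ (x i) (x j) = 0 := by
    simp only [hx, inner_sub_left, inner_sub_right, hRl, hRr, hself]
    rw [inner_fixProj_left, hprod i j hij]
    ring
  -- The deviations x i are pairwise orthogonal, have equal norms, and satisfy ⟨v, x i⟩ = ‖x i‖²;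
  -- Cauchy–Schwarz for v against their sum is then Bessel's inequality.
  have hvx (i : I) : inner ℝ v (x i) = ‖x i‖ ^ 2 := by
    rw [← real_inner_self_eq_norm_sq]
    simp only [hx, inner_sub_left, inner_sub_right, hRl, hRr, hself]
    ring
  have hnorm (i : I) : ‖x i‖ = ‖fixProj ρ N v - fixProj ρ R v‖ := by
    rw [hx', LinearIsometryEquiv.norm_map]
  have hsum : ‖∑ i, x i‖ ^ 2 = ∑ i, ‖x i‖ ^ 2 := by
    rw [← real_inner_self_eq_norm_sq, sum_inner]
    refine Finset.sum_congr rfl fun i _ => ?_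
    rw [inner_sum, Finset.sum_eq_single i (fun j _ hji => horth i j hji.symm) (by simp),
      real_inner_self_eq_norm_sq]
  have hle : ∑ i, ‖x i‖ ^ 2 ≤ ‖v‖ * ‖∑ i, x i‖ := by
    calc ∑ i, ‖x i‖ ^ 2 = inner ℝ v (∑ i, x i) := by
          rw [inner_sum]; exact Finset.sum_congr rfl fun i _ => (hvx i).symm
      _ ≤ _ := real_inner_le_norm _ _
  have hcard : ∑ i, ‖x i‖ ^ 2 = (Fintype.card I : ℝ) * ‖fixProj ρ N v - fixProj ρ R v‖ ^ 2 := by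
    simp [hnorm]
  rw [← hcard]
  rw [← hsum] at hle ⊢
  have h0 := norm_nonneg (∑ i, x i)
  have h1 : ‖∑ i, x i‖ ≤ ‖v‖ := by
    by_contra hcon
    push Not at hcon
    nlinarith [norm_nonneg v]
  exact pow_le_pow_left₀ h0 h1 2

end FixedVectors

/-! ### Column stabilisers in the general linear group -/

section ColumnStabilizers

variable {ι F : Type*} [Fintype ι] [DecidableEq ι] [Field F]

/-- The invertible matrices whose columns outside `S` are those of the identity matrix. -/
def colFix (F : Type*) [Field F] (S : Finset ι) : Subgroup (Matrix ι ι F)ˣ where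
  carrier := {g | ∀ p ∉ S, (g : Matrix ι ι F).mulVec (Pi.single p 1) = Pi.single p 1}
  mul_mem' {g h} hg hh p hp := by
    rw [Units.val_mul, ← Matrix.mulVec_mulVec, hh p hp, hg p hp]
  one_mem' p _ := by rw [Units.val_one, Matrix.one_mulVec]
  inv_mem' {g} hg p hp := by
    conv_lhs => rw [← hg p hp]
    rw [Matrix.mulVec_mulVec, Units.inv_mul, Matrix.one_mulVec]

theorem mem_colFix {S : Finset ι} {g : (Matrix ι ι F)ˣ} :
    g ∈ colFix F S ↔ ∀ p ∉ S, (g : Matrix ι ι F).mulVec (Pi.single p 1) = Pi.single p 1 := Iff.rfl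

theorem mem_colFix_iff {S : Finset ι} {g : (Matrix ι ι F)ˣ} :
    g ∈ colFix F S ↔ ∀ p ∉ S, ∀ i, (g : Matrix ι ι F) i p = (1 : Matrix ι ι F) i p := by
  refine forall₂_congr fun p _ => ?_
  rw [Matrix.mulVec_single_one, funext_iff]
  simp [Matrix.col, Matrix.one_apply, Pi.single_apply]

theorem colFix_mono {S T : Finset ι} (h : S ⊆ T) : colFix F S ≤ colFix F T :=
  fun _ hg p hp => hg p fun hpS => hp (h hpS)

/-- The stabiliser of the columns outside `S` is transitive on the vectors which are not supported
outside `S`. -/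
theorem exists_mem_colFix_mulVec_eq {S : Finset ι} {p : ι} (hp : p ∈ S) {u : ι → F}
    (hu : ∃ i ∈ S, u i ≠ 0) :
    ∃ g ∈ colFix F S, (g : Matrix ι ι F).mulVec (Pi.single p 1) = u := by
  have key : ∀ u : ι → F, u p ≠ 0 →
      ∃ g ∈ colFix F S, (g : Matrix ι ι F).mulVec (Pi.single p 1) = u := by
    intro u hu
    have hdet : (Matrix.updateCol (1 : Matrix ι ι F) p u).det ≠ 0 := by
      rwa [← Matrix.cramer_apply, Matrix.cramer_one]
    refine ⟨Matrix.GeneralLinearGroup.mkOfDetNeZero _ hdet, fun i hi => ?_, ?_⟩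
    · have hip : i ≠ p := fun h => hi (h ▸ hp)
      change (Matrix.updateCol (1 : Matrix ι ι F) p u).mulVec _ = _
      ext k
      rw [Matrix.mulVec_single_one, Matrix.col_apply, Matrix.updateCol_ne hip, Matrix.one_apply,
        Pi.single_apply]
    · change (Matrix.updateCol (1 : Matrix ι ι F) p u).mulVec _ = _
      ext k
      rw [Matrix.mulVec_single_one, Matrix.col_apply, Matrix.updateCol_self]
  -- If u p = 0 the identity with column p replaced by u is singular. Instead reach u - u i • e_p,
  -- whose entry at p is nonzero, and add its coordinate i to coordinate p by a transvection.
  by_cases hup : u p = 0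
  · obtain ⟨i, hi, hui⟩ := hu
    have hip : p ≠ i := fun h => hui (h ▸ hup)
    obtain ⟨g, hg, hgu⟩ := key (u - Pi.single p (u i)) (by simpa [hup] using hui)
    have hdet : (Matrix.transvection p i (1 : F)).det ≠ 0 := by
      rw [Matrix.det_transvection_of_ne _ _ hip]; exact one_ne_zero
    have ht (w : ι → F) : ((Matrix.GeneralLinearGroup.mkOfDetNeZero _ hdet :
        (Matrix ι ι F)ˣ) : Matrix ι ι F).mulVec w = w + Pi.single p (w i) := by
      change (Matrix.transvection p i (1 : F)).mulVec w = _
      rw [Matrix.transvection, Matrix.add_mulVec, Matrix.one_mulVec, Matrix.single_mulVec]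
      ext k
      simp [Pi.single_apply, Function.update_apply]
    refine ⟨Matrix.GeneralLinearGroup.mkOfDetNeZero _ hdet * g,
      Subgroup.mul_mem _ (fun k hk => ?_) hg, ?_⟩
    · have hki : i ≠ k := fun h => hk (h ▸ hi)
      rw [ht, Pi.single_eq_of_ne hki, Pi.single_zero, add_zero]
    · rw [Units.val_mul, ← Matrix.mulVec_mulVec, hgu, ht]
      ext k
      simp [Pi.single_apply, hip.symm]
  · exact key u hup

theorem mulVec_eq_self_of_mem_colFix {S : Finset ι} {g : (Matrix ι ι F)ˣ} (hg : g ∈ colFix F S)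
    {u : ι → F} (hu : ∀ i ∈ S, u i = 0) : (g : Matrix ι ι F).mulVec u = u := by
  have h : u = ∑ i, u i • (Pi.single i 1 : ι → F) := by
    ext k; simp [Finset.sum_apply, Pi.single_apply]
  rw [h, Matrix.mulVec_sum]
  refine Finset.sum_congr rfl fun i _ => ?_
  by_cases hi : i ∈ S
  · rw [hu i hi, zero_smul, Matrix.mulVec_zero]
  · rw [Matrix.mulVec_smul, hg i hi]

theorem exists_mulVec_ne_zero {S : Finset ι} {g : (Matrix ι ι F)ˣ} (hg : g ∈ colFix F S)
    {u : ι → F} (hu : ∃ i ∈ S, u i ≠ 0) : ∃ i ∈ S, (g : Matrix ι ι F).mulVec u i ≠ 0 := by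
  by_contra! hcon
  have h := mulVec_eq_self_of_mem_colFix (Subgroup.inv_mem _ hg) hcon
  rw [Matrix.mulVec_mulVec, Units.inv_mul, Matrix.one_mulVec] at h
  obtain ⟨i, hi, hui⟩ := hu
  exact hui (by rw [h]; exact hcon i hi)

theorem card_vanishing_mul [Fintype F] [DecidableEq F] (S : Finset ι) :
    (Finset.univ.filter fun u : ι → F => ∀ p ∈ S, u p = 0).card * Fintype.card F ^ S.card =
      Fintype.card F ^ Fintype.card ι := by
  have h : (Finset.univ.filter fun u : ι → F => ∀ p ∈ S, u p = 0) =
      Fintype.piFinset fun p => if p ∈ S then {0} else Finset.univ := by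
    ext u
    simp only [Finset.mem_filter, Finset.mem_univ, true_and, Fintype.mem_piFinset]
    refine forall_congr' fun p => ?_
    by_cases hp : p ∈ S <;> simp [hp]
  rw [h, Fintype.card_piFinset, ← Finset.card_univ (α := ι),
    ← Finset.prod_const, ← Finset.prod_const]
  rw [← Finset.prod_subset (Finset.subset_univ Sᶜ) (fun p _ hp => by simp_all)]
  rw [← Finset.prod_compl_mul_prod S (fun _ => Fintype.card F)]
  congr 1
  exact Finset.prod_congr rfl fun p hp => by simp_all

end ColumnStabilizers

/-! ### Projections as averages over orbits of column stabilisers -/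

section OrbitAverages

variable {ι F : Type*} [Fintype ι] [DecidableEq ι] [Field F] [Fintype F]
  {V : Type*} [NormedAddCommGroup V] [InnerProductSpace ℝ V]

/-- The mean over B is a mixture of the means over A and over B \ A, the latter with weight the
missing proportion, and two means differ by at most 2C. -/
theorem norm_inv_smul_sum_sub_le {α : Type*} [DecidableEq α] {A B : Finset α} (hAB : A ⊆ B)
    (hA : A.Nonempty) (Φ : α → V) {C : ℝ} (hΦ : ∀ a ∈ B, ‖Φ a‖ ≤ C) :
    ‖(A.card : ℝ)⁻¹ • ∑ a ∈ A, Φ a - (B.card : ℝ)⁻¹ • ∑ a ∈ B, Φ a‖ ≤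
      2 * (((B.card : ℝ) - A.card) / B.card) * C := by
  have hA0 : (0 : ℝ) < A.card := by exact_mod_cast hA.card_pos
  have hB0 : (0 : ℝ) < B.card := by exact_mod_cast (hA.mono hAB).card_pos
  have hle : (A.card : ℝ) ≤ B.card := by exact_mod_cast Finset.card_le_card hAB
  have h1 : ‖∑ a ∈ A, Φ a‖ ≤ A.card * C := by
    simpa using norm_sum_le_of_le A fun a ha => hΦ a (hAB ha)
  have h2 : ‖∑ a ∈ B \ A, Φ a‖ ≤ ((B.card : ℝ) - A.card) * C := by
    have := norm_sum_le_of_le (B \ A) fun a ha => hΦ a (Finset.sdiff_subset ha)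
    rwa [Finset.sum_const, Finset.card_sdiff_of_subset hAB, nsmul_eq_mul,
      Nat.cast_sub (Finset.card_le_card hAB)] at this
  rw [← Finset.sum_sdiff hAB, smul_add]
  have h3 : (A.card : ℝ)⁻¹ • ∑ a ∈ A, Φ a -
      ((B.card : ℝ)⁻¹ • ∑ a ∈ B \ A, Φ a + (B.card : ℝ)⁻¹ • ∑ a ∈ A, Φ a) =
      ((A.card : ℝ)⁻¹ - (B.card : ℝ)⁻¹) • ∑ a ∈ A, Φ a - (B.card : ℝ)⁻¹ • ∑ a ∈ B \ A, Φ a := by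
    rw [sub_smul]; abel
  rw [h3]
  have h4 : (0 : ℝ) ≤ (A.card : ℝ)⁻¹ - (B.card : ℝ)⁻¹ :=
    sub_nonneg.2 (inv_anti₀ hA0 hle)
  calc _ ≤ ‖((A.card : ℝ)⁻¹ - (B.card : ℝ)⁻¹) • ∑ a ∈ A, Φ a‖ +
        ‖(B.card : ℝ)⁻¹ • ∑ a ∈ B \ A, Φ a‖ := norm_sub_le _ _
    _ ≤ ((A.card : ℝ)⁻¹ - (B.card : ℝ)⁻¹) * (A.card * C) +
        (B.card : ℝ)⁻¹ * (((B.card : ℝ) - A.card) * C) := by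
      rw [norm_smul, norm_smul, Real.norm_of_nonneg h4, Real.norm_of_nonneg (inv_pos.2 hB0).le]
      gcongr
    _ = _ := by field_simp; ring

variable [FiniteDimensional ℝ V]

/-- A vector fixed by the stabiliser of `e_{p}` in the column stabiliser of `S` has nearly the same
projection for the column stabiliser of `S` and for that of a subset. -/
theorem norm_fixProj_colFix_sub_le (ρ : (Matrix ι ι F)ˣ →* (V ≃ₗᵢ[ℝ] V)) {S' S : Finset ι}
    (hS : S' ⊆ S) {p : ι} (hp : p ∈ S) {a : (Matrix ι ι F)ˣ} (ha : a ∈ colFix F S)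
    (hap : ∃ i ∈ S', (a : Matrix ι ι F) i p ≠ 0) {x : V}
    (hx : x ∈ fixedSpace ρ (colFix F (S.erase p) : Set (Matrix ι ι F)ˣ)) :
    ‖fixProj ρ (colFix F S' : Set (Matrix ι ι F)ˣ) (ρ a x) -
      fixProj ρ (colFix F S : Set (Matrix ι ι F)ˣ) x‖ ≤
      2 / (Fintype.card F : ℝ) ^ S'.card * ‖x‖ := by
  classical
  let e : ι → F := Pi.single p 1
  have hsel : ∀ u : ι → F, (∃ i ∈ S, u i ≠ 0) →
      ∃ g : (Matrix ι ι F)ˣ, g ∈ colFix F S ∧ (g : Matrix ι ι F).mulVec e = u :=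
    fun u hu => exists_mem_colFix_mulVec_eq hp hu
  choose! s hsS hse using hsel
  -- Since `colFix F (S.erase p)` is the stabiliser of e_p in `colFix F S` and fixes x, the vector ρ
  -- g x depends only on u = g e_p. This makes Φ an equivariant function on the orbit `Ω S`.
  set Φ : (ι → F) → V := fun u => ρ (s u) x with hΦ
  have hval (g : (Matrix ι ι F)ˣ) (hg : g ∈ colFix F S) :
      ∃ i ∈ S, (g : Matrix ι ι F).mulVec e i ≠ 0 :=
    exists_mulVec_ne_zero hg ⟨p, hp, by simp [e]⟩
  have hΦeq (g : (Matrix ι ι F)ˣ) (hg : g ∈ colFix F S) :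
      Φ ((g : Matrix ι ι F).mulVec e) = ρ g x := by
    have h1 := hse _ (hval g hg)
    have h2 := hsS _ (hval g hg)
    set k := s ((g : Matrix ι ι F).mulVec e) with hk
    have h3 : g⁻¹ * k ∈ colFix F (S.erase p) := by
      intro i hi
      by_cases hip : i = p
      · subst hip
        rw [Units.val_mul, ← Matrix.mulVec_mulVec]
        change (g⁻¹ : (Matrix ι ι F)ˣ).val.mulVec ((k : Matrix ι ι F).mulVec e) = e
        rw [h1, Matrix.mulVec_mulVec, Units.inv_mul, Matrix.one_mulVec]
      · exact Subgroup.mul_mem _ (Subgroup.inv_mem _ hg) h2 i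
          fun hiS => hi (Finset.mem_erase.2 ⟨hip, hiS⟩)
    have h4 := hx _ h3
    calc ρ k x = ρ g (ρ (g⁻¹ * k) x) := by rw [← rep_mul_apply, mul_inv_cancel_left]
      _ = ρ g x := by rw [h4]
  set Ω : Finset ι → Finset (ι → F) :=
    fun T => Finset.univ.filter fun u => ∃ i ∈ T, u i ≠ 0 with hΩ
  have hmem (T : Finset ι) (u : ι → F) : u ∈ Ω T ↔ ∃ i ∈ T, u i ≠ 0 := by simp [hΩ]
  have hΩmono (T : Finset ι) (hT : T ⊆ S) : Ω T ⊆ Ω S := by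
    intro u hu
    obtain ⟨i, hi, h⟩ := (hmem _ _).1 hu
    exact (hmem _ _).2 ⟨i, hT hi, h⟩
  have hst (T : Finset ι) (hT : T ⊆ S) (k : (Matrix ι ι F)ˣ) (hk : k ∈ colFix F T) (u : ι → F)
      (hu : u ∈ Ω T) :
      (k : Matrix ι ι F).mulVec u ∈ Ω T ∧ ρ k (Φ u) = Φ ((k : Matrix ι ι F).mulVec u) := by
    refine ⟨(hmem _ _).2 (exists_mulVec_ne_zero hk ((hmem _ _).1 hu)), ?_⟩
    have h1 := (hmem _ _).1 (hΩmono T hT hu)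
    conv_rhs => rw [← hse u h1]
    rw [Matrix.mulVec_mulVec, ← Units.val_mul,
      hΦeq _ (Subgroup.mul_mem _ (colFix_mono hT hk) (hsS u h1)), rep_mul_apply]
  -- the sum over an orbit is a multiple of the projection
  have main (T : Finset ι) (hT : T ⊆ S) (g : (Matrix ι ι F)ˣ) (hg : g ∈ colFix F S)
      (hgT : ∃ i ∈ T, (g : Matrix ι ι F).mulVec e i ≠ 0) :
      fixProj ρ (colFix F T : Set (Matrix ι ι F)ˣ) (ρ g x) =
        ((Ω T).card : ℝ)⁻¹ • ∑ u ∈ Ω T, Φ u := by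
    have hT0 : ((Ω T).card : ℝ) ≠ 0 := by
      have : 0 < (Ω T).card := Finset.card_pos.2 ⟨_, (hmem _ _).2 hgT⟩
      positivity
    have hfix : ∑ u ∈ Ω T, Φ u ∈ fixedSpace ρ (colFix F T : Set (Matrix ι ι F)ˣ) := by
      intro k hk
      rw [map_sum]
      refine Finset.sum_bij (fun u _ => (k : Matrix ι ι F).mulVec u)
        (fun u hu => (hst T hT k hk u hu).1) (fun u _ w _ h => ?_) (fun u hu => ?_)
        (fun u hu => (hst T hT k hk u hu).2)
      · have := congrArg (fun y => (k⁻¹ : (Matrix ι ι F)ˣ).val.mulVec y) h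
        simpa [Matrix.mulVec_mulVec] using this
      · exact ⟨_, (hst T hT _ (Subgroup.inv_mem _ hk) u hu).1, by simp [Matrix.mulVec_mulVec]⟩
    have hsame (u : ι → F) (hu : u ∈ Ω T) :
        fixProj ρ (colFix F T : Set (Matrix ι ι F)ˣ) (Φ u) =
          fixProj ρ (colFix F T : Set (Matrix ι ι F)ˣ) (ρ g x) := by
      obtain ⟨i, hi, hgi⟩ := hgT
      obtain ⟨l, hl, hlu⟩ := exists_mem_colFix_mulVec_eq hi ⟨i, hi, hgi⟩
      obtain ⟨l', hl', hlu'⟩ := exists_mem_colFix_mulVec_eq hi ((hmem _ _).1 hu)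
      have hk : l' * l⁻¹ ∈ colFix F T := Subgroup.mul_mem _ hl' (Subgroup.inv_mem _ hl)
      have h1 : u = ((l' * l⁻¹ : (Matrix ι ι F)ˣ) : Matrix ι ι F).mulVec
          ((g : Matrix ι ι F).mulVec e) := by
        rw [← hlu, Units.val_mul, ← Matrix.mulVec_mulVec, Matrix.mulVec_mulVec _ _ l.val,
          Units.inv_mul, Matrix.one_mulVec, hlu']
      rw [h1, ← (hst T hT _ hk _ ((hmem _ _).2 ⟨i, hi, hgi⟩)).2, hΦeq g hg,
        fixProj_apply_of_mem ρ hk]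
    rw [← fixProj_eq_self ρ hfix, map_sum, Finset.sum_congr rfl hsame, Finset.sum_const,
      ← Nat.cast_smul_eq_nsmul ℝ, smul_smul, inv_mul_cancel₀ hT0, one_smul]
  have hae : (a : Matrix ι ι F).mulVec e = fun i => (a : Matrix ι ι F) i p := by
    ext i; rw [Matrix.mulVec_single_one, Matrix.col_apply]
  have h1 := main S' hS a ha (by simpa only [hae] using hap)
  have h2 := main S subset_rfl 1 (Subgroup.one_mem _) (hval 1 (Subgroup.one_mem _))
  rw [map_one, LinearIsometryEquiv.coe_one, id] at h2
  rw [h1, h2]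
  have hne : (Ω S').Nonempty := ⟨_, (hmem _ _).2 (by simpa only [hae] using hap)⟩
  refine (norm_inv_smul_sum_sub_le (hΩmono S' hS) hne Φ (C := ‖x‖) fun u _ => ?_).trans ?_
  · rw [hΦ, LinearIsometryEquiv.norm_map]
  gcongr
  -- A proportion q^(-|T|) of all vectors vanishes on T. Hence the proportion of `Ω S` outside `Ω
  -- S'` is (1/A - 1/B) / (1 - 1/B) ≤ 1/A, with A, B the powers of q for S', S.
  have hcardΩ (T : Finset ι) : ((Ω T).card : ℝ) =
      (Fintype.card F : ℝ) ^ Fintype.card ι - (Fintype.card F : ℝ) ^ Fintype.card ι /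
        (Fintype.card F : ℝ) ^ T.card := by
    have hq : (0 : ℝ) < Fintype.card F := by exact_mod_cast Fintype.card_pos
    have h3 := card_vanishing_mul (F := F) T
    have h4 : (Ω T).card + (Finset.univ.filter fun u : ι → F => ∀ p ∈ T, u p = 0).card =
        Fintype.card F ^ Fintype.card ι := by
      have h5 : (Finset.univ.filter fun u : ι → F => ∀ p ∈ T, u p = 0) = (Ω T)ᶜ := by
        ext u; simp [hΩ]
      rw [h5, Finset.card_add_card_compl, Fintype.card_fun]
    have h3' : ((Finset.univ.filter fun u : ι → F => ∀ p ∈ T, u p = 0).card : ℝ) *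
        (Fintype.card F : ℝ) ^ T.card = (Fintype.card F : ℝ) ^ Fintype.card ι := by
      exact_mod_cast h3
    have h4' : ((Ω T).card : ℝ) +
        (Finset.univ.filter fun u : ι → F => ∀ p ∈ T, u p = 0).card =
        (Fintype.card F : ℝ) ^ Fintype.card ι := by exact_mod_cast h4
    rw [← h3', mul_div_cancel_right₀ _ (by positivity), h3', ← h4']
    ring
  have hpos : (0 : ℝ) < (Ω S).card := by
    exact_mod_cast (hne.mono (hΩmono S' hS)).card_pos
  have hq : (0 : ℝ) < Fintype.card F := by exact_mod_cast Fintype.card_pos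
  have hpos' : (0 : ℝ) < (Ω S').card := by exact_mod_cast hne.card_pos
  have hq1 : (1 : ℝ) ≤ Fintype.card F := by exact_mod_cast Fintype.card_pos
  rw [mul_div_assoc', div_le_div_iff₀ hpos (by positivity)]
  rw [hcardΩ] at hpos hpos' ⊢
  rw [hcardΩ]
  set Q := (Fintype.card F : ℝ) ^ Fintype.card ι
  set A := (Fintype.card F : ℝ) ^ S'.card
  set B := (Fintype.card F : ℝ) ^ S.card
  have hA1 : 1 ≤ A := one_le_pow₀ hq1
  have hAB : A ≤ B := pow_le_pow_right₀ hq1 (Finset.card_le_card hS)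
  have hQ : 0 < Q := by positivity
  have hB : 0 < B := by linarith
  have hQA : Q / A * A = Q := div_mul_cancel₀ _ (by linarith)
  have h6 : Q / B ≤ Q / B * A := le_mul_of_one_le_right (by positivity) hA1
  nlinarith

theorem norm_fixProj_colFix_sub_le' (ρ : (Matrix ι ι F)ˣ →* (V ≃ₗᵢ[ℝ] V)) {S' S : Finset ι}
    (hS : S' ⊆ S) {p : ι} (hp : p ∈ S') {x : V}
    (hx : x ∈ fixedSpace ρ (colFix F (S.erase p) : Set (Matrix ι ι F)ˣ)) :
    ‖fixProj ρ (colFix F S' : Set (Matrix ι ι F)ˣ) x -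
      fixProj ρ (colFix F S : Set (Matrix ι ι F)ˣ) x‖ ≤
      2 / (Fintype.card F : ℝ) ^ S'.card * ‖x‖ := by
  have h := norm_fixProj_colFix_sub_le ρ hS (hS hp) (a := 1) (Subgroup.one_mem _)
    ⟨p, hp, by rw [Units.val_one, Matrix.one_apply_eq]; exact one_ne_zero⟩ hx
  rwa [map_one, LinearIsometryEquiv.coe_one, id] at h

end OrbitAverages

/-! ### Expansion in the general linear group of rank four -/

section AbelianUnipotent

variable {F : Type*} [Field F] [Fintype F]
  {V G : Type*} [NormedAddCommGroup V] [InnerProductSpace ℝ V] [FiniteDimensional ℝ V] [Group G]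

theorem le_div_mul_of_sq_mul_sq_le {q a b : ℝ} (hq : 0 < q) (hb : 0 ≤ b)
    (h : q ^ 2 * a ^ 2 ≤ b ^ 2) : a ≤ 1 / q * b := by
  rw [one_div, ← div_eq_inv_mul, le_div_iff₀ hq]
  refine le_of_sq_le_sq ?_ hb
  linarith [mul_pow a q 2, mul_comm (q ^ 2) (a ^ 2)]

/-- The projections for the diagonal and for all `2 × 2` matrices are close on vectors which are
fixed by elements that realise the multiplications by elements of `SL₂` on both sides. -/
theorem norm_fixProj_diag_sub_le (ρ : G →* (V ≃ₗᵢ[ℝ] V)) (τ : Matrix (Fin 2) (Fin 2) F → G)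
    (hτ : ∀ X Y, τ (X + Y) = τ X * τ Y) {v : V}
    (hv : ∀ g h : Matrix (Fin 2) (Fin 2) F, g.det = 1 → h.det = 1 →
      ∃ k, ρ k v = v ∧ ∀ X, k * τ X * k⁻¹ = τ (g * X * h)) :
    ‖fixProj ρ (τ '' {X | X 0 1 = 0 ∧ X 1 0 = 0}) v - fixProj ρ (Set.range τ) v‖ ≤
      2 / Fintype.card F * ‖v‖ := by
  classical
  have hq : (0 : ℝ) < Fintype.card F := by exact_mod_cast Fintype.card_pos
  have hcomm : ∀ r ∈ Set.range τ, ∀ r' ∈ Set.range τ, r * r' = r' * r := by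
    rintro _ ⟨X, rfl⟩ _ ⟨Y, rfl⟩
    rw [← hτ, ← hτ, add_comm]
  have hconj (k : G) (g h g' h' : Matrix (Fin 2) (Fin 2) F)
      (hk : ∀ X, k * τ X * k⁻¹ = τ (g * X * h)) (hg : g * g' = 1) (hh : h' * h = 1)
      (X : Matrix (Fin 2) (Fin 2) F) : k⁻¹ * τ X * k = τ (g' * X * h') := by
    have h1 := hk (g' * X * h')
    rw [show g * (g' * X * h') * h = (g * g') * X * (h' * h) by
      simp only [Matrix.mul_assoc], hg, hh,
      Matrix.one_mul, Matrix.mul_one] at h1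
    rw [← h1]; group
  -- Pass from diagonal to upper triangular matrices with the q² conjugates by pairs of upper
  -- unitriangular matrices, so the error is 1/q; the lower unitriangular pairs then give all
  -- matrices with the same error.
  have step1 : ‖fixProj ρ (τ '' {X | X 0 1 = 0 ∧ X 1 0 = 0}) v -
      fixProj ρ (τ '' {X | X 1 0 = 0}) v‖ ≤ 1 / Fintype.card F * ‖v‖ := by
    refine le_div_mul_of_sq_mul_sq_le hq (norm_nonneg v) ?_
    have h1 (i : F × F) := hv !![1, i.1; 0, 1] !![1, i.2; 0, 1] (by simp) (by simp)
    choose k hkv hk using h1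
    have h2 := card_mul_norm_fixProj_sub_sq_le ρ k (N := τ '' {X | X 0 1 = 0 ∧ X 1 0 = 0})
      (R := τ '' {X | X 1 0 = 0}) hkv ?_ ?_ ?_ ?_ ?_
    · simpa [Fintype.card_prod, sq] using h2
    · rintro i _ ⟨X, hX, rfl⟩
      refine ⟨_, ?_, (hk i X).symm⟩
      simp only [Set.mem_ofPred_eq, Matrix.mul_apply, Fin.sum_univ_two] at hX ⊢
      simp [hX]
    · rintro i _ ⟨X, hX, rfl⟩
      refine ⟨_, ?_, (hconj _ _ _ !![1, -i.1; 0, 1] !![1, -i.2; 0, 1] (hk i)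
        (by simp [Matrix.one_fin_two]) (by simp [Matrix.one_fin_two]) X).symm⟩
      simp only [Set.mem_ofPred_eq, Matrix.mul_apply, Fin.sum_univ_two] at hX ⊢
      simp [hX]
    · exact Set.image_mono fun X hX => hX.2
    · exact fun r hr r' hr' => hcomm r (Set.image_subset_range _ _ hr) r'
        (Set.image_subset_range _ _ hr')
    · rintro ⟨s, t⟩ ⟨s', t'⟩ hij _ ⟨X, hX, rfl⟩
      simp only [Set.mem_ofPred_eq] at hX
      -- Conjugation by (s, t) adds x t + s y to the upper right entry of diag(x, y). Splitting X
      -- between two conjugates is one linear equation in x, y, solvable because (s, t) ≠ (s', t').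
      obtain ⟨x, y, hxy⟩ : ∃ x y : F, x * (t - t') + y * (s - s') =
          X 0 1 - X 0 0 * t' - s' * X 1 1 := by
        by_cases ht : t = t'
        · have hs : s - s' ≠ 0 := sub_ne_zero.2 fun h => hij (by rw [h, ht])
          exact ⟨0, (X 0 1 - X 0 0 * t' - s' * X 1 1) / (s - s'), by field_simp; ring⟩
        · have ht' : t - t' ≠ 0 := sub_ne_zero.2 ht
          exact ⟨(X 0 1 - X 0 0 * t' - s' * X 1 1) / (t - t'), 0, by field_simp; ring⟩
      refine ⟨_, ⟨!![x, 0; 0, y], by simp, rfl⟩, _,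
        ⟨!![X 0 0 - x, 0; 0, X 1 1 - y], by simp, rfl⟩, ?_⟩
      rw [hk, hk, ← hτ]
      congr 1
      ext a b
      fin_cases a <;> fin_cases b
      · simp
      · simp
        linear_combination -hxy
      · simp [hX]
      · simp
  have step2 : ‖fixProj ρ (τ '' {X | X 1 0 = 0}) v - fixProj ρ (Set.range τ) v‖ ≤
      1 / Fintype.card F * ‖v‖ := by
    refine le_div_mul_of_sq_mul_sq_le hq (norm_nonneg v) ?_
    have h1 (i : F × F) := hv !![1, 0; i.1, 1] !![1, 0; i.2, 1] (by simp) (by simp)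
    choose k hkv hk using h1
    have h2 := card_mul_norm_fixProj_sub_sq_le ρ k (N := τ '' {X | X 1 0 = 0})
      (R := Set.range τ) hkv ?_ ?_ ?_ hcomm ?_
    · simpa [Fintype.card_prod, sq] using h2
    · rintro i _ ⟨X, rfl⟩
      exact ⟨_, (hk i X).symm⟩
    · rintro i _ ⟨X, rfl⟩
      exact ⟨_, (hconj _ _ _ !![1, 0; -i.1, 1] !![1, 0; -i.2, 1] (hk i)
        (by simp [Matrix.one_fin_two]) (by simp [Matrix.one_fin_two]) X).symm⟩
    · exact Set.image_subset_range _ _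
    · rintro ⟨s, t⟩ ⟨s', t'⟩ hij _ ⟨X, rfl⟩
      -- Again one linear equation, now for the lower left entry. The second summand carries the
      -- entry X 0 1, which also alters the diagonal and accounts for the correction terms.
      obtain ⟨x, y, hxy⟩ : ∃ x y : F, x * (s - s') + y * (t - t') =
          X 1 0 - t' * s' * X 0 1 - s' * (X 0 0 - X 0 1 * t') - t' * (X 1 1 - s' * X 0 1) := by
        by_cases ht : t = t'
        · have hs : s - s' ≠ 0 := sub_ne_zero.2 fun h => hij (by rw [h, ht])
          exact ⟨(X 1 0 - t' * s' * X 0 1 - s' * (X 0 0 - X 0 1 * t') -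
            t' * (X 1 1 - s' * X 0 1)) / (s - s'), 0, by field_simp; ring⟩
        · have ht' : t - t' ≠ 0 := sub_ne_zero.2 ht
          exact ⟨0, (X 1 0 - t' * s' * X 0 1 - s' * (X 0 0 - X 0 1 * t') -
            t' * (X 1 1 - s' * X 0 1)) / (t - t'), by field_simp; ring⟩
      refine ⟨_, ⟨!![x, 0; 0, y], by simp, rfl⟩, _,
        ⟨!![X 0 0 - X 0 1 * t' - x, X 0 1; 0, X 1 1 - s' * X 0 1 - y], by simp, rfl⟩, ?_⟩
      rw [hk, hk, ← hτ]
      congr 1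
      ext a b
      fin_cases a <;> fin_cases b
      · simp; ring
      · simp
      · simp
        linear_combination -hxy
      · simp; ring
  calc _ ≤ _ := norm_sub_le_norm_sub_add_norm_sub _ (fixProj ρ (τ '' {X | X 1 0 = 0}) v) _
    _ ≤ 1 / Fintype.card F * ‖v‖ + 1 / Fintype.card F * ‖v‖ := add_le_add step1 step2
    _ = _ := by ring

end AbelianUnipotent

/-! ### Two transversal Levi subgroups of GL₄ -/

section RankFour

variable {F : Type*} [Field F]

/-- The group `GL₄(F)`, as matrices with `2 × 2` blocks. -/
abbrev GLFour (F : Type*) [Field F] : Type _ := (Matrix (Fin 2 ⊕ Fin 2) (Fin 2 ⊕ Fin 2) F)ˣ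

/-- The invertible matrices which are block diagonal with respect to the fibres of `f`. -/
def leviSet (F : Type*) [Field F] {ι α : Type*} [Fintype ι] [DecidableEq ι] (f : ι → α) :
    Set (Matrix ι ι F)ˣ :=
  {g | ∀ p q, f p ≠ f q → (g : Matrix ι ι F) p q = 0}

/-- The block upper unitriangular matrix with upper right block `X`. -/
def upperUnit (X : Matrix (Fin 2) (Fin 2) F) : GLFour F where
  val := Matrix.fromBlocks 1 X 0 1
  inv := Matrix.fromBlocks 1 (-X) 0 1
  val_inv := by simp [Matrix.fromBlocks_multiply]
  inv_val := by simp [Matrix.fromBlocks_multiply]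

/-- The block lower unitriangular matrix with lower left block `X`. -/
def lowerUnit (X : Matrix (Fin 2) (Fin 2) F) : GLFour F where
  val := Matrix.fromBlocks 1 0 X 1
  inv := Matrix.fromBlocks 1 0 (-X) 1
  val_inv := by simp [Matrix.fromBlocks_multiply]
  inv_val := by simp [Matrix.fromBlocks_multiply]

/-- The block diagonal matrix with blocks `A` and `D`. -/
def diagUnit (A D : (Matrix (Fin 2) (Fin 2) F)ˣ) :
    GLFour F where
  val := Matrix.fromBlocks A 0 0 D
  inv := Matrix.fromBlocks A⁻¹.val 0 0 D⁻¹.val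
  val_inv := by simp only [Matrix.fromBlocks_multiply]; simp
  inv_val := by simp only [Matrix.fromBlocks_multiply]; simp

theorem upperUnit_add (X Y : Matrix (Fin 2) (Fin 2) F) :
    upperUnit (X + Y) = upperUnit X * upperUnit Y := by
  ext1; simp [upperUnit, Matrix.fromBlocks_multiply, add_comm]

theorem lowerUnit_add (X Y : Matrix (Fin 2) (Fin 2) F) :
    lowerUnit (X + Y) = lowerUnit X * lowerUnit Y := by
  ext1; simp [lowerUnit, Matrix.fromBlocks_multiply]

theorem diagUnit_inv (A D : (Matrix (Fin 2) (Fin 2) F)ˣ) : (diagUnit A D)⁻¹ = diagUnit A⁻¹ D⁻¹ :=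
  rfl

theorem diagUnit_mul_upperUnit (A D : (Matrix (Fin 2) (Fin 2) F)ˣ)
    (X : Matrix (Fin 2) (Fin 2) F) :
    diagUnit A D * upperUnit X * (diagUnit A D)⁻¹ = upperUnit (A.val * X * D⁻¹.val) := by
  rw [mul_inv_eq_iff_eq_mul]
  ext1
  simp [upperUnit, diagUnit, Matrix.fromBlocks_multiply, Matrix.mul_assoc]

theorem diagUnit_mul_lowerUnit (A D : (Matrix (Fin 2) (Fin 2) F)ˣ)
    (X : Matrix (Fin 2) (Fin 2) F) :
    diagUnit A D * lowerUnit X * (diagUnit A D)⁻¹ = lowerUnit (D.val * X * A⁻¹.val) := by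
  rw [mul_inv_eq_iff_eq_mul]
  ext1
  simp [lowerUnit, diagUnit, Matrix.fromBlocks_multiply, Matrix.mul_assoc]

theorem exists_upperUnit_mul_diagUnit {g : GLFour F}
    (hg : g ∈ colFix F {Sum.inr 0, Sum.inr 1}) :
    ∃ X D, g = upperUnit X * diagUnit 1 D := by
  have key : ∀ h ∈ colFix F ({Sum.inr 0, Sum.inr 1} : Finset (Fin 2 ⊕ Fin 2)),
      h.val = Matrix.fromBlocks 1 h.val.toBlocks₁₂ 0 h.val.toBlocks₂₂ := by
    intro h hh
    rw [mem_colFix_iff] at hh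
    conv_lhs => rw [← Matrix.fromBlocks_toBlocks h.val]
    congr 1 <;> ext a b
    · rw [Matrix.toBlocks₁₁, Matrix.of_apply, hh _ (by simp)]
      simp [Matrix.one_apply]
    · rw [Matrix.toBlocks₂₁, Matrix.of_apply, hh _ (by simp)]
      simp
  have h1 := g.mul_inv
  have h2 := g.inv_mul
  rw [key g hg, key _ (Subgroup.inv_mem _ hg), Matrix.fromBlocks_multiply,
    ← Matrix.fromBlocks_one, Matrix.fromBlocks_inj] at h1 h2
  simp only [Matrix.zero_mul, Matrix.mul_zero, zero_add] at h1 h2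
  obtain ⟨D, hD⟩ : ∃ D : (Matrix (Fin 2) (Fin 2) F)ˣ, D.val = g.val.toBlocks₂₂ :=
    ⟨⟨g.val.toBlocks₂₂, (g⁻¹).val.toBlocks₂₂, h1.2.2.2, h2.2.2.2⟩, rfl⟩
  refine ⟨g.val.toBlocks₁₂ * D⁻¹.val, D, ?_⟩
  ext1
  conv_lhs => rw [key g hg, ← hD]
  simp [upperUnit, diagUnit, Matrix.fromBlocks_multiply, Matrix.mul_assoc]

theorem exists_lowerUnit_mul_diagUnit {g : GLFour F}
    (hg : g ∈ colFix F {Sum.inl 0, Sum.inl 1}) :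
    ∃ X A, g = lowerUnit X * diagUnit A 1 := by
  have key : ∀ h ∈ colFix F ({Sum.inl 0, Sum.inl 1} : Finset (Fin 2 ⊕ Fin 2)),
      h.val = Matrix.fromBlocks h.val.toBlocks₁₁ 0 h.val.toBlocks₂₁ 1 := by
    intro h hh
    rw [mem_colFix_iff] at hh
    conv_lhs => rw [← Matrix.fromBlocks_toBlocks h.val]
    congr 1 <;> ext a b
    · rw [Matrix.toBlocks₁₂, Matrix.of_apply, hh _ (by simp)]
      simp
    · rw [Matrix.toBlocks₂₂, Matrix.of_apply, hh _ (by simp)]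
      simp [Matrix.one_apply]
  have h1 := g.mul_inv
  have h2 := g.inv_mul
  rw [key g hg, key _ (Subgroup.inv_mem _ hg), Matrix.fromBlocks_multiply,
    ← Matrix.fromBlocks_one, Matrix.fromBlocks_inj] at h1 h2
  simp only [Matrix.zero_mul, Matrix.mul_zero, add_zero] at h1 h2
  obtain ⟨A, hA⟩ : ∃ A : (Matrix (Fin 2) (Fin 2) F)ˣ, A.val = g.val.toBlocks₁₁ :=
    ⟨⟨g.val.toBlocks₁₁, (g⁻¹).val.toBlocks₁₁, h1.1, h2.1⟩, rfl⟩
  refine ⟨g.val.toBlocks₂₁ * A⁻¹.val, A, ?_⟩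
  ext1
  conv_lhs => rw [key g hg, ← hA]
  simp [lowerUnit, diagUnit, Matrix.fromBlocks_multiply, Matrix.mul_assoc]

variable [Fintype F]
  {V : Type*} [NormedAddCommGroup V] [InnerProductSpace ℝ V] [FiniteDimensional ℝ V]

/-- Projecting a vector fixed by the Levi subgroup `GL₂ × GL₂` of `GL₄` to the vectors fixed by the
transversal Levi subgroup nearly gives its projection to the invariants of `GL₄`. -/
theorem norm_fixProj_leviSet_sub_le
    (ρ : GLFour F →* (V ≃ₗᵢ[ℝ] V)) {v : V}
    (hv : v ∈ fixedSpace ρ (leviSet F Sum.isLeft)) :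
    ‖fixProj ρ (leviSet F (Sum.elim id id)) v - fixProj ρ Set.univ v‖ ≤
      (6 / Fintype.card F + 2 / (Fintype.card F : ℝ) ^ 2) * ‖v‖ := by
  set H : Set (GLFour F) := leviSet F (Sum.elim id id) with hH
  set T : Set (GLFour F) :=
    Set.range fun AD : (Matrix (Fin 2) (Fin 2) F)ˣ × (Matrix (Fin 2) (Fin 2) F)ˣ =>
      diagUnit AD.1 AD.2 with hT
  have hTH : T ⊆ leviSet F Sum.isLeft := by
    rintro _ ⟨⟨A, D⟩, rfl⟩ (p | p) (q | q) hpq <;> simp_all [diagUnit]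
  replace hv : v ∈ fixedSpace ρ T := fixedSpace_anti ρ hTH hv
  have hTmem (A D : (Matrix (Fin 2) (Fin 2) F)ˣ) : diagUnit A D ∈ T := ⟨(A, D), rfl⟩
  have hdU (X : Matrix (Fin 2) (Fin 2) F) (hX : X 0 1 = 0 ∧ X 1 0 = 0) : upperUnit X ∈ H := by
    rintro (p | p) (q | q) hpq <;> fin_cases p <;> fin_cases q <;>
      simp_all [upperUnit]
  have hdL (X : Matrix (Fin 2) (Fin 2) F) (hX : X 0 1 = 0 ∧ X 1 0 = 0) : lowerUnit X ∈ H := by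
    rintro (p | p) (q | q) hpq <;> fin_cases p <;> fin_cases q <;>
      simp_all [lowerUnit]
  have hUH : upperUnit '' {X : Matrix (Fin 2) (Fin 2) F | X 0 1 = 0 ∧ X 1 0 = 0} ⊆ H := by
    rintro _ ⟨X, hX, rfl⟩; exact hdU X hX
  have hLH : lowerUnit '' {X : Matrix (Fin 2) (Fin 2) F | X 0 1 = 0 ∧ X 1 0 = 0} ⊆ H := by
    rintro _ ⟨X, hX, rfl⟩; exact hdL X hX
  have hunit (g : Matrix (Fin 2) (Fin 2) F) (hg : g.det = 1) :
      ∃ A : (Matrix (Fin 2) (Fin 2) F)ˣ, A.val = g :=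
    (Matrix.isUnit_iff_isUnit_det g).2 (by rw [hg]; exact isUnit_one)
  -- first add the lower unipotent radical
  set u := fixProj ρ (Set.range lowerUnit) v with hu
  -- H contains the part of the lower unipotent radical with diagonal X, so P_H absorbs the
  -- projection for that part, which is within 2/q of the one for the whole radical.
  have h1 : ‖fixProj ρ H v - fixProj ρ H u‖ ≤ 2 / Fintype.card F * ‖v‖ := by
    have h := norm_fixProj_diag_sub_le ρ lowerUnit lowerUnit_add (v := v) ?_
    · rw [← fixProj_fixProj_of_subset' ρ hLH, ← map_sub]
      exact (norm_fixProj_le ρ _).trans h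
    · intro g h hg hh
      obtain ⟨D, hD⟩ := hunit g hg
      obtain ⟨A, hA⟩ := hunit h hh
      refine ⟨diagUnit A⁻¹ D, hv _ ⟨(A⁻¹, D), rfl⟩, fun X => ?_⟩
      rw [diagUnit_mul_lowerUnit, hD, inv_inv, hA]
  have huT : u ∈ fixedSpace ρ T := by
    refine fixProj_mem_of_normalizes ρ ?_ ?_ hv
    · rintro _ ⟨⟨A, D⟩, rfl⟩ _ ⟨X, rfl⟩
      exact ⟨_, (diagUnit_mul_lowerUnit A D X).symm⟩
    · rintro _ ⟨⟨A, D⟩, rfl⟩ _ ⟨X, rfl⟩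
      refine ⟨_, ((diagUnit_mul_lowerUnit A⁻¹ D⁻¹ X).symm.trans ?_)⟩
      rw [← diagUnit_inv, inv_inv]
  have huv : ‖u‖ ≤ ‖v‖ := norm_fixProj_le ρ _
  -- then the upper one
  set w := fixProj ρ (Set.range upperUnit) u with hw
  have h2 : ‖fixProj ρ H u - fixProj ρ H w‖ ≤ 2 / Fintype.card F * ‖u‖ := by
    have h := norm_fixProj_diag_sub_le ρ upperUnit upperUnit_add (v := u) ?_
    · rw [← fixProj_fixProj_of_subset' ρ hUH, ← map_sub]
      exact (norm_fixProj_le ρ _).trans h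
    · intro g h hg hh
      obtain ⟨A, hA⟩ := hunit g hg
      obtain ⟨D, hD⟩ := hunit h hh
      refine ⟨diagUnit A D⁻¹, huT _ ⟨(A, D⁻¹), rfl⟩, fun X => ?_⟩
      rw [diagUnit_mul_upperUnit, hA, inv_inv, hD]
  have hwT : w ∈ fixedSpace ρ T := by
    refine fixProj_mem_of_normalizes ρ ?_ ?_ huT
    · rintro _ ⟨⟨A, D⟩, rfl⟩ _ ⟨X, rfl⟩
      exact ⟨_, (diagUnit_mul_upperUnit A D X).symm⟩
    · rintro _ ⟨⟨A, D⟩, rfl⟩ _ ⟨X, rfl⟩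
      refine ⟨_, ((diagUnit_mul_upperUnit A⁻¹ D⁻¹ X).symm.trans ?_)⟩
      rw [← diagUnit_inv, inv_inv]
  set R : Finset (Fin 2 ⊕ Fin 2) := {Sum.inr 0, Sum.inr 1} with hR
  -- The group `colFix F R` is the upper radical times the second GL₂ factor, and w is already fixed
  -- by that factor. Likewise u is fixed by the lower radical and the first GL₂, which is what the
  -- orbit lemma needs.
  have hwR : w = fixProj ρ (colFix F R : Set (GLFour F)) u := by
    have h : w ∈ fixedSpace ρ (colFix F R : Set (GLFour F)) := by
      intro g hg
      obtain ⟨X, D, rfl⟩ := exists_upperUnit_mul_diagUnit hg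
      rw [rep_mul_apply, hwT _ (hTmem 1 D), hw, apply_fixProj ρ (Set.mem_range_self X)]
    rw [← fixProj_eq_self ρ h, hw, fixProj_fixProj_of_subset' ρ]
    rintro _ ⟨X, rfl⟩
    rw [SetLike.mem_coe, mem_colFix_iff]
    rintro (p | p) hp i
    · rcases i with i | i <;> simp [upperUnit, Matrix.one_apply]
    · fin_cases p <;> simp [hR] at hp
  set L : Finset (Fin 2 ⊕ Fin 2) := {Sum.inl 0, Sum.inl 1, Sum.inr 0} with hL
  have huL : u ∈ fixedSpace ρ (colFix F (L.erase (Sum.inr 0)) : Set (GLFour F)) := by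
    have : L.erase (Sum.inr 0) = {Sum.inl 0, Sum.inl 1} := by rw [hL]; decide
    rw [this]
    intro g hg
    obtain ⟨X, A, rfl⟩ := exists_lowerUnit_mul_diagUnit hg
    rw [rep_mul_apply, huT _ (hTmem A 1), hu, apply_fixProj ρ (Set.mem_range_self X)]
  -- The full group is reached in two stages, freeing column inr 0 and then column inr 1. The
  -- respective comparison sets {inr 0} and R have one and two elements, hence the errors 2/q and
  -- 2/q².
  set x := fixProj ρ (colFix F L : Set (GLFour F)) u with hx
  have h3 : ‖w - fixProj ρ (colFix F R : Set (GLFour F)) x‖ ≤ 2 / Fintype.card F * ‖u‖ := by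
    have h := norm_fixProj_colFix_sub_le' ρ (S' := {Sum.inr 0}) (S := L) (by rw [hL]; decide)
      (Finset.mem_singleton_self _) huL
    rw [Finset.card_singleton, pow_one] at h
    have hsub : (colFix F ({Sum.inr 0} : Finset (Fin 2 ⊕ Fin 2)) : Set (GLFour F)) ⊆
        colFix F R :=
      by exact SetLike.coe_subset_coe.2 (colFix_mono (by rw [hR]; decide))
    rw [hwR, ← fixProj_fixProj_of_subset' ρ hsub, ← map_sub]
    exact (norm_fixProj_le ρ _).trans h
  have hxu : ‖x‖ ≤ ‖u‖ := norm_fixProj_le ρ _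
  have huniv : (colFix F (Finset.univ : Finset (Fin 2 ⊕ Fin 2)) : Set (GLFour F)) =
      Set.univ :=
    by exact Set.eq_univ_of_forall fun g => SetLike.mem_coe.2 (mem_colFix.2 fun p hp =>
      absurd (Finset.mem_univ p) hp)
  have h4 : ‖fixProj ρ (colFix F R : Set (GLFour F)) x - fixProj ρ Set.univ x‖ ≤
      2 / (Fintype.card F : ℝ) ^ 2 * ‖x‖ := by
    have hx' : x ∈ fixedSpace ρ (colFix F ((Finset.univ : Finset (Fin 2 ⊕ Fin 2)).erase
        (Sum.inr 1)) : Set (GLFour F)) := by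
      have : (Finset.univ : Finset (Fin 2 ⊕ Fin 2)).erase (Sum.inr 1) =
          L := by rw [hL]; decide
      rw [this]
      exact fixProj_mem ρ _
    have h := norm_fixProj_colFix_sub_le' ρ (S' := R) (S := Finset.univ) (Finset.subset_univ _)
      (by rw [hR]; decide) hx'
    rwa [huniv, show R.card = 2 by rw [hR]; decide] at h
  have hxv : fixProj ρ Set.univ x = fixProj ρ Set.univ v := by
    rw [hx, fixProj_fixProj_of_subset' ρ (Set.subset_univ _), hu,
      fixProj_fixProj_of_subset' ρ (Set.subset_univ _)]
  have h5 : ‖fixProj ρ H w - fixProj ρ Set.univ v‖ ≤ ‖w - fixProj ρ Set.univ v‖ := by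
    rw [← fixProj_fixProj_of_subset ρ (Set.subset_univ H) v, ← map_sub,
      fixProj_fixProj_of_subset ρ (Set.subset_univ H) v]
    exact norm_fixProj_le ρ _
  have hq : (0 : ℝ) < Fintype.card F := by exact_mod_cast Fintype.card_pos
  have h6 : ‖w - fixProj ρ Set.univ v‖ ≤
      2 / Fintype.card F * ‖u‖ + 2 / (Fintype.card F : ℝ) ^ 2 * ‖x‖ := by
    refine (norm_sub_le_norm_sub_add_norm_sub _
      (fixProj ρ (colFix F R : Set (GLFour F)) x) _).trans ?_
    rw [← hxv]
    exact add_le_add h3 h4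
  calc _ ≤ ‖fixProj ρ H v - fixProj ρ H u‖ + ‖fixProj ρ H u - fixProj ρ Set.univ v‖ :=
        norm_sub_le_norm_sub_add_norm_sub _ _ _
    _ ≤ ‖fixProj ρ H v - fixProj ρ H u‖ + (‖fixProj ρ H u - fixProj ρ H w‖ +
        ‖fixProj ρ H w - fixProj ρ Set.univ v‖) := by
      gcongr; exact norm_sub_le_norm_sub_add_norm_sub _ _ _
    _ ≤ 2 / Fintype.card F * ‖v‖ + (2 / Fintype.card F * ‖v‖ +
        (2 / Fintype.card F * ‖v‖ + 2 / (Fintype.card F : ℝ) ^ 2 * ‖v‖)) := by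
      refine add_le_add h1 (add_le_add (h2.trans ?_) (h5.trans (h6.trans ?_)))
      · gcongr
      · have := hxu.trans huv
        gcongr
    _ = _ := by ring

end RankFour

/-! ### Expansion in a product of column and row stabilisers -/

section LeftRight

variable {ι F : Type*} [Fintype ι] [DecidableEq ι] [Field F]

/-- The inverse transpose, as an embedding into the second factor. -/
def rightHom (ι F : Type*) [Fintype ι] [DecidableEq ι] [Field F] :
    (Matrix ι ι F)ˣ →* (Matrix ι ι F)ˣ × (Matrix ι ι F)ˣ where
  toFun g := (1, ⟨(g⁻¹).val.transpose, g.val.transpose,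
    by rw [← Matrix.transpose_mul, Units.mul_inv, Matrix.transpose_one],
    by rw [← Matrix.transpose_mul, Units.inv_mul, Matrix.transpose_one]⟩)
  map_one' := by
    ext1
    · rfl
    · ext1; simp
  map_mul' g h := by
    ext1
    · simp
    · ext1
      simp only [mul_inv_rev, Units.val_mul, Matrix.transpose_mul, Prod.snd_mul]

/-- The elements `(g, 1)` with `g` in the column stabiliser of `S`. -/
def leftFix (F : Type*) [Field F] (S : Finset ι) : Set ((Matrix ι ι F)ˣ × (Matrix ι ι F)ˣ) :=
  MonoidHom.inl (Matrix ι ι F)ˣ (Matrix ι ι F)ˣ '' (colFix F S : Set (Matrix ι ι F)ˣ)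

/-- The elements `(1, g)` with `g` in the row stabiliser of `S`. -/
def rightFix (F : Type*) [Field F] (S : Finset ι) : Set ((Matrix ι ι F)ˣ × (Matrix ι ι F)ˣ) :=
  rightHom ι F '' (colFix F S : Set (Matrix ι ι F)ˣ)

theorem leftFix_mono {S T : Finset ι} (h : S ⊆ T) : leftFix F S ⊆ leftFix F T :=
  Set.image_mono (colFix_mono h)

theorem rightFix_mono {S T : Finset ι} (h : S ⊆ T) : rightFix F S ⊆ rightFix F T :=
  Set.image_mono (colFix_mono h)

theorem leftFix_comm_rightFix {S T : Finset ι} :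
    ∀ g ∈ leftFix F S, ∀ h ∈ rightFix F T, g * h = h * g := by
  rintro _ ⟨g, _, rfl⟩ _ ⟨h, _, rfl⟩
  simp [rightHom]

theorem rightFix_comm_leftFix {S T : Finset ι} :
    ∀ g ∈ rightFix F S, ∀ h ∈ leftFix F T, g * h = h * g :=
  fun g hg h hh => (leftFix_comm_rightFix h hh g hg).symm

/-- The unipotent matrix `1 + d (e_q - e_p) (e_p + e_q)ᵀ`. -/
def pairUnit (p q : ι) (hpq : p ≠ q) (d : F) : (Matrix ι ι F)ˣ :=
  have h (c : F) : (1 + c • Matrix.vecMulVec (Pi.single q 1 - Pi.single p 1)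
      (Pi.single p 1 + Pi.single q 1) : Matrix ι ι F) *
      (1 + (-c) • Matrix.vecMulVec (Pi.single q 1 - Pi.single p 1)
      (Pi.single p 1 + Pi.single q 1)) = 1 := by
    have h0 : Matrix.vecMulVec (Pi.single q 1 - Pi.single p 1 : ι → F)
        (Pi.single p 1 + Pi.single q 1) * Matrix.vecMulVec (Pi.single q 1 - Pi.single p 1)
        (Pi.single p 1 + Pi.single q 1) = 0 := by
      rw [Matrix.vecMulVec_mul_vecMulVec]
      simp [hpq, hpq.symm, dotProduct_sub]
    rw [add_mul, mul_add, mul_add, smul_mul_smul_comm, h0]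
    simp
  { val := 1 + d • Matrix.vecMulVec (Pi.single q 1 - Pi.single p 1)
      (Pi.single p 1 + Pi.single q 1)
    inv := 1 + (-d) • Matrix.vecMulVec (Pi.single q 1 - Pi.single p 1)
      (Pi.single p 1 + Pi.single q 1)
    val_inv := h d
    inv_val := by simpa using h (-d) }

theorem pairUnit_apply {p q : ι} (hpq : p ≠ q) (d : F) (i j : ι) :
    (pairUnit p q hpq d).val i j = (1 : Matrix ι ι F) i j + d *
      (((if i = q then 1 else 0) - (if i = p then 1 else 0)) *
        ((if j = p then 1 else 0) + (if j = q then 1 else 0))) := by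
  simp [pairUnit, Matrix.vecMulVec_apply, Pi.single_apply]

theorem pairUnit_inv {p q : ι} (hpq : p ≠ q) (d : F) :
    (pairUnit p q hpq d)⁻¹ = pairUnit p q hpq (-d) := by
  ext1; rfl

theorem pairUnit_add {p q : ι} (hpq : p ≠ q) (c d : F) :
    pairUnit p q hpq (c + d) = pairUnit p q hpq c * pairUnit p q hpq d := by
  have h0 : Matrix.vecMulVec (Pi.single q 1 - Pi.single p 1 : ι → F)
      (Pi.single p 1 + Pi.single q 1) * Matrix.vecMulVec (Pi.single q 1 - Pi.single p 1)
      (Pi.single p 1 + Pi.single q 1) = 0 := by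
    rw [Matrix.vecMulVec_mul_vecMulVec]
    simp [hpq, hpq.symm, dotProduct_sub]
  ext1
  simp only [pairUnit, Units.val_mul]
  rw [add_mul, mul_add, mul_add, smul_mul_smul_comm, h0, add_smul]
  simp only [mul_one, one_mul, smul_zero, add_zero]
  abel

theorem pairUnit_mem_colFix {p q : ι} (hpq : p ≠ q) (d : F) {S : Finset ι} (hp : p ∈ S)
    (hq : q ∈ S) : pairUnit p q hpq d ∈ colFix F S := by
  rw [mem_colFix_iff]
  intro j hj i
  have h1 : j ≠ p := fun h => hj (h ▸ hp)
  have h2 : j ≠ q := fun h => hj (h ▸ hq)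
  simp [pairUnit_apply, h1, h2]

/-- `rightHom` sends a to the pair that acts by u ⊗ v ↦ u ⊗ a v. Both off-diagonal entries of
`pairUnit` in the plane of p and q are ±d, so for d ≠ 0 it moves both factors of e_p ⊗ e_p towards
q, which a transvection would not do. -/
theorem exists_rightHom_eq_pairUnit {p q : ι} (hpq : p ≠ q) (d : F) {S : Finset ι} (hp : p ∈ S)
    (hq : q ∈ S) : ∃ a ∈ colFix F S, a.val q p = d ∧ rightHom ι F a = (1, pairUnit p q hpq d) := by
  refine ⟨(rightHom ι F (pairUnit p q hpq d)).2, ?_, ?_, ?_⟩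
  · rw [mem_colFix_iff]
    intro j hj i
    have h1 : j ≠ p := fun h => hj (h ▸ hp)
    have h2 : j ≠ q := fun h => hj (h ▸ hq)
    change ((pairUnit p q hpq d)⁻¹).val.transpose i j = _
    rw [pairUnit_inv, Matrix.transpose_apply, pairUnit_apply]
    simp [h1, h2, Matrix.one_apply, eq_comm]
  · change ((pairUnit p q hpq d)⁻¹).val.transpose q p = _
    rw [pairUnit_inv, Matrix.transpose_apply, pairUnit_apply]
    simp [hpq, hpq.symm]
  · ext1
    · rfl
    · ext1
      change (pairUnit p q hpq d).val.transpose.transpose = _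
      rw [Matrix.transpose_transpose]

variable [Fintype F]
  {V : Type*} [NormedAddCommGroup V] [InnerProductSpace ℝ V] [FiniteDimensional ℝ V]
  (ρ : (Matrix ι ι F)ˣ × (Matrix ι ι F)ˣ →* (V ≃ₗᵢ[ℝ] V))

theorem norm_fixProj_leftFix_sub_le {S' S : Finset ι} (hS : S' ⊆ S) {p : ι} (hp : p ∈ S)
    {a : (Matrix ι ι F)ˣ} (ha : a ∈ colFix F S) (hap : ∃ i ∈ S', a.val i p ≠ 0) {x : V}
    (hx : x ∈ fixedSpace ρ (leftFix F (S.erase p))) :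
    ‖fixProj ρ (leftFix F S') (ρ (a, 1) x) - fixProj ρ (leftFix F S) x‖ ≤
      2 / (Fintype.card F : ℝ) ^ S'.card * ‖x‖ := by
  have h := norm_fixProj_colFix_sub_le (ρ.comp (MonoidHom.inl _ _)) hS hp ha hap (x := x)
    fun g hg => hx _ ⟨g, hg, rfl⟩
  rwa [fixProj_comp, fixProj_comp] at h

theorem norm_fixProj_rightFix_sub_le {S' S : Finset ι} (hS : S' ⊆ S) {p : ι} (hp : p ∈ S)
    {a : (Matrix ι ι F)ˣ} (ha : a ∈ colFix F S) (hap : ∃ i ∈ S', a.val i p ≠ 0) {x : V}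
    (hx : x ∈ fixedSpace ρ (rightFix F (S.erase p))) :
    ‖fixProj ρ (rightFix F S') (ρ (rightHom ι F a) x) - fixProj ρ (rightFix F S) x‖ ≤
      2 / (Fintype.card F : ℝ) ^ S'.card * ‖x‖ := by
  have h := norm_fixProj_colFix_sub_le (ρ.comp (rightHom ι F)) hS hp ha hap (x := x)
    fun g hg => hx _ ⟨g, hg, rfl⟩
  rwa [fixProj_comp, fixProj_comp] at h

theorem norm_fixProj_leftFix_sub_le' {S' S : Finset ι} (hS : S' ⊆ S) {p : ι} (hp : p ∈ S') {x : V}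
    (hx : x ∈ fixedSpace ρ (leftFix F (S.erase p))) :
    ‖fixProj ρ (leftFix F S') x - fixProj ρ (leftFix F S) x‖ ≤
      2 / (Fintype.card F : ℝ) ^ S'.card * ‖x‖ := by
  have h := norm_fixProj_colFix_sub_le' (ρ.comp (MonoidHom.inl _ _)) hS hp (x := x)
    fun g hg => hx _ ⟨g, hg, rfl⟩
  rwa [fixProj_comp, fixProj_comp] at h

theorem norm_fixProj_rightFix_sub_le' {S' S : Finset ι} (hS : S' ⊆ S) {p : ι} (hp : p ∈ S')
    {x : V} (hx : x ∈ fixedSpace ρ (rightFix F (S.erase p))) :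
    ‖fixProj ρ (rightFix F S') x - fixProj ρ (rightFix F S) x‖ ≤
      2 / (Fintype.card F : ℝ) ^ S'.card * ‖x‖ := by
  have h := norm_fixProj_colFix_sub_le' (ρ.comp (rightHom ι F)) hS hp (x := x)
    fun g hg => hx _ ⟨g, hg, rfl⟩
  rwa [fixProj_comp, fixProj_comp] at h

theorem two_div_pow_le {q : ℝ} (hq : 1 ≤ q) {m k : ℕ} (h : k ≤ m) : 2 / q ^ m ≤ 2 / q ^ k :=
  div_le_div_of_nonneg_left (by norm_num) (by positivity) (pow_le_pow_right₀ hq h)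

/-- For d ≠ 0 both factors of e_p ⊗ e_p are moved to vectors nonzero on S without p. The orbit
lemma, used once on each side, replaces the inner product by that of the left and right invariant
parts of y, which vanishes. Each side costs 2/q³ because S without p has at least three elements. -/
theorem abs_inner_apply_pairUnit_le {S : Finset ι} (hS : 4 ≤ S.card) {p q : ι} (hpq : p ≠ q)
    (hp : p ∈ S) (hq : q ∈ S) {y : V} (hyl : y ∈ fixedSpace ρ (leftFix F (S.erase p)))
    (hyr : y ∈ fixedSpace ρ (rightFix F (S.erase p)))
    (hy : fixProj ρ (leftFix F S ∪ rightFix F S) y = 0) {d : F} (hd : d ≠ 0) :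
    inner ℝ y (ρ (pairUnit p q hpq d, pairUnit p q hpq d) y) ≤
      4 / (Fintype.card F : ℝ) ^ 3 * ‖y‖ ^ 2 := by
  have hq1 : (1 : ℝ) ≤ Fintype.card F := by exact_mod_cast Fintype.card_pos
  have hcard : 3 ≤ (S.erase p).card := by rw [Finset.card_erase_of_mem hp]; omega
  obtain ⟨a, ha, had, har⟩ := exists_rightHom_eq_pairUnit hpq d hp hq
  set x := ρ (1, pairUnit p q hpq d) y with hx
  have hnx : ‖x‖ = ‖y‖ := LinearIsometryEquiv.norm_map _ _
  have hxl : x ∈ fixedSpace ρ (leftFix F (S.erase p)) := by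
    rintro _ ⟨g, hg, rfl⟩
    rw [hx, ← rep_mul_apply]
    have : MonoidHom.inl (Matrix ι ι F)ˣ (Matrix ι ι F)ˣ g * (1, pairUnit p q hpq d) =
        (1, pairUnit p q hpq d) * MonoidHom.inl (Matrix ι ι F)ˣ (Matrix ι ι F)ˣ g := by simp
    rw [this, rep_mul_apply, hyl _ ⟨g, hg, rfl⟩]
  have h1 := norm_fixProj_leftFix_sub_le ρ (Finset.erase_subset p S) hp
    (pairUnit_mem_colFix hpq d hp hq) ⟨q, Finset.mem_erase.2 ⟨hpq.symm, hq⟩, by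
      rw [pairUnit_apply]; simpa [hpq.symm, hpq] using hd⟩ hxl
  have h2 := norm_fixProj_rightFix_sub_le ρ (Finset.erase_subset p S) hp ha
    ⟨q, Finset.mem_erase.2 ⟨hpq.symm, hq⟩, by rwa [had]⟩ hyr
  rw [har, ← hx] at h2
  rw [hnx] at h1
  have hle := two_div_pow_le hq1 hcard
  replace h1 := h1.trans (mul_le_mul_of_nonneg_right hle (norm_nonneg y))
  replace h2 := h2.trans (mul_le_mul_of_nonneg_right hle (norm_nonneg y))
  have hE : fixProj ρ (leftFix F S) y ∈ fixedSpace ρ (rightFix F (S.erase p)) :=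
    fixProj_mem_of_commute ρ rightFix_comm_leftFix hyr
  have e1 : inner ℝ y (ρ (pairUnit p q hpq d, pairUnit p q hpq d) y) =
      inner ℝ y (fixProj ρ (leftFix F (S.erase p)) (ρ (pairUnit p q hpq d, 1) x) -
        fixProj ρ (leftFix F S) x) +
      inner ℝ (fixProj ρ (leftFix F S) y) (fixProj ρ (rightFix F (S.erase p)) x -
        fixProj ρ (rightFix F S) y) := by
    have e2 : inner ℝ (fixProj ρ (leftFix F S) y) (fixProj ρ (rightFix F S) y) = 0 := by
      rw [inner_fixProj_left, fixProj_fixProj_of_commute ρ rightFix_comm_leftFix, hy,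
        inner_zero_right]
    rw [inner_sub_right, inner_sub_right, e2, ← inner_fixProj_left, ← inner_fixProj_left,
      ← inner_fixProj_left, fixProj_eq_self ρ hyl, fixProj_eq_self ρ hE, hx, ← rep_mul_apply]
    simp
  have b1 := (real_inner_le_norm y _).trans (mul_le_mul_of_nonneg_left h1 (norm_nonneg y))
  have b2 := (real_inner_le_norm (fixProj ρ (leftFix F S) y) _).trans
    (mul_le_mul (norm_fixProj_le ρ y) h2 (norm_nonneg _) (norm_nonneg y))
  rw [e1]
  calc _ ≤ _ := add_le_add b1 b2
    _ = _ := by ring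

/-- Averaging over the unipotent group of matrices `pairUnit` moves a vector fixed by the stabiliser
of `e_p ⊗ e_p` close to the invariants. -/
theorem norm_fixProj_sq_le_of_pairUnit {S : Finset ι} (hS : 4 ≤ S.card) {p q : ι} (hpq : p ≠ q)
    (hp : p ∈ S) (hq : q ∈ S) {Z : Set ((Matrix ι ι F)ˣ × (Matrix ι ι F)ˣ)}
    (hZ : ∀ d : F, (pairUnit p q hpq d, pairUnit p q hpq d) ∈ Z)
    {y : V} (hyl : y ∈ fixedSpace ρ (leftFix F (S.erase p)))
    (hyr : y ∈ fixedSpace ρ (rightFix F (S.erase p)))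
    (hy : fixProj ρ (leftFix F S ∪ rightFix F S) y = 0) :
    ‖fixProj ρ Z y‖ ^ 2 ≤
      (1 / Fintype.card F + 4 / (Fintype.card F : ℝ) ^ 3) * ‖y‖ ^ 2 := by
  classical
  have hq0 : (0 : ℝ) < Fintype.card F := by exact_mod_cast Fintype.card_pos
  set Q : ℝ := (Fintype.card F : ℝ) with hQ
  set κ : F → (Matrix ι ι F)ˣ × (Matrix ι ι F)ˣ :=
    fun d => (pairUnit p q hpq d, pairUnit p q hpq d) with hκ
  -- P_Z y is unchanged when y is moved by elements of Z. In the squared norm of the resulting orbit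
  -- sum, the q diagonal terms give the 1/q and the off-diagonal terms, each at most 4/q³ times
  -- ‖y‖², give the rest.
  have hsum : Q • fixProj ρ Z y = fixProj ρ Z (∑ d, ρ (κ d) y) := by
    rw [map_sum, Finset.sum_congr rfl fun d _ => fixProj_apply_of_mem ρ (hZ d) y]
    simp [hQ, Nat.cast_smul_eq_nsmul]
  have hκi (c d : F) : inner ℝ (ρ (κ c) y) (ρ (κ d) y) = inner ℝ y (ρ (κ (d - c)) y) := by
    have : κ d = κ c * κ (d - c) := by
      simp only [hκ, Prod.mk_mul_mk, ← pairUnit_add, add_sub_cancel]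
    rw [this, rep_mul_apply, LinearIsometryEquiv.inner_map_map]
  have hb (c d : F) : inner ℝ y (ρ (κ (d - c)) y) ≤
      (if c = d then ‖y‖ ^ 2 else 0) + 4 / Q ^ 3 * ‖y‖ ^ 2 := by
    split_ifs with h
    · have : κ (d - c) = 1 := by
        rw [h, sub_self]
        simp only [hκ]
        ext i j <;> simp [pairUnit_apply]
      rw [this, map_one, LinearIsometryEquiv.coe_one, id, real_inner_self_eq_norm_sq]
      have : 0 ≤ 4 / Q ^ 3 * ‖y‖ ^ 2 := by positivity
      linarith
    · rw [zero_add]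
      exact abs_inner_apply_pairUnit_le ρ hS hpq hp hq hyl hyr hy
        (sub_ne_zero.2 fun h' => h h'.symm)
  have hnorm : ‖∑ d, ρ (κ d) y‖ ^ 2 ≤ Q * ‖y‖ ^ 2 + Q ^ 2 * (4 / Q ^ 3 * ‖y‖ ^ 2) := by
    rw [← real_inner_self_eq_norm_sq, sum_inner]
    calc ∑ c, inner ℝ (ρ (κ c) y) (∑ d, ρ (κ d) y)
        = ∑ c, ∑ d, inner ℝ y (ρ (κ (d - c)) y) := by
          refine Finset.sum_congr rfl fun c _ => ?_
          rw [inner_sum]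
          exact Finset.sum_congr rfl fun d _ => hκi c d
      _ ≤ ∑ c : F, ∑ d : F, ((if c = d then ‖y‖ ^ 2 else 0) + 4 / Q ^ 3 * ‖y‖ ^ 2) :=
          Finset.sum_le_sum fun c _ => Finset.sum_le_sum fun d _ => hb c d
      _ = _ := by
          simp only [Finset.sum_add_distrib, Finset.sum_ite_eq, Finset.mem_univ, if_true,
            Finset.sum_const, Finset.card_univ, nsmul_eq_mul]
          ring
  have h1 : (Q * ‖fixProj ρ Z y‖) ^ 2 ≤ Q * ‖y‖ ^ 2 + Q ^ 2 * (4 / Q ^ 3 * ‖y‖ ^ 2) := by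
    refine le_trans ?_ hnorm
    rw [← Real.norm_of_nonneg hq0.le, ← norm_smul, hsum]
    exact pow_le_pow_left₀ (norm_nonneg _) (norm_fixProj_le ρ _) 2
  have h2 : Q ^ 2 * ‖fixProj ρ Z y‖ ^ 2 ≤ Q ^ 2 * ((1 / Q + 4 / Q ^ 3) * ‖y‖ ^ 2) := by
    calc _ = (Q * ‖fixProj ρ Z y‖) ^ 2 := by ring
      _ ≤ _ := h1
      _ = _ := by field_simp
  exact le_of_mul_le_mul_left h2 (by positivity)

/-- The composition of the projections to the vectors fixed by two subsets which contain the
stabilisers of `e_p ⊗ e_p + e_q ⊗ e_q` and `e_p ⊗ e_p + e_s ⊗ e_s` is small off the invariants. -/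
theorem norm_fixProj_le_of_mem_fixedSpace {S : Finset ι} (hS : 4 ≤ S.card) {p q s : ι}
    (hpq : p ≠ q) (hps : p ≠ s) (hqs : q ≠ s) (hp : p ∈ S) (hq : q ∈ S) (hs : s ∈ S)
    {Z W : Set ((Matrix ι ι F)ˣ × (Matrix ι ι F)ˣ)}
    (hZ : ∀ d : F, (pairUnit p q hpq d, pairUnit p q hpq d) ∈ Z)
    (hZl : leftFix F ((S.erase p).erase q) ⊆ Z) (hZr : rightFix F ((S.erase p).erase q) ⊆ Z)
    (hW : ∀ d : F, (pairUnit p s hps d, pairUnit p s hps d) ∈ W)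
    (hWl : leftFix F ((S.erase p).erase s) ⊆ W) (hWr : rightFix F ((S.erase p).erase s) ⊆ W)
    {u : V} (hu : u ∈ fixedSpace ρ W) (hu0 : fixProj ρ (leftFix F S ∪ rightFix F S) u = 0) :
    ‖fixProj ρ Z u‖ ≤ (4 / (Fintype.card F : ℝ) ^ 2 +
      (1 / Fintype.card F + 4 / (Fintype.card F : ℝ) ^ 3)) * ‖u‖ := by
  have hq1 : (1 : ℝ) ≤ Fintype.card F := by exact_mod_cast Fintype.card_pos
  set Q : ℝ := (Fintype.card F : ℝ) with hQ
  set A := leftFix F (S.erase p) with hA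
  set A' := rightFix F (S.erase p) with hA'
  set B := leftFix F ((S.erase p).erase q) with hB
  set B' := rightFix F ((S.erase p).erase q) with hB'
  have hs' : s ∈ (S.erase p).erase q :=
    Finset.mem_erase.2 ⟨hqs.symm, Finset.mem_erase.2 ⟨hps.symm, hs⟩⟩
  have hcard : 2 ≤ ((S.erase p).erase q).card := by
    rw [Finset.card_erase_of_mem (Finset.mem_erase.2 ⟨hpq.symm, hq⟩),
      Finset.card_erase_of_mem hp]
    omega
  have hle := two_div_pow_le hq1 hcard
  have h1 : ‖fixProj ρ B' u - fixProj ρ A' u‖ ≤ 2 / Q ^ 2 * ‖u‖ :=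
    (norm_fixProj_rightFix_sub_le' ρ (Finset.erase_subset _ _) hs'
      (fixedSpace_anti ρ hWr hu)).trans (mul_le_mul_of_nonneg_right hle (norm_nonneg u))
  have hx : fixProj ρ A' u ∈ fixedSpace ρ (leftFix F ((S.erase p).erase s)) :=
    fixProj_mem_of_commute ρ leftFix_comm_rightFix (fixedSpace_anti ρ hWl hu)
  have h2 : ‖fixProj ρ B (fixProj ρ A' u) - fixProj ρ A (fixProj ρ A' u)‖ ≤ 2 / Q ^ 2 * ‖u‖ :=
    (norm_fixProj_leftFix_sub_le' ρ (Finset.erase_subset _ _) hs' hx).trans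
      (mul_le_mul hle (norm_fixProj_le ρ u) (norm_nonneg _) (by positivity))
  -- Passing to y, fixed by the left and right stabilisers of e_p, costs 2/q² on each side. The
  -- index s gives u enough invariance for this, and q ≠ s keeps s among the indices left to Z.
  set y := fixProj ρ A (fixProj ρ A' u) with hy
  have hyl : y ∈ fixedSpace ρ A := fixProj_mem ρ _
  have hyr : y ∈ fixedSpace ρ A' :=
    fixProj_mem_of_commute ρ rightFix_comm_leftFix (fixProj_mem ρ u)
  have hAS : A ⊆ leftFix F S ∪ rightFix F S :=
    (leftFix_mono (Finset.erase_subset _ _)).trans Set.subset_union_left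
  have hAS' : A' ⊆ leftFix F S ∪ rightFix F S :=
    (rightFix_mono (Finset.erase_subset _ _)).trans Set.subset_union_right
  have hy0 : fixProj ρ (leftFix F S ∪ rightFix F S) y = 0 := by
    rw [hy, fixProj_fixProj_of_subset' ρ hAS, fixProj_fixProj_of_subset' ρ hAS', hu0]
  have hZy := norm_fixProj_sq_le_of_pairUnit ρ hS hpq hp hq hZ hyl hyr hy0
  have hWy := norm_fixProj_sq_le_of_pairUnit ρ hS hps hp hs hW hyl hyr hy0
  set c : ℝ := 1 / Q + 4 / Q ^ 3 with hc
  have hc0 : 0 ≤ c := by positivity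
  -- Since u is W-fixed, ‖y‖² = ⟨u, P_W y⟩. The square-root saving for W bounds y by u, and the one
  -- for Z bounds P_Z y by y; together they save the full factor c.
  have hyy : ‖y‖ ^ 2 ≤ ‖u‖ * ‖fixProj ρ W y‖ := by
    have : ‖y‖ ^ 2 = inner ℝ u (fixProj ρ W y) := by
      rw [← inner_fixProj_left, fixProj_eq_self ρ hu, ← real_inner_self_eq_norm_sq]
      nth_rewrite 1 [hy]
      rw [inner_fixProj_left, fixProj_eq_self ρ hyl, inner_fixProj_left, fixProj_eq_self ρ hyr]
    rw [this]
    exact real_inner_le_norm _ _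
  have hsq (t : ℝ) (ht : t ^ 2 ≤ c * ‖y‖ ^ 2) : t ≤ √c * ‖y‖ := by
    rw [← Real.sqrt_sq (norm_nonneg y), ← Real.sqrt_mul hc0]
    exact Real.le_sqrt_of_sq_le ht
  have hyu : ‖y‖ ≤ √c * ‖u‖ := by
    rcases (norm_nonneg y).eq_or_lt with h0 | h0
    · rw [← h0]; positivity
    · have := hyy.trans (mul_le_mul_of_nonneg_left (hsq _ hWy) (norm_nonneg u))
      refine le_of_mul_le_mul_right ?_ h0
      linarith
  have hZyu : ‖fixProj ρ Z y‖ ≤ c * ‖u‖ := by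
    calc _ ≤ √c * ‖y‖ := hsq _ hZy
      _ ≤ √c * (√c * ‖u‖) := by gcongr
      _ = c * ‖u‖ := by rw [← mul_assoc, Real.mul_self_sqrt hc0]
  have e : fixProj ρ Z u = fixProj ρ Z (fixProj ρ B' u - fixProj ρ A' u) +
      (fixProj ρ Z (fixProj ρ B (fixProj ρ A' u) - fixProj ρ A (fixProj ρ A' u)) +
        fixProj ρ Z y) := by
    rw [map_sub, map_sub, fixProj_fixProj_of_subset' ρ hZr, fixProj_fixProj_of_subset' ρ hZl,
      ← hy]
    abel
  rw [e]
  calc _ ≤ ‖fixProj ρ B' u - fixProj ρ A' u‖ +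
        (‖fixProj ρ B (fixProj ρ A' u) - fixProj ρ A (fixProj ρ A' u)‖ + ‖fixProj ρ Z y‖) :=
        (norm_add_le _ _).trans (add_le_add (norm_fixProj_le ρ _)
          ((norm_add_le _ _).trans (add_le_add_left (norm_fixProj_le ρ _) _)))
    _ ≤ 2 / Q ^ 2 * ‖u‖ + (2 / Q ^ 2 * ‖u‖ + c * ‖u‖) :=
        add_le_add h1 (add_le_add h2 hZyu)
    _ = _ := by ring

end LeftRight

/-! ### Expansion for stabilisers of families of diagonal matrices -/

section BlockEmbedding

variable {κ ι F : Type*} [Fintype κ] [DecidableEq κ] [DecidableEq ι] [Field F]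

/-- The matrix whose block on the range of `f` is `A` and which is the identity elsewhere. -/
def embMatrix (f : κ → ι) (A : Matrix κ κ F) : Matrix ι ι F :=
  1 + (1 : Matrix ι ι F).submatrix id f * (A - 1) * (1 : Matrix ι ι F).submatrix f id

theorem embMatrix_one (f : κ → ι) : embMatrix f (1 : Matrix κ κ F) = 1 := by
  simp [embMatrix]

theorem embMatrix_mul [Fintype ι] {f : κ → ι} (hf : Function.Injective f) (A B : Matrix κ κ F) :
    embMatrix f (A * B) = embMatrix f A * embMatrix f B := by
  set P := (1 : Matrix ι ι F).submatrix id f with hP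
  set P' := (1 : Matrix ι ι F).submatrix f id with hP'
  have h : P' * P = 1 := by
    ext a b
    simp [hP, hP', Matrix.mul_apply, Matrix.one_apply, hf.eq_iff]
  have h2 : P * (A - 1) * P' * (P * (B - 1) * P') = P * ((A - 1) * (B - 1)) * P' := by
    calc _ = P * (A - 1) * (P' * P) * (B - 1) * P' := by simp only [Matrix.mul_assoc]
      _ = _ := by rw [h, Matrix.mul_one]; simp only [Matrix.mul_assoc]
  unfold embMatrix
  rw [add_mul, mul_add, mul_add, h2, one_mul, mul_one, one_mul,
    show A * B - 1 = (A - 1) + (B - 1) + (A - 1) * (B - 1) by noncomm_ring]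
  simp only [Matrix.mul_add, Matrix.add_mul]
  abel

theorem embMatrix_apply {f : κ → ι} (hf : Function.Injective f) (A : Matrix κ κ F) (a b : κ) :
    embMatrix f A (f a) (f b) = A a b := by
  simp [embMatrix, Matrix.mul_apply, Matrix.one_apply, hf.eq_iff]

theorem embMatrix_apply_of_left {f : κ → ι} (A : Matrix κ κ F) {i : ι} (hi : i ∉ Set.range f)
    (j : ι) : embMatrix f A i j = (1 : Matrix ι ι F) i j := by
  have h (a : κ) : i ≠ f a := fun h => hi ⟨a, h.symm⟩
  simp [embMatrix, Matrix.mul_apply, Matrix.one_apply, h]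

theorem embMatrix_apply_of_right {f : κ → ι} (A : Matrix κ κ F) (i : ι) {j : ι}
    (hj : j ∉ Set.range f) : embMatrix f A i j = (1 : Matrix ι ι F) i j := by
  have h (a : κ) : f a ≠ j := fun h => hj ⟨a, h⟩
  simp [embMatrix, Matrix.mul_apply, Matrix.one_apply, h]

/-- The block embedding `A ↦ (A, A)` of a general linear group. -/
def diagEmb [Fintype ι] {f : κ → ι} (hf : Function.Injective f) :
    (Matrix κ κ F)ˣ →* (Matrix ι ι F)ˣ × (Matrix ι ι F)ˣ :=
  let φ : Matrix κ κ F →* Matrix ι ι F :=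
    { toFun := embMatrix f, map_one' := embMatrix_one f, map_mul' := embMatrix_mul hf }
  (Units.map φ).prod (Units.map φ)

theorem diagEmb_fst [Fintype ι] {f : κ → ι} (hf : Function.Injective f) (A : (Matrix κ κ F)ˣ) :
    (diagEmb hf A).1.val = embMatrix f A.val := rfl

theorem diagEmb_snd [Fintype ι] {f : κ → ι} (hf : Function.Injective f) (A : (Matrix κ κ F)ˣ) :
    (diagEmb hf A).2.val = embMatrix f A.val := rfl

end BlockEmbedding

/-! ### Pointwise stabilisers of families of diagonal matrices -/

section DiagonalStabilizer

variable {ι F K : Type*} [Fintype ι] [DecidableEq ι] [Field F]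

/-- The pairs `(g, h)` with `g D h⁻¹ = D` for all diagonal matrices `D` of a given family. -/
def diagStab (D : K → ι → F) : Subgroup ((Matrix ι ι F)ˣ × (Matrix ι ι F)ˣ) where
  carrier := {γ | ∀ k, γ.1.val * Matrix.diagonal (D k) = Matrix.diagonal (D k) * γ.2.val}
  mul_mem' {γ δ} hγ hδ k := by
    rw [Prod.fst_mul, Prod.snd_mul, Units.val_mul, Units.val_mul, mul_assoc, hδ k, ← mul_assoc,
      hγ k, mul_assoc]
  one_mem' k := by simp
  inv_mem' {γ} hγ k := by
    rw [Prod.fst_inv, Prod.snd_inv, Units.inv_mul_eq_iff_eq_mul, ← mul_assoc, hγ k, mul_assoc,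
      Units.mul_inv, mul_one]

theorem mem_diagStab {D : K → ι → F} {γ : (Matrix ι ι F)ˣ × (Matrix ι ι F)ˣ} :
    γ ∈ diagStab D ↔
      ∀ k, γ.1.val * Matrix.diagonal (D k) = Matrix.diagonal (D k) * γ.2.val := Iff.rfl

theorem mem_diagStab_iff {D : K → ι → F} {γ : (Matrix ι ι F)ˣ × (Matrix ι ι F)ˣ} :
    γ ∈ diagStab D ↔ ∀ k i j, γ.1.val i j * D k j = D k i * γ.2.val i j := by
  refine forall_congr' fun k => ?_
  rw [← Matrix.ext_iff]
  simp [Matrix.mul_diagonal, Matrix.diagonal_mul]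

theorem diagEmb_mem_diagStab {κ : Type*} [Fintype κ] [DecidableEq κ] {f : κ → ι}
    (hf : Function.Injective f) {D : K → ι → F} {A : (Matrix κ κ F)ˣ}
    (h : ∀ k a b, A.val a b = 0 ∨ D k (f a) = D k (f b)) : diagEmb hf A ∈ diagStab D := by
  rw [mem_diagStab_iff]
  intro k i j
  rw [diagEmb_fst, diagEmb_snd]
  by_cases hi : i ∈ Set.range f
  · by_cases hj : j ∈ Set.range f
    · obtain ⟨a, rfl⟩ := hi
      obtain ⟨b, rfl⟩ := hj
      rw [embMatrix_apply hf]
      rcases h k a b with h | h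
      · rw [h, zero_mul, mul_zero]
      · rw [h, mul_comm]
    · rw [embMatrix_apply_of_right _ _ hj, Matrix.one_apply]
      split_ifs with hij
      · rw [hij, mul_comm]
      · rw [zero_mul, mul_zero]
  · rw [embMatrix_apply_of_left _ hi, Matrix.one_apply]
    split_ifs with hij
    · rw [hij, mul_comm]
    · rw [zero_mul, mul_zero]

end DiagonalStabilizer

/-- The combinatorial data of a link: the indices have types in `L`, the diagonal matrices with
entries `coef k (type i)` span the centre of the link, and `z`, `w` are the diagonals of two
directions. The indices of each nonzero type form a `2 × 2` array. -/
structure LinkLabels (ι F K L : Type*) [Fintype ι] [DecidableEq ι] [Field F] [Zero L]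
    [DecidableEq L] where
  type : ι → L
  coef : K → L → F
  coef_zero : ∀ k, coef k 0 = 0
  separates : ∀ j j', j ≠ 0 → j' ≠ j → ∃ k, coef k j ≠ 0 ∧ coef k j' = 0
  block : L → Fin 2 ⊕ Fin 2 → ι
  block_injective : ∀ j, j ≠ 0 → Function.Injective (block j)
  mem_range_block : ∀ j, j ≠ 0 → ∀ i, i ∈ Set.range (block j) ↔ type i = j
  z : ι → F
  w : ι → F
  z_block : ∀ j, j ≠ 0 → ∀ a b : Fin 2 ⊕ Fin 2, Sum.elim id id a = Sum.elim id id b →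
    z (block j a) = z (block j b)
  w_block : ∀ j, j ≠ 0 → ∀ a b : Fin 2 ⊕ Fin 2, Sum.isLeft a = Sum.isLeft b →
    w (block j a) = w (block j b)
  p : ι
  q : ι
  s : ι
  p_ne_q : p ≠ q
  p_ne_s : p ≠ s
  q_ne_s : q ≠ s
  type_p : type p = 0
  type_q : type q = 0
  type_s : type s = 0
  z_p : z p = z q
  w_p : w p = w s
  z_eq_zero : ∀ i, type i = 0 → i ≠ p → i ≠ q → z i = 0
  w_eq_zero : ∀ i, type i = 0 → i ≠ p → i ≠ s → w i = 0
  four_le_card : 4 ≤ (Finset.univ.filter fun i => type i = 0).card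

/-! ### Structure of the stabiliser of the centre, and induction over its blocks -/

namespace LinkLabels

variable {ι F K L : Type*} [Fintype ι] [DecidableEq ι] [Field F] [Zero L] [DecidableEq L]
  (X : LinkLabels ι F K L)

/-- The pointwise stabiliser of the centre of the link. -/
def stab : Subgroup ((Matrix ι ι F)ˣ × (Matrix ι ι F)ˣ) :=
  diagStab fun k i => X.coef k (X.type i)

/-- The pointwise stabiliser of the centre and of the diagonal matrix with entries `z`. -/
def stabWith (z : ι → F) : Subgroup ((Matrix ι ι F)ˣ × (Matrix ι ι F)ˣ) :=
  X.stab ⊓ diagStab fun _ : Unit => z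

/-- The indices of type zero. -/
def zeroType : Finset ι := Finset.univ.filter fun i => X.type i = 0

/-- The elements of the stabiliser which act trivially on the blocks outside `T`. -/
def blockStab (T : Finset L) : Set ((Matrix ι ι F)ˣ × (Matrix ι ι F)ˣ) :=
  {γ | γ ∈ X.stab ∧ ∀ j, j ≠ 0 → j ∉ T → γ.1.val.submatrix (X.block j) (X.block j) = 1}

variable {X}

/-- A member of the family that is nonzero on the type of j and zero on that of i forces the entry
to vanish. So columns of nonzero type stay in their block, while columns of type zero are
unconstrained. -/
theorem fst_apply_eq_zero {γ : (Matrix ι ι F)ˣ × (Matrix ι ι F)ˣ} (hγ : γ ∈ X.stab) {i j : ι}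
    (hj : X.type j ≠ 0) (hij : X.type i ≠ X.type j) : γ.1.val i j = 0 := by
  obtain ⟨k, h1, h2⟩ := X.separates _ _ hj hij
  have h := mem_diagStab_iff.1 hγ k i j
  rw [h2, zero_mul] at h
  exact (mul_eq_zero.1 h).resolve_right h1

theorem snd_apply_eq_zero {γ : (Matrix ι ι F)ˣ × (Matrix ι ι F)ˣ} (hγ : γ ∈ X.stab) {i j : ι}
    (hi : X.type i ≠ 0) (hij : X.type j ≠ X.type i) : γ.2.val i j = 0 := by
  obtain ⟨k, h1, h2⟩ := X.separates _ _ hi hij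
  have h := mem_diagStab_iff.1 hγ k i j
  rw [h2, mul_zero] at h
  exact (mul_eq_zero.1 h.symm).resolve_left h1

theorem snd_apply_eq_fst_apply {γ : (Matrix ι ι F)ˣ × (Matrix ι ι F)ˣ} (hγ : γ ∈ X.stab)
    {i j : ι} (hi : X.type i ≠ 0) (hij : X.type i = X.type j) :
    γ.2.val i j = γ.1.val i j := by
  obtain ⟨k, h1, -⟩ := X.separates _ 0 hi hi.symm
  have h := mem_diagStab_iff.1 hγ k i j
  rw [← hij, mul_comm] at h
  exact (mul_left_cancel₀ h1 h).symm

/-- Columns of δ in block j are supported on that block, so no index outside it contributes to the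
product. Restriction to a block is thus a homomorphism from the stabiliser to GL₄. -/
theorem submatrix_mul {γ δ : (Matrix ι ι F)ˣ × (Matrix ι ι F)ˣ} (hδ : δ ∈ X.stab) {j : L}
    (hj : j ≠ 0) :
    (γ * δ).1.val.submatrix (X.block j) (X.block j) =
      γ.1.val.submatrix (X.block j) (X.block j) * δ.1.val.submatrix (X.block j) (X.block j) := by
  ext a b
  simp only [Prod.fst_mul, Units.val_mul, Matrix.submatrix_apply, Matrix.mul_apply]
  have hb : X.type (X.block j b) = j := (X.mem_range_block j hj _).1 ⟨b, rfl⟩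
  rw [← Finset.sum_image (g := X.block j)
    (f := fun i => γ.1.val (X.block j a) i * δ.1.val i (X.block j b))
    (fun x _ y _ h => X.block_injective j hj h)]
  symm
  refine Finset.sum_subset (Finset.subset_univ _) fun i _ hi => ?_
  have hi' : X.type i ≠ X.type (X.block j b) := by
    rw [hb]
    intro h
    obtain ⟨c, rfl⟩ := (X.mem_range_block j hj i).2 h
    exact hi (Finset.mem_image_of_mem _ (Finset.mem_univ c))
  rw [fst_apply_eq_zero hδ (by rwa [hb]) hi', mul_zero]

theorem submatrix_one {j : L} (hj : j ≠ 0) :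
    (1 : (Matrix ι ι F)ˣ × (Matrix ι ι F)ˣ).1.val.submatrix (X.block j) (X.block j) = 1 :=
  Matrix.submatrix_one _ (X.block_injective j hj)

theorem diagEmb_mem_stab {j : L} (hj : j ≠ 0) (A : GLFour F) :
    diagEmb (X.block_injective j hj) A ∈ X.stab := by
  refine diagEmb_mem_diagStab _ fun k a b => Or.inr ?_
  rw [(X.mem_range_block j hj _).1 ⟨a, rfl⟩, (X.mem_range_block j hj _).1 ⟨b, rfl⟩]

theorem submatrix_diagEmb {j : L} (hj : j ≠ 0) (A : GLFour F) :
    (diagEmb (X.block_injective j hj) A).1.val.submatrix (X.block j) (X.block j) = A.val := by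
  ext a b
  rw [Matrix.submatrix_apply, diagEmb_fst, embMatrix_apply (X.block_injective j hj)]

theorem submatrix_diagEmb_of_ne {i j : L} (hi : i ≠ 0) (hj : j ≠ 0) (hij : i ≠ j)
    (A : GLFour F) :
    (diagEmb (X.block_injective j hj) A).1.val.submatrix (X.block i) (X.block i) = 1 := by
  rw [← Matrix.submatrix_one _ (X.block_injective i hi)]
  ext a b
  rw [Matrix.submatrix_apply, diagEmb_fst, embMatrix_apply_of_left, Matrix.submatrix_apply]
  rw [X.mem_range_block j hj, (X.mem_range_block i hi _).1 ⟨a, rfl⟩]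
  exact hij

/-- `blockStab T` is the common kernel of the block homomorphisms outside T, hence normal in the
stabiliser. -/
theorem conj_mem_blockStab {T : Finset L} {γ σ : (Matrix ι ι F)ˣ × (Matrix ι ι F)ˣ}
    (hγ : γ ∈ X.stab) (hσ : σ ∈ X.blockStab T) : γ * σ * γ⁻¹ ∈ X.blockStab T := by
  refine ⟨X.stab.mul_mem (X.stab.mul_mem hγ hσ.1) (X.stab.inv_mem hγ), fun j hj hjT => ?_⟩
  rw [submatrix_mul (X.stab.inv_mem hγ) hj, submatrix_mul hσ.1 hj, hσ.2 j hj hjT, mul_one,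
    ← submatrix_mul (X.stab.inv_mem hγ) hj, mul_inv_cancel, submatrix_one hj]

theorem conj_mem_blockStab' {T : Finset L} {γ σ : (Matrix ι ι F)ˣ × (Matrix ι ι F)ˣ}
    (hγ : γ ∈ X.stab) (hσ : σ ∈ X.blockStab T) : γ⁻¹ * σ * γ ∈ X.blockStab T := by
  simpa using conj_mem_blockStab (X.stab.inv_mem hγ) hσ

theorem blockStab_mono {T T' : Finset L} (h : T ⊆ T') : X.blockStab T ⊆ X.blockStab T' :=
  fun _ hγ => ⟨hγ.1, fun j hj hjT => hγ.2 j hj fun hj' => hjT (h hj')⟩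

/-- The embedding of GL₄ splits the homomorphism to block j, so allowing one more block means
adjoining one copy of GL₄. -/
theorem exists_mul_diagEmb {T : Finset L} {j : L} (hj : j ≠ 0)
    {γ : (Matrix ι ι F)ˣ × (Matrix ι ι F)ˣ} (hγ : γ ∈ X.blockStab (insert j T)) :
    ∃ σ ∈ X.blockStab T, ∃ A, γ = σ * diagEmb (X.block_injective j hj) A := by
  have hinv := X.stab.inv_mem hγ.1
  let A : GLFour F :=
    { val := γ.1.val.submatrix (X.block j) (X.block j)
      inv := γ⁻¹.1.val.submatrix (X.block j) (X.block j)
      val_inv := by rw [← submatrix_mul hinv hj, mul_inv_cancel, submatrix_one hj]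
      inv_val := by rw [← submatrix_mul hγ.1 hj, inv_mul_cancel, submatrix_one hj] }
  have hA := diagEmb_mem_stab (X := X) hj A⁻¹
  refine ⟨γ * diagEmb (X.block_injective j hj) A⁻¹, ⟨X.stab.mul_mem hγ.1 hA,
    fun i hi hiT => ?_⟩, A, ?_⟩
  · rw [submatrix_mul hA hi]
    by_cases hij : i = j
    · subst hij
      rw [submatrix_diagEmb hi]
      exact A.mul_inv
    · rw [submatrix_diagEmb_of_ne hi hj hij, mul_one]
      exact hγ.2 i hi fun h => (Finset.mem_insert.1 h).elim hij hiT
  · rw [mul_assoc, ← map_mul, inv_mul_cancel, map_one, mul_one]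

/-- When all blocks are trivial, only the type-zero columns of the first matrix and the type-zero
rows of the second can differ from the identity, and the factors (γ.1, 1) and (1, γ.2) fix the
centre separately. -/
theorem exists_mul_of_mem_blockStab_empty {γ : (Matrix ι ι F)ˣ × (Matrix ι ι F)ˣ}
    (hγ : γ ∈ X.blockStab ∅) :
    ∃ a ∈ leftFix F X.zeroType, ∃ b ∈ rightFix F X.zeroType, γ = a * b := by
  have hone {i j : ι} (hi : X.type i ≠ 0) (hij : X.type i = X.type j) :
      γ.1.val i j = (1 : Matrix ι ι F) i j := by
    obtain ⟨a, ha⟩ := (X.mem_range_block _ hi i).2 rfl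
    obtain ⟨b, hb⟩ := (X.mem_range_block _ hi j).2 hij.symm
    have h := congrFun (congrFun (hγ.2 _ hi (Finset.notMem_empty _)) a) b
    rw [Matrix.submatrix_apply, ha, hb] at h
    rw [h, ← Matrix.submatrix_one _ (X.block_injective _ hi), Matrix.submatrix_apply, ha, hb]
  refine ⟨(γ.1, 1), ⟨γ.1, ?_, rfl⟩, (1, γ.2), ⟨(rightHom ι F γ.2).2, ?_, ?_⟩, by simp⟩
  · rw [SetLike.mem_coe, mem_colFix_iff]
    intro j hj i
    have hj0 : X.type j ≠ 0 := fun h => hj (Finset.mem_filter.2 ⟨Finset.mem_univ _, h⟩)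
    by_cases hij : X.type i = X.type j
    · exact hone (hij ▸ hj0) hij
    · rw [fst_apply_eq_zero hγ.1 hj0 hij, Matrix.one_apply_ne fun h => hij (congrArg _ h)]
  · rw [SetLike.mem_coe, ← inv_mem_iff, mem_colFix_iff]
    intro i hi j
    change γ.2.val.transpose j i = _
    have hi0 : X.type i ≠ 0 := fun h => hi (Finset.mem_filter.2 ⟨Finset.mem_univ _, h⟩)
    rw [Matrix.transpose_apply]
    by_cases hij : X.type i = X.type j
    · rw [snd_apply_eq_fst_apply hγ.1 hi0 hij, hone hi0 hij]
      simp [Matrix.one_apply, eq_comm]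
    · rw [snd_apply_eq_zero hγ.1 hi0 fun h => hij h.symm,
        Matrix.one_apply_ne fun h => hij (congrArg _ h.symm)]
  · ext1
    · rfl
    · ext1
      change γ.2.val.transpose.transpose = _
      rw [Matrix.transpose_transpose]

/-- The stabiliser of `z` contains the factors of type zero. -/
theorem leftFix_subset_stabWith {S : Finset ι} {z : ι → F} (hS : S ⊆ X.zeroType)
    (hz : ∀ i ∈ S, z i = 0) : leftFix F S ⊆ X.stabWith z := by
  rintro _ ⟨g, hg, rfl⟩
  rw [SetLike.mem_coe, mem_colFix_iff] at hg
  have key (D : ι → F) (hD : ∀ i ∈ S, D i = 0) (i j : ι) :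
      g.val i j * D j = D i * (1 : Matrix ι ι F) i j := by
    by_cases hj : j ∈ S
    · rw [hD j hj, mul_zero, Matrix.one_apply]
      split_ifs with h
      · rw [h, hD j hj, zero_mul]
      · rw [mul_zero]
    · rw [hg j hj, Matrix.one_apply]
      split_ifs with h
      · rw [h, mul_comm]
      · rw [zero_mul, mul_zero]
  refine ⟨mem_diagStab_iff.2 fun k i j =>
    key (fun i => X.coef k (X.type i)) (fun i hi => ?_) i j,
    mem_diagStab_iff.2 fun k i j => key z hz i j⟩
  rw [(Finset.mem_filter.1 (hS hi)).2, X.coef_zero]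

theorem rightFix_subset_stabWith {S : Finset ι} {z : ι → F} (hS : S ⊆ X.zeroType)
    (hz : ∀ i ∈ S, z i = 0) : rightFix F S ⊆ X.stabWith z := by
  rintro _ ⟨g, hg, rfl⟩
  have hg' := (mem_colFix_iff.1 (Subgroup.inv_mem _ hg))
  have key (D : ι → F) (hD : ∀ i ∈ S, D i = 0) (i j : ι) :
      (1 : Matrix ι ι F) i j * D j = D i * (rightHom ι F g).2.val i j := by
    change _ = _ * (g⁻¹).val.transpose i j
    rw [Matrix.transpose_apply]
    by_cases hi : i ∈ S
    · rw [hD i hi, zero_mul, Matrix.one_apply]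
      split_ifs with h
      · rw [← h, hD i hi, mul_zero]
      · rw [zero_mul]
    · rw [hg' i hi, Matrix.one_apply, Matrix.one_apply]
      split_ifs with h h' h'
      · rw [h, mul_comm]
      · exact absurd h.symm h'
      · exact absurd h'.symm h
      · rw [zero_mul, mul_zero]
  refine ⟨mem_diagStab_iff.2 fun k i j =>
    key (fun i => X.coef k (X.type i)) (fun i hi => ?_) i j,
    mem_diagStab_iff.2 fun k i j => key z hz i j⟩
  rw [(Finset.mem_filter.1 (hS hi)).2, X.coef_zero]

/-- `pairUnit` differs from the identity only on the plane of p and q, where each diagonal matrix of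
the family is scalar, so it commutes with them. -/
theorem pairUnit_mem_stabWith {p q : ι} (hpq : p ≠ q) {z : ι → F} (hp : X.type p = 0)
    (hq : X.type q = 0) (hz : z p = z q) (d : F) :
    (pairUnit p q hpq d, pairUnit p q hpq d) ∈ X.stabWith z := by
  have key (D : ι → F) (hD : D p = D q) (i j : ι) :
      (pairUnit p q hpq d).val i j * D j = D i * (pairUnit p q hpq d).val i j := by
    rw [pairUnit_apply, Matrix.one_apply]
    have h (i j : ι) (hi : i = p ∨ i = q) (hj : j = p ∨ j = q) : D i = D j := by
      rcases hi with rfl | rfl <;> rcases hj with rfl | rfl <;> simp [hD]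
    by_cases hi : i = p ∨ i = q
    · by_cases hj : j = p ∨ j = q
      · rw [h i j hi hj, mul_comm]
      · push Not at hj
        by_cases hij : i = j
        · rw [hij, mul_comm]
        · simp [hj.1, hj.2, hij]
    · push Not at hi
      by_cases hij : i = j
      · rw [hij, mul_comm]
      · simp [hi.1, hi.2, hij]
  exact ⟨mem_diagStab_iff.2 fun k i j => 
    key (fun i => X.coef k (X.type i)) (by simp only [hp, hq]) i j,
    mem_diagStab_iff.2 fun k i j => key z hz i j⟩

theorem diagEmb_image_leviSet_subset {j : L} (hj : j ≠ 0) {α : Type*} {f : Fin 2 ⊕ Fin 2 → α}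
    {z : ι → F} (hz : ∀ a b, f a = f b → z (X.block j a) = z (X.block j b)) :
    diagEmb (X.block_injective j hj) '' leviSet F f ⊆ X.stabWith z := by
  rintro _ ⟨A, hA, rfl⟩
  refine ⟨diagEmb_mem_stab hj A, diagEmb_mem_diagStab _ fun k a b => ?_⟩
  by_cases h : f a = f b
  · exact Or.inr (hz a b h)
  · exact Or.inl (hA a b h)

variable [Fintype F]
  {V : Type*} [NormedAddCommGroup V] [InnerProductSpace ℝ V] [FiniteDimensional ℝ V]
  (ρ : (Matrix ι ι F)ˣ × (Matrix ι ι F)ˣ →* (V ≃ₗᵢ[ℝ] V))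

/-- Induction on the blocks allowed to move. The empty set is the type-zero part, and each insertion
adds a component governed by one GL₄. Normality of `blockStab T` keeps the components orthogonal
under P_z, so Pythagoras preserves the constant 11/q. -/
theorem norm_fixProj_sub_blockStab_le {T : Finset L} (hT : 0 ∉ T) {u : V}
    (hu : u ∈ fixedSpace ρ (X.stabWith X.w : Set _)) :
    ‖fixProj ρ (X.stabWith X.z : Set _) (u - fixProj ρ (X.blockStab T) u)‖ ≤
      11 / Fintype.card F * ‖u - fixProj ρ (X.blockStab T) u‖ := by
  have hq1 : (1 : ℝ) ≤ Fintype.card F := by exact_mod_cast Fintype.card_pos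
  set Q : ℝ := (Fintype.card F : ℝ) with hQ
  have hQ2 : 1 / Q ^ 2 ≤ 1 / Q := one_div_le_one_div_of_le (by linarith) (by nlinarith)
  have hQ3 : 1 / Q ^ 3 ≤ 1 / Q :=
    one_div_le_one_div_of_le (by linarith) (le_self_pow₀ hq1 (by norm_num))
  have hnormal (T : Finset L) (z : ι → F) : ∀ g ∈ (X.stabWith z : Set _), ∀ s ∈ X.blockStab T,
      g * s * g⁻¹ ∈ X.blockStab T := fun g hg s hs => conj_mem_blockStab hg.1 hs
  have hnormal' (T : Finset L) (z : ι → F) : ∀ g ∈ (X.stabWith z : Set _), ∀ s ∈ X.blockStab T,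
      g⁻¹ * s * g ∈ X.blockStab T := fun g hg s hs => conj_mem_blockStab' hg.1 hs
  have hidem (T : Finset L) (v : V) : fixProj ρ (X.blockStab T) (v - fixProj ρ (X.blockStab T) v) =
      0 := by rw [map_sub, fixProj_fixProj_of_subset ρ subset_rfl, sub_self]
  induction T using Finset.induction_on with
  | empty =>
    set x := u - fixProj ρ (X.blockStab ∅) u with hx
    have hxw : x ∈ fixedSpace ρ (X.stabWith X.w : Set _) :=
      Submodule.sub_mem _ hu (fixProj_mem_of_normalizes ρ (hnormal ∅ _) (hnormal' ∅ _) hu)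
    have hle : fixedSpace ρ (leftFix F X.zeroType ∪ rightFix F X.zeroType) ≤
        fixedSpace ρ (X.blockStab ∅) := by
      intro v hv γ hγ
      obtain ⟨a, ha, b, hb, rfl⟩ := exists_mul_of_mem_blockStab_empty hγ
      rw [rep_mul_apply, hv b (Or.inr hb), hv a (Or.inl ha)]
    have hx0 : fixProj ρ (leftFix F X.zeroType ∪ rightFix F X.zeroType) x = 0 := by
      rw [← fixProj_fixProj_of_le ρ hle, hx, hidem, map_zero]
    have hmem {i : ι} (h : X.type i = 0) : i ∈ X.zeroType :=
      Finset.mem_filter.2 ⟨Finset.mem_univ _, h⟩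
    have hsub (a b : ι) : (X.zeroType.erase a).erase b ⊆ X.zeroType :=
      (Finset.erase_subset _ _).trans (Finset.erase_subset _ _)
    have hzoff : ∀ i ∈ (X.zeroType.erase X.p).erase X.q, X.z i = 0 := fun i hi => by
      simp only [Finset.mem_erase] at hi
      exact X.z_eq_zero i (Finset.mem_filter.1 hi.2.2).2 hi.2.1 hi.1
    have hwoff : ∀ i ∈ (X.zeroType.erase X.p).erase X.s, X.w i = 0 := fun i hi => by
      simp only [Finset.mem_erase] at hi
      exact X.w_eq_zero i (Finset.mem_filter.1 hi.2.2).2 hi.2.1 hi.1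
    refine (norm_fixProj_le_of_mem_fixedSpace ρ X.four_le_card X.p_ne_q X.p_ne_s X.q_ne_s
      (hmem X.type_p) (hmem X.type_q) (hmem X.type_s)
      (pairUnit_mem_stabWith X.p_ne_q X.type_p X.type_q X.z_p)
      (leftFix_subset_stabWith (hsub _ _) hzoff) (rightFix_subset_stabWith (hsub _ _) hzoff)
      (pairUnit_mem_stabWith X.p_ne_s X.type_p X.type_s X.w_p)
      (leftFix_subset_stabWith (hsub _ _) hwoff) (rightFix_subset_stabWith (hsub _ _) hwoff)
      hxw hx0).trans (mul_le_mul_of_nonneg_right ?_ (norm_nonneg _))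
    -- As q ≥ 1, the bound 4/q² + 1/q + 4/q³ is at most 9/q. In the inductive step 6/q + 2/q² is at
    -- most 8/q.
    have : 0 < 1 / Q := by positivity
    rw [← hQ]
    linarith [show 4 / Q ^ 2 = 4 * (1 / Q ^ 2) by ring, show 4 / Q ^ 3 = 4 * (1 / Q ^ 3) by ring,
      show 11 / Q = 11 * (1 / Q) by ring]
  | insert j T hjT ih =>
    have hj : j ≠ 0 := fun h => hT (h ▸ Finset.mem_insert_self j T)
    replace ih := ih fun h => hT (Finset.mem_insert_of_mem h)
    set φ : GLFour F →* (Matrix ι ι F)ˣ × (Matrix ι ι F)ˣ :=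
      diagEmb (X.block_injective j hj) with hφ
    set u' := fixProj ρ (X.blockStab T) u with hu'
    have hu'w : u' ∈ fixedSpace ρ (X.stabWith X.w : Set _) :=
      fixProj_mem_of_normalizes ρ (hnormal T _) (hnormal' T _) hu
    have hcomm : fixProj ρ (φ '' Set.univ) u' =
        fixProj ρ (X.blockStab T) (fixProj ρ (φ '' Set.univ) u) := by
      symm
      refine fixProj_comm_of_normalizes ρ ?_ ?_ u
      · rintro _ ⟨A, _, rfl⟩ s hs
        exact conj_mem_blockStab (diagEmb_mem_stab hj A) hs
      · rintro _ ⟨A, _, rfl⟩ s hs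
        exact conj_mem_blockStab' (diagEmb_mem_stab hj A) hs
    have hrange (A : GLFour F) : φ A ∈ φ '' Set.univ := ⟨A, Set.mem_univ _, rfl⟩
    have hfix : fixProj ρ (φ '' Set.univ) u' ∈ fixedSpace ρ (X.blockStab (insert j T)) := by
      intro γ hγ
      obtain ⟨σ, hσ, A, rfl⟩ := exists_mul_diagEmb hj hγ
      rw [rep_mul_apply, apply_fixProj ρ (hrange A), hcomm, apply_fixProj ρ hσ]
    have hins : fixProj ρ (X.blockStab (insert j T)) u = fixProj ρ (φ '' Set.univ) u' := by
      have hsub : φ '' Set.univ ⊆ X.blockStab (insert j T) := by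
        rintro _ ⟨A, _, rfl⟩
        refine ⟨diagEmb_mem_stab hj A, fun i hi hiT => submatrix_diagEmb_of_ne hi hj ?_ A⟩
        exact fun h => hiT (h ▸ Finset.mem_insert_self _ _)
      rw [← fixProj_eq_self ρ hfix, fixProj_fixProj_of_subset' ρ hsub, hu',
        fixProj_fixProj_of_subset' ρ (blockStab_mono (Finset.subset_insert j T))]
    rw [hins]
    set x₁ := u - u' with hx₁
    set x₂ := u' - fixProj ρ (φ '' Set.univ) u' with hx₂
    have hx : u - fixProj ρ (φ '' Set.univ) u' = x₁ + x₂ := by rw [hx₁, hx₂]; abel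
    have hx₂T : x₂ ∈ fixedSpace ρ (X.blockStab T) :=
      Submodule.sub_mem _ (fixProj_mem ρ u)
        (fixedSpace_anti ρ (blockStab_mono (Finset.subset_insert j T)) hfix)
    have hx₂w : x₂ ∈ fixedSpace (ρ.comp φ) (leviSet F Sum.isLeft) := by
      intro A hA
      change ρ (φ A) x₂ = x₂
      rw [hx₂, map_sub, apply_fixProj ρ (hrange A),
        hu'w (φ A) (diagEmb_image_leviSet_subset hj (X.w_block j hj) ⟨A, hA, rfl⟩)]
    have hb₂ : ‖fixProj ρ (X.stabWith X.z : Set _) x₂‖ ≤ 11 / Q * ‖x₂‖ := by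
      have h := norm_fixProj_leviSet_sub_le (ρ.comp φ) hx₂w
      have h0 : fixProj (ρ.comp φ) Set.univ x₂ = 0 := by
        rw [fixProj_comp, hx₂, map_sub, fixProj_fixProj_of_subset ρ subset_rfl, sub_self]
      rw [h0, sub_zero, fixProj_comp] at h
      refine (norm_fixProj_anti ρ (diagEmb_image_leviSet_subset hj (X.z_block j hj)) x₂).trans
        (h.trans (mul_le_mul_of_nonneg_right ?_ (norm_nonneg _)))
      have : 0 < 1 / Q := by positivity
      rw [← hQ]
      linarith [show 2 / Q ^ 2 = 2 * (1 / Q ^ 2) by ring, show 6 / Q = 6 * (1 / Q) by ring,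
        show 11 / Q = 11 * (1 / Q) by ring]
    have horth : inner ℝ x₁ x₂ = 0 := inner_sub_fixProj ρ hx₂T
    -- P_z commutes with the projection for `blockStab T`, so P_z x₂ is still fixed by `blockStab
    -- T`, while x₁ is orthogonal to all such vectors.
    have horth' : inner ℝ (fixProj ρ (X.stabWith X.z : Set _) x₁)
        (fixProj ρ (X.stabWith X.z : Set _) x₂) = 0 := by
      rw [inner_fixProj_left, fixProj_fixProj_of_subset ρ subset_rfl]
      refine inner_sub_fixProj ρ ?_
      rw [← fixProj_eq_self ρ hx₂T, ← fixProj_comm_of_normalizes ρ (hnormal T _) (hnormal' T _)]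
      exact fixProj_mem ρ _
    have e1 := norm_add_sq_eq_norm_sq_add_norm_sq_of_inner_eq_zero _ _ horth
    have e2 := norm_add_sq_eq_norm_sq_add_norm_sq_of_inner_eq_zero _ _ horth'
    rw [hx, map_add]
    have hc : 0 ≤ 11 / Q := by positivity
    refine le_of_sq_le_sq ?_ (by positivity)
    have s1 := pow_le_pow_left₀ (norm_nonneg _) ih 2
    have s2 := pow_le_pow_left₀ (norm_nonneg _) hb₂ 2
    rw [mul_pow] at s1 s2 ⊢
    nlinarith

/-- The composition of the projections for the stabilisers of `z` and `w` has norm at most `11 / q`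
on the vectors without component fixed by the stabiliser of the centre. -/
theorem norm_fixProj_stabWith_le [Fintype L] {u : V}
    (hu : u ∈ fixedSpace ρ (X.stabWith X.w : Set _)) (hu0 : fixProj ρ (X.stab : Set _) u = 0) :
    ‖fixProj ρ (X.stabWith X.z : Set _) u‖ ≤ 11 / Fintype.card F * ‖u‖ := by
  have h := norm_fixProj_sub_blockStab_le (X := X) ρ (T := Finset.univ.erase 0)
    (Finset.notMem_erase _ _) hu
  have hs : X.blockStab (Finset.univ.erase 0) = X.stab := by
    ext γ
    exact ⟨fun h => h.1, fun h => ⟨h, fun j hj hj' =>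
      absurd (Finset.mem_erase.2 ⟨hj, Finset.mem_univ j⟩) hj'⟩⟩
  rwa [hs, hu0, sub_zero] at h

end LinkLabels

/-! ### A criterion for the spectral expansion -/

section Spectral

/-- In decreasing order only the head can equal 1, so the second entry is bounded by c. The last
entry is no larger than the second, hence is not 1 either. -/
theorem List.abs_getD_one_le_and_abs_getLastD_le {l : List ℝ} {c : ℝ}
    (hl : l.Pairwise fun a b => b ≤ a) (hlen : 2 ≤ l.length) (hc : c < 1)
    (hmem : ∀ x ∈ l, x = 1 ∨ |x| ≤ c)
    (hcount : l.count 1 ≤ 1) : |l.getD 1 0| ≤ c ∧ |l.getLastD 0| ≤ c := by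
  match l, hlen with
  | a :: b :: t, _ =>
    have hab : b ≤ a := (List.pairwise_cons.1 hl).1 b (by simp)
    have hle (x : ℝ) (hx : x ∈ a :: b :: t) : x ≤ 1 :=
      (hmem x hx).elim le_of_eq fun h => (le_abs_self x).trans (h.trans hc.le)
    have hb1 : b ≠ 1 := by
      rintro rfl
      have ha : a = 1 := le_antisymm (hle a (by simp)) hab
      simp [ha] at hcount
    have hb : |b| ≤ c := (hmem b (by simp)).resolve_left hb1
    refine ⟨by simpa using hb, ?_⟩
    have hlast : (a :: b :: t).getLastD 0 = (b :: t).getLast (by simp) := by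
      rw [List.getLastD_cons, List.getLastD_eq_getLast?, List.getLast?_eq_getLast_of_ne_nil]
      rfl
    rw [hlast]
    set x := (b :: t).getLast (by simp) with hx
    have hxm : x ∈ b :: t := List.getLast_mem _
    have hxb : x ≤ b := by
      rcases List.mem_cons.1 hxm with h | h
      · exact h.le
      · exact (List.pairwise_cons.1 (List.pairwise_cons.1 hl).2).1 x h
    refine (hmem x (List.mem_cons_of_mem _ hxm)).resolve_left fun h => ?_
    have := le_abs_self b
    linarith

variable {V : Type*} [Fintype V]

open scoped Classical in
-- An eigenvector of sum zero obeys the Rayleigh bound; any other pairs nontrivially with the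
-- constant vector, which forces eigenvalue 1. Two independent eigenvectors for 1 would have a
-- combination of sum zero, contradicting c < 1.
theorem Matrix.IsHermitian.abs_eigenvalues_le {W : Matrix V V ℝ} (hW : W.IsHermitian)
    (hW1 : W.mulVec 1 = 1) {c : ℝ}
    (h : ∀ f : V → ℝ, ∑ v, f v = 0 → |f ⬝ᵥ W.mulVec f| ≤ c * (f ⬝ᵥ f)) :
    (∀ i, hW.eigenvalues i = 1 ∨ |hW.eigenvalues i| ≤ c) ∧
      (c < 1 → ∀ i j, hW.eigenvalues i = 1 → hW.eigenvalues j = 1 → i = j) := by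
  set u : V → V → ℝ := fun i => hW.eigenvectorBasis i with hu
  have hWu (i : V) : W.mulVec (u i) = hW.eigenvalues i • u i := hW.mulVec_eigenvectorBasis i
  have horth (i j : V) : u i ⬝ᵥ u j = if i = j then 1 else 0 := by
    have := orthonormal_iff_ite.1 hW.eigenvectorBasis.orthonormal j i
    rw [EuclideanSpace.inner_eq_star_dotProduct] at this
    simpa [eq_comm, hu] using this
  have hev (f : V → ℝ) (μ : ℝ) (hf : W.mulVec f = μ • f) (hf0 : ∑ v, f v = 0)
      (hff : 0 < f ⬝ᵥ f) : |μ| ≤ c := by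
    have := h f hf0
    rw [hf, dotProduct_smul, smul_eq_mul, abs_mul, abs_of_pos hff] at this
    exact le_of_mul_le_mul_right this hff
  refine ⟨fun i => ?_, fun hc i j hi hj => ?_⟩
  · by_cases h0 : ∑ v, u i v = 0
    · exact Or.inr (hev _ _ (hWu i) h0 (by simp [horth]))
    · left
      have h1 : (1 : V → ℝ) ⬝ᵥ W.mulVec (u i) = 1 ⬝ᵥ u i := by
        rw [Matrix.dotProduct_mulVec, ← Matrix.mulVec_transpose,
          show W.transpose = W from hW, hW1]
      rw [hWu, dotProduct_smul, smul_eq_mul, one_dotProduct] at h1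
      exact mul_right_cancel₀ h0 (h1.trans (one_mul _).symm)
  · by_contra hij
    have hpos (a b : ℝ) (hab : a ≠ 0 ∨ b ≠ 0) :
        0 < (a • u i + b • u j) ⬝ᵥ (a • u i + b • u j) := by
      have : (a • u i + b • u j) ⬝ᵥ (a • u i + b • u j) = a ^ 2 + b ^ 2 := by
        simp [dotProduct_add, add_dotProduct, horth, hij, Ne.symm hij]
        ring
      rw [this]
      rcases hab with h | h <;> positivity
    have hval (a b : ℝ) : W.mulVec (a • u i + b • u j) = (1 : ℝ) • (a • u i + b • u j) := by
      rw [Matrix.mulVec_add, Matrix.mulVec_smul, Matrix.mulVec_smul, hWu, hWu, hi, hj]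
      simp
    have hsum (a b : ℝ) : ∑ v, (a • u i + b • u j) v = a * ∑ v, u i v + b * ∑ v, u j v := by
      simp [Finset.sum_add_distrib, Finset.mul_sum]
    have key (a b : ℝ) (hab : a ≠ 0 ∨ b ≠ 0) (h0 : a * ∑ v, u i v + b * ∑ v, u j v = 0) :
        False := by
      have := hev _ _ (hval a b) ((hsum a b).trans h0) (hpos a b hab)
      rw [abs_one] at this
      exact hc.not_ge this
    by_cases h0 : ∑ v, u j v = 0
    · exact key 0 1 (by simp) (by simp [h0])
    · exact key (∑ v, u j v) (-∑ v, u i v) (Or.inl h0) (by ring)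

open scoped Classical in
theorem spectralExpansion_le [Nontrivial V] {m : Matrix V V ℝ}
    (hW : (randomWalkMatrix m).IsHermitian) (hW1 : (randomWalkMatrix m).mulVec 1 = 1) {c : ℝ}
    (h : ∀ f : V → ℝ, ∑ v, f v = 0 → |f ⬝ᵥ (randomWalkMatrix m).mulVec f| ≤ c * (f ⬝ᵥ f)) :
    spectralExpansion m ≤ c := by
  obtain ⟨h1, h2⟩ := hW.abs_eigenvalues_le hW1 h
  have hl : walkEigenvalues m =
      (Finset.univ.val.map hW.eigenvalues).sort fun a b => b ≤ a := by
    have hr := hW.roots_charpoly_eq_eigenvalues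
    rw [RCLike.ofReal_real_eq_id, Function.id_comp] at hr
    rw [← hr]
    unfold walkEigenvalues
    congr!
  have hmem : ∀ x ∈ walkEigenvalues m, x = 1 ∨ |x| ≤ c := fun x hx => by
    rw [hl, Multiset.mem_sort, Multiset.mem_map] at hx
    obtain ⟨i, -, rfl⟩ := hx
    exact h1 i
  have hlen : 2 ≤ (walkEigenvalues m).length := by
    rw [hl, Multiset.length_sort, Multiset.card_map]
    exact Fintype.one_lt_card
  rcases lt_or_ge c 1 with hc1 | hc1
  · have := List.abs_getD_one_le_and_abs_getLastD_le
      (hl ▸ Multiset.pairwise_sort _ _) hlen hc1 hmem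
      (by
        rw [← Multiset.coe_count, hl, Multiset.sort_eq, Multiset.count_map]
        have : (Finset.univ.filter fun i => 1 = hW.eigenvalues i).card ≤ 1 :=
          Finset.card_le_one.2 fun i hi j hj => h2 hc1 i j (Finset.mem_filter.1 hi).2.symm
            (Finset.mem_filter.1 hj).2.symm
        exact this)
    exact max_le this.1 this.2
  -- For c ≥ 1 the eigenvalue 1 itself satisfies the bound, so its multiplicity is irrelevant. This
  -- case is needed: 11/q exceeds 1 for small q.
  · have hall (x : ℝ) (hx : x ∈ walkEigenvalues m) : |x| ≤ c :=
      (hmem x hx).elim (fun h => by rwa [h, abs_one]) id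
    refine max_le (hall _ ?_) (hall _ ?_)
    · rw [List.getD_eq_getElem _ _ hlen]
      exact List.getElem_mem _
    · rw [List.getLastD_eq_getLast?, List.getLast?_eq_getLast_of_ne_nil
        (List.ne_nil_of_length_pos (by omega))]
      exact List.getLast_mem _

theorem sum_comp_eq_sum_card_mul [DecidableEq V] {Ω : Type*} [Fintype Ω] (p : Ω → V) (f : V → ℝ) :
    ∑ t, f (p t) = ∑ v, ((Finset.univ.filter fun t => p t = v).card : ℝ) * f v := by
  rw [← Finset.sum_fiberwise' Finset.univ p f]
  simp

/-- The expansion of a graph whose ordered edges are the images of the elements of `Ω` under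
`(p, p')`, where `p` has fibres of constant size. -/
theorem spectralExpansion_le_of_fibers [DecidableEq V] [Nontrivial V] {Ω : Type*} [Fintype Ω]
    (p p' : Ω → V)
    {m : Matrix V V ℝ} (hm : m.IsSymm) {κ k c : ℝ} (hκ : 0 < κ) (hk : 0 < k)
    (hp : ∀ v, ((Finset.univ.filter fun t => p t = v).card : ℝ) = k)
    (hpp : ∀ v v', ((Finset.univ.filter fun t => p t = v ∧ p' t = v').card : ℝ) = κ * m v v')
    (h : ∀ f : V → ℝ, ∑ t, f (p' t) = 0 → ∑ t, f (p' t) ^ 2 = ∑ t, f (p t) ^ 2 →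
      |∑ t, f (p t) * f (p' t)| ≤ c * ∑ t, f (p t) ^ 2) :
    spectralExpansion m ≤ c := by
  have hrow (v : V) : κ * ∑ v', m v v' = k := by
    rw [Finset.mul_sum, ← hp v]
    simp_rw [← hpp]
    rw [Finset.card_eq_sum_card_fiberwise (f := p') (t := Finset.univ) (by simp)]
    push_cast
    simp_rw [Finset.filter_filter]
  have hp' (v' : V) : ((Finset.univ.filter fun t => p' t = v').card : ℝ) = k := by
    rw [← hrow v', Finset.mul_sum]
    simp_rw [← hm.apply v', ← hpp]
    rw [Finset.card_eq_sum_card_fiberwise (f := p) (t := Finset.univ) (by simp)]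
    push_cast
    simp_rw [Finset.filter_filter, and_comm]
  have hpair (f : V → ℝ) : ∑ t, f (p t) * f (p' t) = κ * (f ⬝ᵥ m.mulVec f) := by
    rw [sum_comp_eq_sum_card_mul (fun t => (p t, p' t)) fun x : V × V => f x.1 * f x.2,
      Fintype.sum_prod_type]
    simp_rw [Prod.mk.injEq, hpp, dotProduct, Matrix.mulVec, dotProduct, Finset.mul_sum]
    exact Finset.sum_congr rfl fun v _ => Finset.sum_congr rfl fun v' _ => by ring
  -- Constant fibres make the graph regular, so the walk matrix is a multiple of m and is symmetric.
  have hrow' (v : V) : ∑ v', m v v' = k / κ := by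
    rw [eq_div_iff hκ.ne', mul_comm, hrow]
  have hW : randomWalkMatrix m = (κ / k) • m := by
    ext v v'
    simp only [randomWalkMatrix, Matrix.of_apply, hrow', Matrix.smul_apply, smul_eq_mul]
    field_simp
  refine spectralExpansion_le ?_ ?_ fun f hf => ?_
  · rw [hW, Matrix.IsHermitian, Matrix.conjTranspose_eq_transpose_of_trivial,
      Matrix.transpose_smul, hm.eq]
  · ext v
    rw [hW, Matrix.smul_mulVec]
    simp only [Pi.smul_apply, Matrix.mulVec, dotProduct, Pi.one_apply, mul_one, hrow', smul_eq_mul]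
    field_simp
  · have hsq (g : Ω → V) (hg : ∀ v, ((Finset.univ.filter fun t => g t = v).card : ℝ) = k) :
        ∑ t, f (g t) ^ 2 = k * (f ⬝ᵥ f) := by
      rw [sum_comp_eq_sum_card_mul g fun v => f v ^ 2]
      simp_rw [hg, dotProduct, Finset.mul_sum, sq]
    have h1 := h f (by
      rw [sum_comp_eq_sum_card_mul]
      simp_rw [hp', ← Finset.mul_sum, hf, mul_zero]) ((hsq p' hp').trans (hsq p hp).symm)
    rw [hpair, hsq p hp, abs_mul, abs_of_pos hκ] at h1
    rw [hW, Matrix.smul_mulVec, dotProduct_smul, smul_eq_mul, abs_mul,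
      abs_of_pos (div_pos hκ hk), div_mul_eq_mul_div, div_le_iff₀ hk]
    linarith

end Spectral

/-! ### Labels of the coordinates -/

section Labels

/-- The parameter space of a face of rank two more than that of its subspace indexed by `J`. -/
abbrev LabelSpace (J : Type*) : Type _ := (J → ZMod 2) × (ZMod 2 × ZMod 2)

variable {J : Type*}

section Pairing

variable [Fintype J]

/-- The standard pairing on `LabelSpace J`. -/
def labelPairing (k : LabelSpace J) : LabelSpace J →ₗ[ZMod 2] ZMod 2 :=
  (Fintype.linearCombination (ZMod 2) k.1).coprod
    ((LinearMap.toSpanSingleton (ZMod 2) (ZMod 2) k.2.1).coprod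
      (LinearMap.toSpanSingleton (ZMod 2) (ZMod 2) k.2.2))

theorem labelPairing_apply (k s : LabelSpace J) :
    labelPairing k s = (∑ j, s.1 j * k.1 j) + (s.2.1 * k.2.1 + s.2.2 * k.2.2) := by
  simp [labelPairing, Fintype.linearCombination_apply]

theorem exists_labelPairing_eq [DecidableEq J] (l : LabelSpace J →ₗ[ZMod 2] ZMod 2) :
    ∃ k, labelPairing k = l := by
  refine ⟨(fun j => l (Pi.single j 1, 0), (l (0, (1, 0)), l (0, (0, 1)))), ?_⟩
  ext <;> simp [labelPairing_apply, Pi.single_apply]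

/-- Distinct vectors over F₂ with j nonzero are separated by a functional sending j to 1 and j' to
0, because j is not a multiple of j'. -/
theorem exists_dotProduct_ne_zero {j j' : J → ZMod 2} (hj : j ≠ 0) (hjj' : j' ≠ j) :
    ∃ s, j ⬝ᵥ s = 1 ∧ j' ⬝ᵥ s = 0 := by
  classical
  have h2 (x : ZMod 2) : x = 0 ∨ x = 1 := by revert x; decide
  obtain ⟨i, hi⟩ := Function.ne_iff.1 hjj'
  rcases h2 (j i) with h | h
  · have h' : j' i = 1 := (h2 _).resolve_left fun h' => hi (h'.trans h.symm)
    obtain ⟨i₂, hi₂⟩ := Function.ne_iff.1 hj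
    replace hi₂ : j i₂ = 1 := (h2 _).resolve_left hi₂
    rcases h2 (j' i₂) with h₂ | h₂
    · exact ⟨Pi.single i₂ 1, by simp [hi₂], by simp [h₂]⟩
    · refine ⟨Pi.single i 1 + Pi.single i₂ 1, by simp [dotProduct_add, h, hi₂], ?_⟩
      simp only [dotProduct_add, dotProduct_single, h', h₂]
      decide
  · have h' : j' i = 0 := (h2 _).resolve_right fun h' => hi (h'.trans h.symm)
    exact ⟨Pi.single i 1, by simp [h], by simp [h']⟩

end Pairing

variable {ι : Type*} (e : LabelSpace J ↪ ι)

/-- The labelling of coordinates which inverts `e`, with label zero off the range of `e`. -/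
noncomputable def coordLabel : ι → LabelSpace J := Function.extend e id fun _ => 0

theorem coordLabel_emb (k : LabelSpace J) : coordLabel e (e k) = k :=
  e.injective.extend_apply _ _ _

theorem emb_coordLabel {i : ι} (h : coordLabel e i ≠ 0) : e (coordLabel e i) = i := by
  by_cases hi : ∃ k, e k = i
  · obtain ⟨k, rfl⟩ := hi
    rw [coordLabel_emb]
  · exact absurd (Function.extend_apply' id (fun _ => 0) i hi) h

theorem coordLabel_eq_iff {i : ι} {k : LabelSpace J} (hk : k ≠ 0) :
    coordLabel e i = k ↔ i = e k :=
  ⟨fun h => by rw [← h, emb_coordLabel e (h ▸ hk)], fun h => h ▸ coordLabel_emb e k⟩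

variable [Fintype J] (F : Type*) [Field F] [Algebra (ZMod 2) F]

/-- The diagonal of the model matrix with parameter `s`. -/
noncomputable def modelDiag (s : LabelSpace J) (i : ι) : F :=
  algebraMap (ZMod 2) F (labelPairing (coordLabel e i) s)

/-- The model of a face: an `𝔽₂`-linear family of diagonal matrices. -/
noncomputable def modelMap [DecidableEq ι] : LabelSpace J →ₗ[ZMod 2] Matrix ι ι F where
  toFun s := Matrix.diagonal (modelDiag e F s)
  map_add' s t := by
    rw [Matrix.diagonal_add]
    congr 1
    ext i
    simp [modelDiag]
  map_smul' c s := by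
    rw [RingHom.id_apply, ← Matrix.diagonal_smul]
    congr 1
    ext i
    rw [modelDiag, map_smul, smul_eq_mul, map_mul]
    exact (Algebra.smul_def _ _).symm

/-- The arrangement of the labels of a block. -/
def blockLabel : Fin 2 ⊕ Fin 2 → ZMod 2 × ZMod 2 :=
  Sum.elim (fun a => (a, 0)) fun a => (a, 1)

theorem blockLabel_injective : Function.Injective blockLabel := by decide

theorem blockLabel_surjective : Function.Surjective blockLabel := by decide

theorem blockLabel_fst : ∀ a b : Fin 2 ⊕ Fin 2, Sum.elim id id a = Sum.elim id id b →
    (blockLabel a).1 = (blockLabel b).1 := by decide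

theorem blockLabel_snd : ∀ a b : Fin 2 ⊕ Fin 2, Sum.isLeft a = Sum.isLeft b →
    (blockLabel a).2 = (blockLabel b).2 := by decide

variable [Fintype ι] [DecidableEq ι] [DecidableEq J]

/-- The labels for the model of a face. -/
noncomputable def modelLabels : LinkLabels ι F (J → ZMod 2) (J → ZMod 2) where
  type i := (coordLabel e i).1
  coef s j := algebraMap (ZMod 2) F (j ⬝ᵥ s)
  coef_zero s := by simp
  separates j j' hj hjj' := by
    obtain ⟨s, h1, h2⟩ := exists_dotProduct_ne_zero hj hjj'
    exact ⟨s, by simp [h1], by simp [h2]⟩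
  block j := fun c => e (j, blockLabel c)
  block_injective j _ :=
    e.injective.comp fun _ _ h => blockLabel_injective (congrArg Prod.snd h)
  mem_range_block j hj i := by
    constructor
    · rintro ⟨c, rfl⟩
      rw [coordLabel_emb]
    · intro h
      have h0 : coordLabel e i ≠ 0 := fun h0 => hj (by rw [← h, h0]; rfl)
      rw [← emb_coordLabel e h0]
      obtain ⟨c, hc⟩ := blockLabel_surjective (coordLabel e i).2
      exact ⟨c, congrArg e (Prod.ext h.symm hc)⟩
  z := modelDiag e F (0, (1, 0))
  w := modelDiag e F (0, (0, 1))
  z_block j _ a b h := by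
    simp [modelDiag, coordLabel_emb, labelPairing_apply, blockLabel_fst a b h]
  w_block j _ a b h := by
    simp [modelDiag, coordLabel_emb, labelPairing_apply, blockLabel_snd a b h]
  -- On type zero, z reads the first and w the second coordinate of a label in F₂². Hence z lives on
  -- (1, 1) and (1, 0), w on (1, 1) and (0, 1), and they share only p.
  p := e (0, (1, 1))
  q := e (0, (1, 0))
  s := e (0, (0, 1))
  p_ne_q := by simp
  p_ne_s := by simp
  q_ne_s := by simp
  type_p := by rw [coordLabel_emb]
  type_q := by rw [coordLabel_emb]
  type_s := by rw [coordLabel_emb]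
  z_p := by simp [modelDiag, coordLabel_emb, labelPairing_apply]
  w_p := by simp [modelDiag, coordLabel_emb, labelPairing_apply]
  z_eq_zero i hi hp hq := by
    simp only [modelDiag, labelPairing_apply]
    rw [Ne, ← coordLabel_eq_iff e (by simp)] at hp hq
    generalize coordLabel e i = x at *
    obtain ⟨k, a, c⟩ := x
    obtain rfl : k = 0 := hi
    simp only [Prod.mk.injEq, true_and] at hp hq
    have h0 : a = 0 := by revert a c; decide
    simp [h0]
  w_eq_zero i hi hp hs := by
    simp only [modelDiag, labelPairing_apply]
    rw [Ne, ← coordLabel_eq_iff e (by simp)] at hp hs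
    generalize coordLabel e i = x at *
    obtain ⟨k, a, c⟩ := x
    obtain rfl : k = 0 := hi
    simp only [Prod.mk.injEq, true_and] at hp hs
    have h0 : c = 0 := by revert a c; decide
    simp [h0]
  -- The fourth index of type zero carries the zero label. It is available because e embeds the
  -- whole label space, which is why n ≥ 2^(r+1) is used and not only 2^(r+1) - 1.
  four_le_card := by
    calc 4 = (Finset.univ.map ((Function.Embedding.sectR (0 : J → ZMod 2)
          (ZMod 2 × ZMod 2)).trans e)).card := by
            rw [Finset.card_map]
            rfl
      _ ≤ _ := Finset.card_le_card fun i hi => by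
        obtain ⟨x, -, rfl⟩ := Finset.mem_map.1 hi
        rw [Finset.mem_filter]
        exact ⟨Finset.mem_univ _, congrArg Prod.fst (coordLabel_emb e (0, x))⟩

end Labels

/-! ### The action on matrices and the parametrisations of the top faces -/

section Action

theorem LinearIndependent.exists_linearEquiv_apply_eq {κ K E : Type*} [Field K] [AddCommGroup E]
    [Module K E] [FiniteDimensional K E] {u v : κ → E} (hu : LinearIndependent K u)
    (hv : LinearIndependent K v) : ∃ g : E ≃ₗ[K] E, ∀ k, g (u k) = v k := by
  obtain ⟨g, hg⟩ := Submodule.exists_linearEquiv_restrict_eq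
    ((Module.Basis.span hu).equiv (Module.Basis.span hv) (Equiv.refl κ))
  refine ⟨g, fun k => ?_⟩
  have h := hg (Module.Basis.span hu k)
  rw [Module.Basis.equiv_apply, Module.Basis.coe_span_apply, Module.Basis.coe_span_apply] at h
  exact h.symm

theorem LinearIndependent.exists_units_col_eq {κ ι F : Type*} [Fintype ι] [DecidableEq ι] [Field F]
    {v : κ → ι → F} (hv : LinearIndependent F v) {i : κ → ι} (hi : Function.Injective i) :
    ∃ g : (Matrix ι ι F)ˣ, ∀ k a, g.val a (i k) = v k a := by
  have hu : LinearIndependent F fun k => Pi.basisFun F ι (i k) :=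
    (Pi.basisFun F ι).linearIndependent.comp i hi
  obtain ⟨g, hg⟩ := hu.exists_linearEquiv_apply_eq hv
  refine ⟨⟨LinearMap.toMatrix' g.toLinearMap, LinearMap.toMatrix' g.symm.toLinearMap, ?_, ?_⟩,
    fun k a => ?_⟩
  · rw [← LinearMap.toMatrix'_comp]
    simp
  · rw [← LinearMap.toMatrix'_comp]
    simp
  · rw [← hg k, Pi.basisFun_apply]
    simp [LinearMap.toMatrix'_apply]

variable {ι F : Type*} [Fintype ι] [DecidableEq ι] [Field F] [Algebra (ZMod 2) F]

/-- The action `M ↦ g M h⁻¹` of the pairs `(g, h)` of invertible matrices. -/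
def pairAct (γ : (Matrix ι ι F)ˣ × (Matrix ι ι F)ˣ) : Matrix ι ι F →ₗ[ZMod 2] Matrix ι ι F :=
  LinearMap.mulRight (ZMod 2) γ.2⁻¹.val ∘ₗ LinearMap.mulLeft (ZMod 2) γ.1.val

theorem pairAct_apply (γ : (Matrix ι ι F)ˣ × (Matrix ι ι F)ˣ) (M : Matrix ι ι F) :
    pairAct γ M = γ.1.val * M * γ.2⁻¹.val := rfl

theorem pairAct_mul (γ δ : (Matrix ι ι F)ˣ × (Matrix ι ι F)ˣ) (M : Matrix ι ι F) :
    pairAct (γ * δ) M = pairAct γ (pairAct δ M) := by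
  simp only [pairAct_apply, Prod.fst_mul, Prod.snd_mul, mul_inv_rev, Units.val_mul, mul_assoc]

theorem pairAct_inv_apply (γ : (Matrix ι ι F)ˣ × (Matrix ι ι F)ˣ) (M : Matrix ι ι F) :
    pairAct γ⁻¹ (pairAct γ M) = M := by
  rw [← pairAct_mul, inv_mul_cancel, pairAct_apply]
  simp

theorem pairAct_injective (γ : (Matrix ι ι F)ˣ × (Matrix ι ι F)ˣ) :
    Function.Injective (pairAct γ) :=
  Function.LeftInverse.injective (pairAct_inv_apply γ)

theorem pairAct_eq_self_iff {γ : (Matrix ι ι F)ˣ × (Matrix ι ι F)ˣ} {M : Matrix ι ι F} :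
    pairAct γ M = M ↔ γ.1.val * M = M * γ.2.val := by
  rw [pairAct_apply, Units.mul_inv_eq_iff_eq_mul]

variable {J : Type*} [Fintype J] {e : LabelSpace J ↪ ι}

/-- Identifies the stabiliser defined by labels with the pairs fixing the model of x pointwise under
M ↦ g M h⁻¹. -/
theorem mem_stab_modelLabels {γ : (Matrix ι ι F)ˣ × (Matrix ι ι F)ˣ} :
    γ ∈ (modelLabels e F).stab ↔
      ∀ s : J → ZMod 2, pairAct γ (modelMap e F (s, 0)) = modelMap e F (s, 0) := by
  refine forall_congr' fun s => ?_
  rw [pairAct_eq_self_iff]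
  have h : (fun i => (modelLabels e F).coef s ((modelLabels e F).type i)) =
      modelDiag e F (s, 0) := by
    ext i
    simp [modelLabels, modelDiag, labelPairing_apply, dotProduct, mul_comm]
  dsimp only
  rw [h]
  rfl

theorem mem_stabWith_z_modelLabels {γ : (Matrix ι ι F)ˣ × (Matrix ι ι F)ˣ} :
    γ ∈ (modelLabels e F).stabWith (modelLabels e F).z ↔ γ ∈ (modelLabels e F).stab ∧
      pairAct γ (modelMap e F (0, (1, 0))) = modelMap e F (0, (1, 0)) := by
  rw [pairAct_eq_self_iff, LinkLabels.stabWith, Subgroup.mem_inf, mem_diagStab, forall_const]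
  rfl

theorem mem_stabWith_w_modelLabels {γ : (Matrix ι ι F)ˣ × (Matrix ι ι F)ˣ} :
    γ ∈ (modelLabels e F).stabWith (modelLabels e F).w ↔ γ ∈ (modelLabels e F).stab ∧
      pairAct γ (modelMap e F (0, (0, 1))) = modelMap e F (0, (0, 1)) := by
  rw [pairAct_eq_self_iff, LinkLabels.stabWith, Subgroup.mem_inf, mem_diagStab, forall_const]
  rfl

end Action

/-! ### All top faces are translates of the diagonal model -/

section TopFaces

theorem hadamardGenerator_injective (r : ℕ) : Function.Injective (hadamardGenerator r) := by
  intro k k' h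
  have h1 (j : ℕ) (hj : j ≤ r) :
      (2 ^ (r + 1) - (k.val + 1)).testBit j = (2 ^ (r + 1) - (k'.val + 1)).testBit j := by
    -- The most significant bit comes first, so bit j stands in column r - j. The numbers are below
    -- 2^(r+1), so these bits determine them.
    have := congrFun h ⟨r - j, by omega⟩
    simp only [hadamardGenerator, Matrix.of_apply, show r - (r - j) = j by omega] at this
    split_ifs at this with h1 h2 h2
    · rw [h1, h2]
    · exact absurd this (by decide)
    · exact absurd this (by decide)
    · rw [Bool.not_eq_true] at h1 h2
      rw [h1, h2]
  have h2 : 2 ^ (r + 1) - (k.val + 1) = 2 ^ (r + 1) - (k'.val + 1) := by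
    refine Nat.eq_of_testBit_eq fun j => ?_
    rcases le_or_gt j r with hj | hj
    · exact h1 j hj
    · have hlt (m : ℕ) (hm : m < 2 ^ (r + 1)) : m.testBit j = false :=
        Nat.testBit_lt_two_pow (hm.trans_le (Nat.pow_le_pow_right two_pos hj))
      have : 0 < 2 ^ (r + 1) := by positivity
      rw [hlt _ (by omega), hlt _ (by omega)]
  have := k.2
  have := k'.2
  ext
  omega

theorem hadamardGenerator_ne_zero (r : ℕ) (k : Fin (2 ^ (r + 1) - 1)) :
    hadamardGenerator r k ≠ 0 := by
  intro h
  have hk := k.2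
  have h2 : 2 ^ (r + 1) - (k.val + 1) = 0 := by
    refine Nat.eq_of_testBit_eq fun j => ?_
    rw [Nat.zero_testBit]
    rcases le_or_gt j r with hj | hj
    · have := congrFun h ⟨r - j, by omega⟩
      simp only [hadamardGenerator, Matrix.of_apply, show r - (r - j) = j by omega] at this
      split_ifs at this with h1
      · exact absurd this one_ne_zero
      · exact Bool.not_eq_true _ ▸ h1
    · refine Nat.testBit_lt_two_pow (lt_of_lt_of_le ?_ (Nat.pow_le_pow_right two_pos hj))
      have : 0 < 2 ^ (r + 1) := by positivity
      omega
  omega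

variable {r b n : ℕ}

theorem map_pairAct_mem_topFaces {x : Submodule (ZMod 2) (MatrixSpace b n)}
    (hx : x ∈ topFaces r b n)
    (γ : (MatrixSpace b n)ˣ × (MatrixSpace b n)ˣ) :
    x.map (pairAct γ) ∈ topFaces r b n := by
  obtain ⟨hx, e₁, e₂, h₁, h₂, rfl⟩ := hx
  refine ⟨(Submodule.equivMapOfInjective _ (pairAct_injective γ) _).finrank_eq.symm.trans hx,
    fun k => γ.1.val.mulVec (e₁ k), fun k => Matrix.vecMul (e₂ k) γ.2⁻¹.val, ?_, ?_, ?_⟩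
  · exact h₁.map' γ.1.val.mulVecLin
      (LinearMap.ker_eq_bot.2 (Matrix.mulVec_injective_of_isUnit γ.1.isUnit))
  · exact h₂.map' γ.2⁻¹.val.vecMulLinear
      (LinearMap.ker_eq_bot.2 (Matrix.vecMul_injective_of_isUnit γ.2⁻¹.isUnit))
  · rw [← LinearMap.range_comp]
    congr 1
    refine LinearMap.ext fun s => ?_
    simp only [LinearMap.comp_apply, tensorColumns, Fintype.linearCombination_apply, map_sum,
      map_smul, pairAct_apply, Matrix.mul_vecMulVec, Matrix.vecMulVec_mul]

/-- In terms of β, each row of the Hadamard matrix becomes a functional on the label space. By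
injectivity and counting these are all the nonzero functionals, so β s = ∑ ⟨κ k, s⟩ e₁ k ⊗ e₂ k.
Matrices sending the coordinate vector at e (κ k) to e₁ k and to e₂ k then carry the model to β. The
symmetry of the code is what makes every basis of the face equally good. -/
theorem exists_pairAct_modelMap_eq {J : Type*} [Fintype J] [DecidableEq J]
    (hJ : Fintype.card J + 1 = r) (e : LabelSpace J ↪ Fin n)
    {β : LabelSpace J →ₗ[ZMod 2] MatrixSpace b n} (hβ : Function.Injective β)
    (hr : LinearMap.range β ∈ topFaces r b n) :
    ∃ γ, ∀ s, β s = pairAct γ (modelMap e (GaloisField 2 b) s) := by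
  obtain ⟨hdim, e₁, e₂, h₁, h₂, hrange⟩ := hr
  set θ := tensorColumns e₁ e₂ ∘ₗ (hadamardGenerator r).mulVecLin with hθ
  have hθinj : Function.Injective θ := by
    rw [hrange] at hdim
    have := θ.finrank_range_add_finrank_ker
    rw [hdim, Module.finrank_fin_fun] at this
    exact LinearMap.ker_eq_bot.1 (Submodule.finrank_eq_zero.1 (by omega))
  let A : LabelSpace J ≃ₗ[ZMod 2] (Fin (r + 1) → ZMod 2) :=
    (LinearEquiv.ofInjective β hβ).trans
      ((LinearEquiv.ofEq _ _ hrange).trans (LinearEquiv.ofInjective θ hθinj).symm)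
  have hA (s : LabelSpace J) : θ (A s) = β s := by
    have : LinearEquiv.ofInjective θ hθinj (A s) =
        LinearEquiv.ofEq _ _ hrange (LinearEquiv.ofInjective β hβ s) := by simp [A]
    exact congrArg Subtype.val this
  have hκ (k : Fin (2 ^ (r + 1) - 1)) : ∃ κ : LabelSpace J, ∀ s,
      labelPairing κ s = (hadamardGenerator r).mulVec (A s) k := by
    obtain ⟨κ, h⟩ := exists_labelPairing_eq
      (LinearMap.proj k ∘ₗ (hadamardGenerator r).mulVecLin ∘ₗ A.toLinearMap)
    exact ⟨κ, fun s => by rw [h]; rfl⟩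
  choose κ hκ using hκ
  have hrow (k : Fin (2 ^ (r + 1) - 1)) (j : Fin (r + 1)) :
      hadamardGenerator r k j = labelPairing (κ k) (A.symm (Pi.single j 1)) := by
    rw [hκ, LinearEquiv.apply_symm_apply, Matrix.mulVec_single_one]
    rfl
  have hκinj : Function.Injective κ := fun k k' h =>
    hadamardGenerator_injective r (funext fun j => by rw [hrow, hrow, h])
  have hκ0 (k) : κ k ≠ 0 := fun h =>
    hadamardGenerator_ne_zero r k (funext fun j => by rw [hrow, h]; simp [labelPairing_apply])
  have hκsurj (l : LabelSpace J) (hl : l ≠ 0) : ∃ k, κ k = l := by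
    by_contra! h
    have h1 : (Finset.univ.map ⟨κ, hκinj⟩) ⊆ (Finset.univ.erase 0).erase l := by
      intro x hx
      obtain ⟨k, -, rfl⟩ := Finset.mem_map.1 hx
      simp only [Finset.mem_erase, Finset.mem_univ, and_true]
      exact ⟨h k, hκ0 k⟩
    have h2 := Finset.card_le_card h1
    rw [Finset.card_map, Finset.card_erase_of_mem (by simp [hl]),
      Finset.card_erase_of_mem (Finset.mem_univ _), Finset.card_univ, Finset.card_univ,
      Fintype.card_fin] at h2
    have h3 : Fintype.card (LabelSpace J) = 2 ^ (r + 1) := by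
      rw [Fintype.card_prod, Fintype.card_prod, Fintype.card_fun, ZMod.card, ← hJ]
      ring
    have h4 : 2 ^ 1 ≤ 2 ^ (r + 1) := Nat.pow_le_pow_right two_pos (by omega)
    omega
  obtain ⟨g₁, hg₁⟩ := h₁.exists_units_col_eq (e.injective.comp hκinj)
  obtain ⟨g₂, hg₂⟩ := h₂.exists_units_col_eq (e.injective.comp hκinj)
  -- The action uses the inverse of the second matrix, so the inverse transpose of g₂ is taken in
  -- order to multiply on the right by g₂ᵀ.
  let g₂' : (MatrixSpace b n)ˣ :=
    ⟨g₂⁻¹.val.transpose, g₂.val.transpose,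
      by rw [← Matrix.transpose_mul, Units.mul_inv, Matrix.transpose_one],
      by rw [← Matrix.transpose_mul, Units.inv_mul, Matrix.transpose_one]⟩
  refine ⟨(g₁, g₂'), fun s => ?_⟩
  have hβs : β s = ∑ k, labelPairing (κ k) s • Matrix.vecMulVec (e₁ k) (e₂ k) := by
    rw [← hA, hθ]
    simp only [LinearMap.comp_apply, tensorColumns, Fintype.linearCombination_apply, hκ,
      Matrix.mulVecLin_apply]
  ext a c
  have hact : pairAct (g₁, g₂') (modelMap e (GaloisField 2 b) s) =
    g₁.val * Matrix.diagonal (modelDiag e _ s) * g₂.val.transpose := rfl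
  rw [hact, hβs, Matrix.sum_apply, Matrix.mul_apply]
  refine Fintype.sum_of_injective (fun k => e (κ k)) (e.injective.comp hκinj) _ _ ?_ ?_
  · intro i hi
    have : coordLabel e i = 0 := by
      by_contra h
      obtain ⟨k, hk⟩ := hκsurj _ h
      exact hi ⟨k, (congrArg e hk).trans (emb_coordLabel e h)⟩
    simp [Matrix.mul_diagonal, modelDiag, this, labelPairing_apply]
  · intro k
    have h1 := hg₁ k a
    have h2 := hg₂ k c
    simp only [Function.comp_apply] at h1 h2
    rw [Matrix.mul_diagonal, Matrix.transpose_apply, h1, h2, modelDiag, coordLabel_emb,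
      Matrix.smul_apply, Matrix.vecMulVec_apply, Algebra.smul_def]
    ring

end TopFaces

/-! ### The right regular representation -/

section RightRegular

variable {G : Type*} [Group G] [Fintype G]

/-- The right regular representation on the functions on a finite group. -/
noncomputable def rightRegular (G : Type*) [Group G] [Fintype G] :
    G →* (EuclideanSpace ℝ G ≃ₗᵢ[ℝ] EuclideanSpace ℝ G) where
  toFun δ := LinearIsometryEquiv.piLpCongrLeft 2 ℝ ℝ (Equiv.mulRight δ).symm
  map_one' := by
    ext f γ
    change f.ofLp (γ * 1) = f.ofLp γ
    rw [mul_one]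
  map_mul' δ δ' := by
    ext f γ
    change f.ofLp (γ * (δ * δ')) = f.ofLp (γ * δ * δ')
    rw [mul_assoc]

theorem rightRegular_apply (δ : G) (f : EuclideanSpace ℝ G) (γ : G) :
    rightRegular G δ f γ = f (γ * δ) := rfl

theorem mem_fixedSpace_rightRegular {S : Set G} {f : EuclideanSpace ℝ G} :
    f ∈ fixedSpace (rightRegular G) S ↔ ∀ δ ∈ S, ∀ γ, f (γ * δ) = f γ := by
  refine forall₂_congr fun δ _ => ?_
  rw [PiLp.ext_iff]
  simp_rw [rightRegular_apply]

/-- A correlation bound for functions on a left coset `T` of `H` which are invariant under the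
right translations by elements of `Hz` and `Hw`. -/
theorem abs_sum_mul_le_of_coset {H Hz Hw : Subgroup G} {c : ℝ}
    (hbound : ∀ u ∈ fixedSpace (rightRegular G) (Hw : Set G),
      fixProj (rightRegular G) (H : Set G) u = 0 →
        ‖fixProj (rightRegular G) (Hz : Set G) u‖ ≤ c * ‖u‖)
    {T : Set G} (hT : ∀ γ ∈ T, ∀ δ ∈ T, γ⁻¹ * δ ∈ H) {φ φ' : G → ℝ}
    (hφ : ∀ δ ∈ Hz, ∀ γ, φ (γ * δ) = φ γ) (hφ' : ∀ δ ∈ Hw, ∀ γ, φ' (γ * δ) = φ' γ)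
    (hsupp : ∀ γ ∉ T, φ' γ = 0) (hsum : ∑ γ, φ' γ = 0)
    (hsq : ∑ γ, φ' γ ^ 2 = ∑ γ, φ γ ^ 2) :
    |∑ γ, φ γ * φ' γ| ≤ c * ∑ γ, φ γ ^ 2 := by
  set u : EuclideanSpace ℝ G := WithLp.toLp 2 φ with hu
  set u' : EuclideanSpace ℝ G := WithLp.toLp 2 φ' with hu'
  have hinner (f g : EuclideanSpace ℝ G) : inner ℝ f g = ∑ γ, f γ * g γ := by
    rw [PiLp.inner_apply]
    simp [mul_comm]
  have hnorm (f : EuclideanSpace ℝ G) : ‖f‖ * ‖f‖ = ∑ γ, f γ ^ 2 := by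
    rw [← sq, EuclideanSpace.real_norm_sq_eq]
  have huz : u ∈ fixedSpace (rightRegular G) (Hz : Set G) :=
    mem_fixedSpace_rightRegular.2 fun δ hδ γ => hφ δ hδ γ
  have huw : u' ∈ fixedSpace (rightRegular G) (Hw : Set G) :=
    mem_fixedSpace_rightRegular.2 fun δ hδ γ => hφ' δ hδ γ
  -- Functions fixed by H are constant on the coset T that supports φ', so orthogonality to all of
  -- them is the single condition that φ' has sum zero.
  have h0 : fixProj (rightRegular G) (H : Set G) u' = 0 := by
    refine fixProj_eq_of_mem _ (Submodule.zero_mem _) fun v hv => ?_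
    rw [sub_zero, hinner]
    rw [mem_fixedSpace_rightRegular] at hv
    rcases T.eq_empty_or_nonempty with h | ⟨γ₀, hγ₀⟩
    · exact Finset.sum_eq_zero fun γ _ => by
        rw [show u' γ = 0 from hsupp γ (by simp [h]), zero_mul]
    · have (γ : G) : u' γ * v γ = φ' γ * v γ₀ := by
        by_cases hγ : γ ∈ T
        · have := hv _ (hT γ₀ hγ₀ γ hγ) γ₀
          rw [mul_inv_cancel_left] at this
          rw [this]
        · rw [show u' γ = 0 from hsupp γ hγ, hsupp γ hγ, zero_mul, zero_mul]
      simp_rw [this, ← Finset.sum_mul, hsum, zero_mul]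
  have hnn : ‖u'‖ = ‖u‖ := by
    rw [← mul_self_inj (norm_nonneg _) (norm_nonneg _), hnorm, hnorm]
    exact hsq
  calc |∑ γ, φ γ * φ' γ| = |inner ℝ u (fixProj (rightRegular G) (Hz : Set G) u')| := by
        rw [← inner_fixProj_left, fixProj_eq_self _ huz, hinner]
    _ ≤ ‖u‖ * (c * ‖u‖) := (abs_real_inner_le_norm _ _).trans <|
        mul_le_mul_of_nonneg_left (hnn ▸ hbound u' huw h0) (norm_nonneg _)
    _ = c * ∑ γ, φ γ ^ 2 := by rw [mul_left_comm, hnorm]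

end RightRegular

/-- The fibres of an equivariant map on a subset of a group closed under `γ₁ γ₂⁻¹ γ`. -/
theorem card_fiber_eq_of_translate {G β : Type*} [Group G] {T : Set G}
    [Fintype T] [DecidableEq β] (Q : T → β)
    (hT : ∀ γ₁ γ₂ γ : T, γ₁.val * γ₂.val⁻¹ * γ.val ∈ T)
    (hQ : ∀ γ₁ γ₂ γ : T, Q γ = Q γ₂ → Q ⟨_, hT γ₁ γ₂ γ⟩ = Q γ₁) (γ₁ γ₂ : T) :
    (Finset.univ.filter fun γ => Q γ = Q γ₁).card =
      (Finset.univ.filter fun γ => Q γ = Q γ₂).card := by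
  have hle (γ₁ γ₂ : T) : (Finset.univ.filter fun γ => Q γ = Q γ₂).card ≤
      (Finset.univ.filter fun γ => Q γ = Q γ₁).card := by
    refine Finset.card_le_card_of_injOn (fun γ => ⟨_, hT γ₁ γ₂ γ⟩) (fun γ hγ => ?_)
      fun γ _ γ' _ h => ?_
    · exact Finset.mem_coe.2 (Finset.mem_filter.2
        ⟨Finset.mem_univ _, hQ γ₁ γ₂ γ (Finset.mem_filter.1 hγ).2⟩)
    · exact Subtype.ext (mul_left_cancel (congrArg Subtype.val h))
  exact le_antisymm (hle γ₂ γ₁) (hle γ₁ γ₂)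

/-! ### Frames of a face -/

section Frames

variable {r b n : ℕ} {J : Type*} [Fintype J]

/-- The subspace of the model of a top face that models a vertex in the direction `k`. -/
noncomputable def vertexModel (e : LabelSpace J ↪ Fin n) (b : ℕ) (k : ZMod 2 × ZMod 2) :
    Submodule (ZMod 2) (MatrixSpace b n) :=
  LinearMap.range (modelMap e (GaloisField 2 b) ∘ₗ LinearMap.inl (ZMod 2) _ _) ⊔
    Submodule.span (ZMod 2) {modelMap e (GaloisField 2 b) (0, k)}

/-- The pairs of matrices which map the model of a face to the face parametrised by `ξ`. -/
def frames (e : LabelSpace J ↪ Fin n) (ξ : (J → ZMod 2) →ₗ[ZMod 2] MatrixSpace b n) :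
    Set ((MatrixSpace b n)ˣ × (MatrixSpace b n)ˣ) :=
  {γ | ∀ s, pairAct γ (modelMap e (GaloisField 2 b) (s, 0)) = ξ s}

variable {e : LabelSpace J ↪ Fin n} {ξ : (J → ZMod 2) →ₗ[ZMod 2] MatrixSpace b n}

/-- Left translation by γ₁ γ₂⁻¹ moves frames over the vertex or edge of γ₂ to frames over that of
γ₁; this makes the fibres equinumerous. -/
theorem translate_mem_frames {γ₁ γ₂ γ : (MatrixSpace b n)ˣ × (MatrixSpace b n)ˣ}
    (h₁ : γ₁ ∈ frames e ξ) (h₂ : γ₂ ∈ frames e ξ) (h : γ ∈ frames e ξ) :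
    γ₁ * γ₂⁻¹ * γ ∈ frames e ξ := by
  intro s
  rw [pairAct_mul, pairAct_mul, h s, ← h₂ s, pairAct_inv_apply, h₁ s, h₂ s]

theorem inv_mul_mem_stab {γ δ : (MatrixSpace b n)ˣ × (MatrixSpace b n)ˣ}
    (hγ : γ ∈ frames e ξ) (hδ : δ ∈ frames e ξ) :
    γ⁻¹ * δ ∈ (modelLabels e (GaloisField 2 b)).stab := by
  rw [mem_stab_modelLabels]
  intro s
  rw [pairAct_mul, hδ s, ← hγ s, pairAct_inv_apply]

theorem mul_mem_frames_iff {γ δ : (MatrixSpace b n)ˣ × (MatrixSpace b n)ˣ}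
    (hδ : δ ∈ (modelLabels e (GaloisField 2 b)).stab) : γ * δ ∈ frames e ξ ↔ γ ∈ frames e ξ := by
  refine forall_congr' fun s => ?_
  rw [pairAct_mul, mem_stab_modelLabels.1 hδ]

/-- The source of right-invariance: δ fixes the model of the vertex, so γ and γ δ determine the same
vertex of the link. -/
theorem map_vertexModel_mul {k : ZMod 2 × ZMod 2} {δ : (MatrixSpace b n)ˣ × (MatrixSpace b n)ˣ}
    (hδ : δ ∈ (modelLabels e (GaloisField 2 b)).stab)
    (hk : pairAct δ (modelMap e (GaloisField 2 b) (0, k)) = modelMap e (GaloisField 2 b) (0, k))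
    (γ : (MatrixSpace b n)ˣ × (MatrixSpace b n)ˣ) :
    (vertexModel e b k).map (pairAct (γ * δ)) = (vertexModel e b k).map (pairAct γ) := by
  have hδ' : (vertexModel e b k).map (pairAct δ) = vertexModel e b k := by
    rw [vertexModel, Submodule.map_sup, ← LinearMap.range_comp, Submodule.map_span,
      Set.image_singleton, hk]
    congr 2
    exact LinearMap.ext fun s => mem_stab_modelLabels.1 hδ s
  conv_rhs => rw [← hδ', ← Submodule.map_comp]
  congr 1
  exact LinearMap.ext fun M => pairAct_mul γ δ M

theorem map_pairAct_translate {U : Submodule (ZMod 2) (MatrixSpace b n)}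
    {γ₁ γ₂ γ : (MatrixSpace b n)ˣ × (MatrixSpace b n)ˣ}
    (h : U.map (pairAct γ) = U.map (pairAct γ₂)) :
    U.map (pairAct (γ₁ * γ₂⁻¹ * γ)) = U.map (pairAct γ₁) := by
  have h1 : pairAct (γ₁ * γ₂⁻¹ * γ) = pairAct (γ₁ * γ₂⁻¹) ∘ₗ pairAct γ :=
    LinearMap.ext fun M => pairAct_mul _ γ M
  have h2 : pairAct γ₁ = pairAct (γ₁ * γ₂⁻¹) ∘ₗ pairAct γ₂ :=
    LinearMap.ext fun M => by rw [LinearMap.comp_apply, ← pairAct_mul, inv_mul_cancel_right]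
  rw [h1, h2, Submodule.map_comp, Submodule.map_comp, h]

theorem map_vertexModel {γ : (MatrixSpace b n)ˣ × (MatrixSpace b n)ˣ} (hγ : γ ∈ frames e ξ)
    (k : ZMod 2 × ZMod 2) : (vertexModel e b k).map (pairAct γ) = LinearMap.range ξ ⊔
      Submodule.span (ZMod 2) {pairAct γ (modelMap e (GaloisField 2 b) (0, k))} := by
  rw [vertexModel, Submodule.map_sup, ← LinearMap.range_comp, Submodule.map_span,
    Set.image_singleton]
  congr 2
  exact LinearMap.ext fun s => hγ s

theorem vertexModel_sup_span {k k' : ZMod 2 × ZMod 2}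
    (hk : k = (1, 0) ∧ k' = (0, 1) ∨ k = (0, 1) ∧ k' = (1, 0)) :
    vertexModel e b k ⊔ Submodule.span (ZMod 2) {modelMap e (GaloisField 2 b) (0, k')} =
      LinearMap.range (modelMap e (GaloisField 2 b)) := by
  have hmem (s) : modelMap e (GaloisField 2 b) s ∈ LinearMap.range (modelMap e (GaloisField 2 b)) :=
    ⟨s, rfl⟩
  refine le_antisymm (sup_le (sup_le (LinearMap.range_comp_le_range _ _) ?_) ?_) ?_
  · exact (Submodule.span_singleton_le_iff_mem _ _).2 (hmem _)
  · exact (Submodule.span_singleton_le_iff_mem _ _).2 (hmem _)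
  · rintro _ ⟨⟨s, t⟩, rfl⟩
    have hs : ((s, t) : LabelSpace J) = (s, 0) + ((0, (t.1, 0)) + (0, (0, t.2))) := by simp
    have h1 (c : ZMod 2) : ((0, (c, 0)) : LabelSpace J) = c • (0, (1, 0)) := by simp
    have h2 (c : ZMod 2) : ((0, (0, c)) : LabelSpace J) = c • (0, (0, 1)) := by simp
    rw [hs, map_add, map_add, h1, h2, map_smul, map_smul]
    have ha : modelMap e (GaloisField 2 b) (0, k) ∈ vertexModel e b k ⊔
        Submodule.span (ZMod 2) {modelMap e (GaloisField 2 b) (0, k')} :=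
      le_sup_left (a := vertexModel e b k) (Submodule.mem_sup_right
        (Submodule.mem_span_singleton_self _))
    have hb : modelMap e (GaloisField 2 b) (0, k') ∈ vertexModel e b k ⊔
        Submodule.span (ZMod 2) {modelMap e (GaloisField 2 b) (0, k')} :=
      Submodule.mem_sup_right (Submodule.mem_span_singleton_self _)
    refine Submodule.add_mem _ (Submodule.mem_sup_left (Submodule.mem_sup_left ⟨s, rfl⟩))
      (Submodule.add_mem _ (Submodule.smul_mem _ _ ?_) (Submodule.smul_mem _ _ ?_))
    · rcases hk with ⟨rfl, rfl⟩ | ⟨rfl, rfl⟩ <;> assumption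
    · rcases hk with ⟨rfl, rfl⟩ | ⟨rfl, rfl⟩ <;> assumption

theorem vertexModel_sup_vertexModel :
    vertexModel e b (1, 0) ⊔ vertexModel e b (0, 1) =
      LinearMap.range (modelMap e (GaloisField 2 b)) := by
  refine le_antisymm (sup_le ?_ ?_) ?_
  · rw [← vertexModel_sup_span (Or.inl ⟨rfl, rfl⟩)]
    exact le_sup_left
  · rw [← vertexModel_sup_span (Or.inr ⟨rfl, rfl⟩)]
    exact le_sup_left
  · rw [← vertexModel_sup_span (Or.inl ⟨rfl, rfl⟩)]
    exact sup_le_sup_left le_sup_right _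

theorem finrank_sup_span_singleton_le {K E : Type*} [Field K] [AddCommGroup E] [Module K E]
    [FiniteDimensional K E] (U : Submodule K E) (u : E) :
    Module.finrank K ↥(U ⊔ Submodule.span K {u}) ≤ Module.finrank K U + 1 :=
  (Submodule.finrank_add_le_finrank_add_finrank _ _).trans
    (Nat.add_le_add_left ((finrank_span_le_card _).trans (by simp)) _)

theorem finrank_vertexModel {k k' : ZMod 2 × ZMod 2}
    (hk : k = (1, 0) ∧ k' = (0, 1) ∨ k = (0, 1) ∧ k' = (1, 0)) (hJ : Fintype.card J + 1 = r)
    (htop : LinearMap.range (modelMap e (GaloisField 2 b)) ∈ topFaces r b n) :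
    Module.finrank (ZMod 2) (vertexModel e b k) = r := by
  have h1 : Module.finrank (ZMod 2) (vertexModel e b k) ≤ Fintype.card J + 1 := by
    refine (finrank_sup_span_singleton_le _ _).trans (Nat.add_le_add_right ?_ 1)
    exact (LinearMap.finrank_range_le _).trans (Module.finrank_fintype_fun_eq_card _).le
  have h2 := finrank_sup_span_singleton_le (vertexModel e b k)
    (modelMap e (GaloisField 2 b) (0, k'))
  rw [vertexModel_sup_span hk, htop.1] at h2
  omega

theorem finrank_map_pairAct (γ : (MatrixSpace b n)ˣ × (MatrixSpace b n)ˣ)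
    (U : Submodule (ZMod 2) (MatrixSpace b n)) :
    Module.finrank (ZMod 2) (U.map (pairAct γ)) = Module.finrank (ZMod 2) U :=
  (Submodule.equivMapOfInjective _ (pairAct_injective γ) _).finrank_eq.symm

/-- Spanning vectors for the two extra directions extend ξ to a surjection onto the top face,
injective by dimension; its translation from the model is a frame. -/
theorem exists_frame [DecidableEq J] (hJ : Fintype.card J + 1 = r) (e : LabelSpace J ↪ Fin n)
    {u₁ u₂ : MatrixSpace b n}
    (htop : LinearMap.range ξ ⊔ (Submodule.span (ZMod 2) {u₁} ⊔ Submodule.span (ZMod 2) {u₂}) ∈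
      topFaces r b n) :
    ∃ γ ∈ frames e ξ, pairAct γ (modelMap e (GaloisField 2 b) (0, (1, 0))) = u₁ ∧
      pairAct γ (modelMap e (GaloisField 2 b) (0, (0, 1))) = u₂ := by
  set β : LabelSpace J →ₗ[ZMod 2] MatrixSpace b n :=
    ξ.coprod ((LinearMap.toSpanSingleton (ZMod 2) _ u₁).coprod
      (LinearMap.toSpanSingleton (ZMod 2) _ u₂)) with hβ
  have hrange : LinearMap.range β = LinearMap.range ξ ⊔
      (Submodule.span (ZMod 2) {u₁} ⊔ Submodule.span (ZMod 2) {u₂}) := by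
    rw [hβ, LinearMap.range_coprod, LinearMap.range_coprod, LinearMap.range_toSpanSingleton,
      LinearMap.range_toSpanSingleton]
  rw [← hrange] at htop
  have hinj : Function.Injective β := by
    have h := β.finrank_range_add_finrank_ker
    rw [htop.1, Module.finrank_prod, Module.finrank_prod, Module.finrank_fintype_fun_eq_card,
      Module.finrank_self] at h
    exact LinearMap.ker_eq_bot.1 (Submodule.finrank_eq_zero.1 (by omega))
  obtain ⟨γ, hγ⟩ := exists_pairAct_modelMap_eq hJ e hinj htop
  refine ⟨γ, fun s => ?_, ?_, ?_⟩ <;> rw [← hγ] <;> simp [hβ]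

end Frames

/-! ### The links of the complex -/

section Links

theorem GrassmannianComplex.link_weight_pos {K E : Type*} [Field K] [AddCommGroup E] [Module K E]
    [Finite (Submodule K E)] (X : GrassmannianComplex K E) {x y : Submodule K E}
    (hy : y ∈ X.faces) (hxy : x ≤ y) : 0 < (X.toWeightedPoset.link x).weight y := by
  have hpos {z : Submodule K E} (hz : z ∈ X.faces) : 0 < X.toWeightedPoset.weight z := by
    refine one_div_pos.2 (Nat.cast_pos.2 ?_)
    have : Nonempty {y : Submodule K E // y ∈ X.faces ∧
      Module.finrank K y = Module.finrank K z} := ⟨⟨z, hz, rfl⟩⟩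
    exact Nat.card_pos
  refine div_pos (hpos hy) ?_
  rw [finsum_mem_eq_finite_toFinset_sum _ (Set.toFinite _)]
  refine Finset.sum_pos (fun z hz => hpos ?_) ⟨y, ?_⟩
  · exact ((Set.Finite.mem_toFinset _).1 hz).1.1
  · exact (Set.Finite.mem_toFinset _).2 ⟨⟨hy, hxy⟩, rfl⟩

theorem GrassmannianComplex.link_weight_eq {K E : Type*} [Field K] [AddCommGroup E] [Module K E]
    (X : GrassmannianComplex K E) (x : Submodule K E) {y z : Submodule K E}
    (h : Module.finrank K y = Module.finrank K z) :
    (X.toWeightedPoset.link x).weight y = (X.toWeightedPoset.link x).weight z := by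
  simp only [WeightedPoset.link, GrassmannianComplex.toWeightedPoset, h]

theorem Submodule.sup_span_eq_of_finrank_eq {K E : Type*} [Field K] [AddCommGroup E] [Module K E]
    [FiniteDimensional K E] {x v : Submodule K E} (hxv : x ≤ v)
    (hv : Module.finrank K v = Module.finrank K x + 1) {u : E} (hu : u ∈ v) (hux : u ∉ x) :
    x ⊔ Submodule.span K {u} = v := by
  refine Submodule.eq_of_le_of_finrank_le
    (sup_le hxv ((Submodule.span_singleton_le_iff_mem _ _).2 hu)) ?_
  rw [hv]
  refine Submodule.finrank_lt_finrank_of_lt (lt_of_le_of_ne le_sup_left fun h => hux ?_)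
  rw [h]
  exact Submodule.mem_sup_right (Submodule.mem_span_singleton_self u)

theorem Submodule.exists_sup_span_eq {K E : Type*} [Field K] [AddCommGroup E] [Module K E]
    [FiniteDimensional K E] {x v : Submodule K E} (hxv : x ≤ v)
    (hv : Module.finrank K v = Module.finrank K x + 1) : ∃ u, x ⊔ Submodule.span K {u} = v := by
  have hlt : x < v := lt_of_le_of_ne hxv fun h => by rw [h] at hv; omega
  obtain ⟨u, hu, hux⟩ := SetLike.exists_of_lt hlt
  exact ⟨u, Submodule.sup_span_eq_of_finrank_eq hxv hv hu hux⟩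

variable {r b n : ℕ} {x : Submodule (ZMod 2) (MatrixSpace b n)}

theorem mem_link_level_zero (hx : Module.finrank (ZMod 2) x + 1 = r)
    {v : Submodule (ZMod 2) (MatrixSpace b n)} :
    v ∈ ((matrixComplex r b n).toWeightedPoset.link x).level 0 ↔
      x ≤ v ∧ Module.finrank (ZMod 2) v = r ∧ ∃ y ∈ topFaces r b n, v ≤ y := by
  have : (((Module.finrank (ZMod 2) v : ℤ) - 1) - ((Module.finrank (ZMod 2) x : ℤ) - 1) - 1 = 0) ↔
      Module.finrank (ZMod 2) v = r := by omega
  constructor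
  · rintro ⟨⟨h1, h2⟩, h3⟩
    exact ⟨h2, this.1 h3, h1⟩
  · rintro ⟨h1, h2, h3⟩
    exact ⟨⟨h3, h1⟩, this.2 h2⟩

theorem mem_link_level_one (hx : Module.finrank (ZMod 2) x + 1 = r)
    {v : Submodule (ZMod 2) (MatrixSpace b n)} :
    v ∈ ((matrixComplex r b n).toWeightedPoset.link x).level 1 ↔ x ≤ v ∧ v ∈ topFaces r b n := by
  have : (((Module.finrank (ZMod 2) v : ℤ) - 1) - ((Module.finrank (ZMod 2) x : ℤ) - 1) - 1 = 1) ↔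
      Module.finrank (ZMod 2) v = r + 1 := by omega
  constructor
  · rintro ⟨⟨⟨y, hy, hvy⟩, h2⟩, h3⟩
    rw [Submodule.eq_of_le_of_finrank_eq hvy ((this.1 h3).trans hy.1.symm)]
    exact ⟨h2.trans hvy, hy⟩
  · rintro ⟨h1, h2⟩
    exact ⟨⟨⟨v, h2, le_rfl⟩, h1⟩, this.2 h2.1⟩

open scoped Classical in
/-- The edges of the 1-skeleton of the link of a face of codimension two have equal weights. -/
theorem exists_skeletonGraph_link_eq (hx : Module.finrank (ZMod 2) x + 1 = r) :
    ∃ c > 0, ∀ v v' : ((matrixComplex r b n).toWeightedPoset.link x).level 0,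
      ((matrixComplex r b n).toWeightedPoset.link x).skeletonGraph v v' =
        if v ≠ v' ∧ v.val ⊔ v'.val ∈ topFaces r b n then c else 0 := by
  set Y := (matrixComplex r b n).toWeightedPoset.link x with hY
  have hgraph (v v' : Y.level 0) : Y.skeletonGraph v v' =
      if v ≠ v' ∧ v.val ⊔ v'.val ∈ topFaces r b n then Y.weight (v.val ⊔ v'.val) else 0 := by
    change (if v = v' then 0 else _) = _
    by_cases hvv : v = v'
    · simp [hvv]
    rw [if_neg hvv]
    have hv := (mem_link_level_zero hx).1 v.2
    have hv' := (mem_link_level_zero hx).1 v'.2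
    -- Two distinct vertices have the same dimension r, so their sum already has dimension at least
    -- r + 1 and is the only top face above both.
    have hle {y : Submodule (ZMod 2) (MatrixSpace b n)} (hy : y ∈ topFaces r b n) (h1 : v.val ≤ y)
        (h2 : v'.val ≤ y) : y = v.val ⊔ v'.val := by
      symm
      refine Submodule.eq_of_le_of_finrank_le (sup_le h1 h2) ?_
      rw [hy.1, ← hv.2.1]
      refine Submodule.finrank_lt_finrank_of_lt (lt_of_le_of_ne le_sup_left fun h => hvv ?_)
      exact Subtype.ext (Submodule.eq_of_le_of_finrank_eq (le_sup_right.trans h.ge)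
        (hv'.2.1.trans hv.2.1.symm)).symm
    by_cases htop : v.val ⊔ v'.val ∈ topFaces r b n
    · have hset : {y | y ∈ Y.level 1 ∧ v.val < y ∧ v'.val < y} = {v.val ⊔ v'.val} := by
        ext y
        constructor
        · rintro ⟨h1, h2, h3⟩
          exact hle ((mem_link_level_one hx).1 h1).2 h2.le h3.le
        · rintro rfl
          have hne {w : Submodule (ZMod 2) (MatrixSpace b n)}
              (hw : Module.finrank (ZMod 2) w = r) : w ≠ v.val ⊔ v'.val := by
            rintro h
            have := htop.1
            rw [← h, hw] at this
            omega
          exact ⟨(mem_link_level_one hx).2 ⟨hv.1.trans le_sup_left, htop⟩,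
            lt_of_le_of_ne le_sup_left (hne hv.2.1), lt_of_le_of_ne le_sup_right (hne hv'.2.1)⟩
      rw [if_pos ⟨hvv, htop⟩, hset, finsum_mem_singleton]
    · have hset : {y | y ∈ Y.level 1 ∧ v.val < y ∧ v'.val < y} = ∅ := by
        refine Set.eq_empty_of_forall_notMem ?_
        rintro y ⟨h1, h2, h3⟩
        have hy := ((mem_link_level_one hx).1 h1).2
        exact htop (hle hy h2.le h3.le ▸ hy)
      rw [if_neg fun h => htop h.2, hset, finsum_mem_empty]
  by_cases hex : ∃ v v' : Y.level 0, v.val ⊔ v'.val ∈ topFaces r b n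
  · obtain ⟨w, w', hw⟩ := hex
    refine ⟨Y.weight (w.val ⊔ w'.val), GrassmannianComplex.link_weight_pos _
      ⟨_, hw, le_rfl⟩ (((mem_link_level_zero hx).1 w.2).1.trans le_sup_left), fun v v' => ?_⟩
    rw [hgraph]
    refine if_ctx_congr Iff.rfl (fun h => ?_) fun _ => rfl
    exact GrassmannianComplex.link_weight_eq _ _ (h.2.1.trans hw.1.symm)
  · refine ⟨1, one_pos, fun v v' => ?_⟩
    rw [hgraph, if_neg fun h => hex ⟨v, v', h.2⟩, if_neg fun h => hex ⟨v, v', h.2⟩]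

end Links

/-! ### From frames to the expansion of a link -/

section LinkExpansion

variable {r b n : ℕ} {J : Type*} [Fintype J] {e : LabelSpace J ↪ Fin n}
  {ξ : (J → ZMod 2) →ₗ[ZMod 2] MatrixSpace b n} {x : Submodule (ZMod 2) (MatrixSpace b n)}

theorem map_range_modelMap (γ : (MatrixSpace b n)ˣ × (MatrixSpace b n)ˣ) :
    (vertexModel e b (1, 0)).map (pairAct γ) ⊔ (vertexModel e b (0, 1)).map (pairAct γ) =
      (LinearMap.range (modelMap e (GaloisField 2 b))).map (pairAct γ) := by
  rw [← Submodule.map_sup, vertexModel_sup_vertexModel]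

theorem exists_frame_of_sup_mem [DecidableEq J] (hJ : Fintype.card J + 1 = r)
    (e : LabelSpace J ↪ Fin n) (hξ : LinearMap.range ξ = x)
    (hx : Module.finrank (ZMod 2) x + 1 = r) {v v' : Submodule (ZMod 2) (MatrixSpace b n)}
    (hxv : x ≤ v) (hv : Module.finrank (ZMod 2) v = r) (hxv' : x ≤ v')
    (hv' : Module.finrank (ZMod 2) v' = r) (h : v ⊔ v' ∈ topFaces r b n) :
    ∃ γ ∈ frames e ξ, (vertexModel e b (1, 0)).map (pairAct γ) = v ∧
      (vertexModel e b (0, 1)).map (pairAct γ) = v' := by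
  obtain ⟨u₁, rfl⟩ := Submodule.exists_sup_span_eq hxv (hv.trans hx.symm)
  obtain ⟨u₂, rfl⟩ := Submodule.exists_sup_span_eq hxv' (hv'.trans hx.symm)
  rw [← sup_sup_distrib_left, ← hξ] at h
  obtain ⟨γ, hγ, h1, h2⟩ := exists_frame hJ e h
  refine ⟨γ, hγ, ?_, ?_⟩
  · rw [map_vertexModel hγ, h1, hξ]
  · rw [map_vertexModel hγ, h2, hξ]

/-- Every vertex has a neighbour: write y as v plus a line, and add that line to x. -/
theorem exists_sup_mem_topFaces (hx : Module.finrank (ZMod 2) x + 1 = r)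
    {v y : Submodule (ZMod 2) (MatrixSpace b n)} (hxv : x ≤ v)
    (hv : Module.finrank (ZMod 2) v = r) (hy : y ∈ topFaces r b n) (hvy : v ≤ y) :
    ∃ v', x ≤ v' ∧ Module.finrank (ZMod 2) v' = r ∧ v ⊔ v' ∈ topFaces r b n := by
  obtain ⟨u, rfl⟩ := Submodule.exists_sup_span_eq hvy (hy.1.trans (by rw [hv]))
  have h : v ⊔ (x ⊔ Submodule.span (ZMod 2) {u}) = v ⊔ Submodule.span (ZMod 2) {u} := by
    rw [← sup_assoc, sup_eq_left.2 hxv]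
  refine ⟨x ⊔ Submodule.span (ZMod 2) {u}, le_sup_left, le_antisymm ?_ ?_, h ▸ hy⟩
  · exact (finrank_sup_span_singleton_le _ _).trans hx.le
  · by_contra! hlt
    have hxe : x = x ⊔ Submodule.span (ZMod 2) {u} :=
      Submodule.eq_of_le_of_finrank_le le_sup_left (by omega)
    have := hy.1
    rw [← h, ← hxe, sup_eq_left.2 hxv, hv] at this
    omega

theorem exists_vertex_of_mem_topFaces (hx : Module.finrank (ZMod 2) x + 1 = r)
    {y : Submodule (ZMod 2) (MatrixSpace b n)} (hy : y ∈ topFaces r b n) (hxy : x ≤ y) :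
    ∃ v, x ≤ v ∧ Module.finrank (ZMod 2) v = r ∧ v ≤ y := by
  have hlt : x < y := lt_of_le_of_ne hxy fun h => by
    have := hy.1
    rw [← h] at this
    omega
  obtain ⟨u, hu, hux⟩ := SetLike.exists_of_lt hlt
  refine ⟨x ⊔ Submodule.span (ZMod 2) {u}, le_sup_left, le_antisymm ?_ ?_,
    sup_le hxy ((Submodule.span_singleton_le_iff_mem _ _).2 hu)⟩
  · exact (finrank_sup_span_singleton_le _ _).trans hx.le
  · by_contra! hlt
    have hxe : x = x ⊔ Submodule.span (ZMod 2) {u} :=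
      Submodule.eq_of_le_of_finrank_le le_sup_left (by omega)
    exact hux (hxe ▸ Submodule.mem_sup_right (Submodule.mem_span_singleton_self u))

theorem map_vertexModel_mem_level (hJ : Fintype.card J + 1 = r) (hξ : LinearMap.range ξ = x)
    (hx : Module.finrank (ZMod 2) x + 1 = r)
    (htop : LinearMap.range (modelMap e (GaloisField 2 b)) ∈ topFaces r b n)
    {k k' : ZMod 2 × ZMod 2} (hk : k = (1, 0) ∧ k' = (0, 1) ∨ k = (0, 1) ∧ k' = (1, 0))
    {γ : (MatrixSpace b n)ˣ × (MatrixSpace b n)ˣ} (hγ : γ ∈ frames e ξ) :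
    (vertexModel e b k).map (pairAct γ) ∈
      ((matrixComplex r b n).toWeightedPoset.link x).level 0 := by
  refine (mem_link_level_zero hx).2 ⟨?_, ?_, _, map_pairAct_mem_topFaces htop γ,
    Submodule.map_mono ?_⟩
  · rw [map_vertexModel hγ, hξ]
    exact le_sup_left
  · rw [finrank_map_pairAct, finrank_vertexModel hk hJ htop]
  · rw [← vertexModel_sup_span hk]
    exact le_sup_left

open scoped Classical in
/-- The correlation bound for the two ends of a random edge of a link. -/
theorem abs_sum_frames_le [Fintype (GaloisField 2 b)] [Fintype (frames e ξ)]
    (f : Submodule (ZMod 2) (MatrixSpace b n) → ℝ)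
    (hsum : ∑ γ : frames e ξ, f ((vertexModel e b (0, 1)).map (pairAct γ)) = 0)
    (hsq : ∑ γ : frames e ξ, f ((vertexModel e b (0, 1)).map (pairAct γ)) ^ 2 =
      ∑ γ : frames e ξ, f ((vertexModel e b (1, 0)).map (pairAct γ)) ^ 2) :
    |∑ γ : frames e ξ, f ((vertexModel e b (1, 0)).map (pairAct γ)) *
        f ((vertexModel e b (0, 1)).map (pairAct γ))| ≤
      11 / Fintype.card (GaloisField 2 b) *
        ∑ γ : frames e ξ, f ((vertexModel e b (1, 0)).map (pairAct γ)) ^ 2 := by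
  let _ : Fintype ((MatrixSpace b n)ˣ × (MatrixSpace b n)ˣ) := Fintype.ofFinite _
  set φ : ZMod 2 × ZMod 2 → (MatrixSpace b n)ˣ × (MatrixSpace b n)ˣ → ℝ := fun k γ =>
    if γ ∈ frames e ξ then f ((vertexModel e b k).map (pairAct γ)) else 0 with hφ
  have hφT (k) (γ : frames e ξ) :
      φ k γ = f ((vertexModel e b k).map (pairAct γ)) := if_pos γ.2
  have hsub (g : (MatrixSpace b n)ˣ × (MatrixSpace b n)ˣ → ℝ) (hg : ∀ γ ∉ frames e ξ, g γ = 0) :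
      ∑ γ, g γ = ∑ γ : frames e ξ, g γ :=
    (Fintype.sum_of_injective Subtype.val Subtype.val_injective _ _
      (fun γ hγ => hg γ (by simpa using hγ)) fun _ => rfl).symm
  have hinv (k) (δ : (MatrixSpace b n)ˣ × (MatrixSpace b n)ˣ)
      (hδ : δ ∈ (modelLabels e (GaloisField 2 b)).stab)
      (hk : pairAct δ (modelMap e (GaloisField 2 b) (0, k)) = modelMap e (GaloisField 2 b) (0, k))
      (γ) : φ k (γ * δ) = φ k γ := by
    simp only [hφ, mul_mem_frames_iff hδ, map_vertexModel_mul hδ hk]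
  have hoff (k) (γ) (hγ : γ ∉ frames e ξ) : φ k γ = 0 := if_neg hγ
  have h := abs_sum_mul_le_of_coset (c := 11 / Fintype.card (GaloisField 2 b))
    (fun u hu hu0 => (modelLabels e (GaloisField 2 b)).norm_fixProj_stabWith_le
      (rightRegular ((MatrixSpace b n)ˣ × (MatrixSpace b n)ˣ)) hu hu0)
    (T := frames e ξ) (fun γ hγ δ hδ => inv_mul_mem_stab hγ hδ) (φ := φ (1, 0)) (φ' := φ (0, 1))
    (fun δ hδ => hinv _ δ (mem_stabWith_z_modelLabels.1 hδ).1 (mem_stabWith_z_modelLabels.1 hδ).2)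
    (fun δ hδ => hinv _ δ (mem_stabWith_w_modelLabels.1 hδ).1 (mem_stabWith_w_modelLabels.1 hδ).2)
    (hoff _)
    (by
      rw [hsub _ (hoff _)]
      simp_rw [hφT]
      exact hsum)
    (by
      rw [hsub _ fun γ hγ => by rw [hoff _ _ hγ, sq, zero_mul],
        hsub _ fun γ hγ => by rw [hoff _ _ hγ, sq, zero_mul]]
      simp_rw [hφT]
      exact hsq)
  rw [hsub _ fun γ hγ => by rw [hoff _ _ hγ, zero_mul],
    hsub _ fun γ hγ => by rw [hoff _ _ hγ, sq, zero_mul]] at h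
  simp_rw [hφT] at h
  exact h

open scoped Classical in
/-- The expansion of the 1-skeleton of the link of a face of codimension two. -/
theorem spectralExpansion_link_le (hr : 1 ≤ r) (hn : 2 ^ (r + 1) ≤ n)
    (hxf : x ∈ (matrixComplex r b n).faces) (hx : Module.finrank (ZMod 2) x + 1 = r) :
    spectralExpansion ((matrixComplex r b n).toWeightedPoset.link x).skeletonGraph ≤
      11 / Nat.card (GaloisField 2 b) := by
  have hJ : Fintype.card (Fin (r - 1)) + 1 = r := by
    rw [Fintype.card_fin]
    omega
  obtain ⟨e⟩ : Nonempty (LabelSpace (Fin (r - 1)) ↪ Fin n) := by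
    refine Function.Embedding.nonempty_of_card_le ?_
    rw [Fintype.card_prod, Fintype.card_prod, Fintype.card_fun, ZMod.card, Fintype.card_fin,
      Fintype.card_fin]
    calc 2 ^ (r - 1) * (2 * 2) = 2 ^ (r - 1 + 2) := by ring
      _ = 2 ^ (r + 1) := by congr 1; omega
      _ ≤ n := hn
  obtain ⟨ξ, hξ⟩ : ∃ ξ : (Fin (r - 1) → ZMod 2) →ₗ[ZMod 2] MatrixSpace b n,
      LinearMap.range ξ = x := by
    have h : Module.finrank (ZMod 2) (Fin (r - 1) → ZMod 2) = Module.finrank (ZMod 2) x := by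
      rw [Module.finrank_fin_fun]
      omega
    refine ⟨x.subtype ∘ₗ (LinearEquiv.ofFinrankEq _ _ h).toLinearMap, ?_⟩
    rw [LinearMap.range_comp, LinearEquiv.range, Submodule.map_top, Submodule.range_subtype]
  set Y := (matrixComplex r b n).toWeightedPoset.link x with hY
  have hframe (v v' : Y.level 0) (h : v.val ⊔ v'.val ∈ topFaces r b n) :
      ∃ γ ∈ frames e ξ, (vertexModel e b (1, 0)).map (pairAct γ) = v ∧
        (vertexModel e b (0, 1)).map (pairAct γ) = v' := by
    have hv := (mem_link_level_zero hx).1 v.2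
    have hv' := (mem_link_level_zero hx).1 v'.2
    exact exists_frame_of_sup_mem hJ e hξ hx hv.1 hv.2.1 hv'.1 hv'.2.1 h
  have hext (v : Y.level 0) : ∃ v' : Y.level 0, v.val ⊔ v'.val ∈ topFaces r b n := by
    obtain ⟨h1, h2, y, hy, hvy⟩ := (mem_link_level_zero hx).1 v.2
    obtain ⟨v', h3, h4, h5⟩ := exists_sup_mem_topFaces hx h1 h2 hy hvy
    exact ⟨⟨v', (mem_link_level_zero hx).2 ⟨h3, h4, _, h5, le_sup_right⟩⟩, h5⟩
  obtain ⟨v₀⟩ : Nonempty (Y.level 0) := by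
    obtain ⟨y, hy, hxy⟩ := hxf
    obtain ⟨v, h1, h2, h3⟩ := exists_vertex_of_mem_topFaces hx hy hxy
    exact ⟨⟨v, (mem_link_level_zero hx).2 ⟨h1, h2, y, hy, h3⟩⟩⟩
  obtain ⟨v₀', hv₀'⟩ := hext v₀
  obtain ⟨γ₀, hγ₀, hγv, hγv'⟩ := hframe v₀ v₀' hv₀'
  -- The model is itself a top face: translate an existing edge back by the inverse of its frame.
  have htop : LinearMap.range (modelMap e (GaloisField 2 b)) ∈ topFaces r b n := by
    rw [← hγv, ← hγv', map_range_modelMap] at hv₀'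
    have h := map_pairAct_mem_topFaces hv₀' γ₀⁻¹
    rwa [← Submodule.map_comp, show pairAct γ₀⁻¹ ∘ₗ pairAct γ₀ = LinearMap.id from
      LinearMap.ext fun M => pairAct_inv_apply γ₀ M, Submodule.map_id] at h
  have hsup (γ : frames e ξ) : (vertexModel e b (1, 0)).map (pairAct γ) ⊔
      (vertexModel e b (0, 1)).map (pairAct γ) ∈ topFaces r b n := by
    rw [map_range_modelMap]
    exact map_pairAct_mem_topFaces htop _
  let p (γ : frames e ξ) : Y.level 0 :=
    ⟨_, map_vertexModel_mem_level hJ hξ hx htop (Or.inl ⟨rfl, rfl⟩) γ.2⟩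
  let p' (γ : frames e ξ) : Y.level 0 :=
    ⟨_, map_vertexModel_mem_level hJ hξ hx htop (Or.inr ⟨rfl, rfl⟩) γ.2⟩
  have hne (γ : frames e ξ) : p γ ≠ p' γ := by
    intro h
    have h1 := (hsup γ).1
    have h2 : (p γ).val ⊔ (p' γ).val = (p γ).val := by rw [← h, sup_idem]
    have h3 := ((mem_link_level_zero hx).1 (p γ).2).2.1
    change Module.finrank (ZMod 2) ↥((p γ).val ⊔ (p' γ).val) = r + 1 at h1
    rw [h2, h3] at h1
    omega
  have : Nontrivial (Y.level 0) := ⟨_, _, hne ⟨γ₀, hγ₀⟩⟩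
  let _ : Fintype (Y.level 0) := Fintype.ofFinite _
  let _ : Fintype (GaloisField 2 b) := Fintype.ofFinite _
  let _ : Fintype (frames e ξ) := Fintype.ofFinite _
  obtain ⟨c, hc, hgraph⟩ := exists_skeletonGraph_link_eq (b := b) (n := n) hx
  have hT (γ₁ γ₂ γ : frames e ξ) : γ₁.val * γ₂.val⁻¹ * γ.val ∈ frames e ξ :=
    translate_mem_frames γ₁.2 γ₂.2 γ.2
  have hpT (γ₁ γ₂ γ : frames e ξ) (h : p γ = p γ₂) : p ⟨_, hT γ₁ γ₂ γ⟩ = p γ₁ :=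
    Subtype.ext (map_pairAct_translate (congrArg Subtype.val h))
  have hpT' (γ₁ γ₂ γ : frames e ξ) (h : p' γ = p' γ₂) : p' ⟨_, hT γ₁ γ₂ γ⟩ = p' γ₁ :=
    Subtype.ext (map_pairAct_translate (congrArg Subtype.val h))
  set k := (Finset.univ.filter fun γ => p γ = p ⟨γ₀, hγ₀⟩).card with hk
  set l := (Finset.univ.filter fun γ => p γ = p ⟨γ₀, hγ₀⟩ ∧ p' γ = p' ⟨γ₀, hγ₀⟩).card with hl
  have hk0 : 0 < k := Finset.card_pos.2 ⟨⟨γ₀, hγ₀⟩, by simp⟩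
  have hl0 : 0 < l := Finset.card_pos.2 ⟨⟨γ₀, hγ₀⟩, by simp⟩
  -- k frames lie over each vertex, l over each ordered edge, and c is the common edge weight. The
  -- factor l / c therefore turns weights into numbers of frames.
  refine spectralExpansion_le_of_fibers p p' (κ := l / c) (k := k) ?_ (by positivity)
    (by positivity) ?_ ?_ ?_
  · ext v v'
    rw [Matrix.transpose_apply, hgraph, hgraph]
    refine if_congr ?_ rfl rfl
    rw [sup_comm, ne_comm]
  · intro v
    obtain ⟨v', hv'⟩ := hext v
    obtain ⟨γ, hγ, h1, -⟩ := hframe v v' hv'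
    have h2 : p ⟨γ, hγ⟩ = v := Subtype.ext h1
    have h3 := card_fiber_eq_of_translate p hT hpT ⟨γ, hγ⟩ ⟨γ₀, hγ₀⟩
    rw [← h2, hk, Nat.cast_inj]
    convert h3
  · intro v v'
    rw [hgraph]
    split_ifs with hvv
    · obtain ⟨γ, hγ, h1, h2⟩ := hframe v v' hvv.2
      have h3 : p ⟨γ, hγ⟩ = v := Subtype.ext h1
      have h4 : p' ⟨γ, hγ⟩ = v' := Subtype.ext h2
      have h5 := card_fiber_eq_of_translate (fun γ => (p γ, p' γ)) hT
        (fun γ₁ γ₂ γ h => by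
          rw [Prod.mk.injEq] at h
          rw [hpT _ _ _ h.1, hpT' _ _ _ h.2]) ⟨γ, hγ⟩ ⟨γ₀, hγ₀⟩
      simp only [Prod.mk.injEq] at h5
      rw [div_mul_cancel₀ _ hc.ne', ← h3, ← h4, hl, Nat.cast_inj]
      convert h5
    · rw [mul_zero, Nat.cast_eq_zero, Finset.card_eq_zero, Finset.filter_eq_empty_iff]
      rintro γ - ⟨rfl, rfl⟩
      exact hvv ⟨hne γ, hsup γ⟩
  · intro f hsum hsq
    -- Extension by zero makes f a function on all subspaces, so that it can be evaluated along the
    -- group action.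
    obtain ⟨g, hg⟩ : ∃ g : Submodule (ZMod 2) (MatrixSpace b n) → ℝ,
        ∀ v : Y.level 0, f v = g v.val :=
      ⟨fun v => if h : v ∈ Y.level 0 then f ⟨v, h⟩ else 0, fun v => by simp⟩
    rw [Nat.card_eq_fintype_card]
    simp only [hg] at hsum hsq ⊢
    exact abs_sum_frames_le _ hsum hsq

end LinkExpansion

theorem mainTheorem5 (r b n : ℕ) (hr : 1 ≤ r) (hb : 1 ≤ b) (hn : 2 ^ (r + 1) ≤ n) :
    (matrixComplex r b n).toWeightedPoset.localExpansion ((r : ℤ) - 2) ≤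
      11 / (2 : ℝ) ^ b := by
  -- The real supremum needs a nonnegative bound, since over an empty index it is zero. Rank r - 2
  -- means dimension r - 1; for r = 1 this is the zero subspace.
  refine Real.iSup_le (fun x => ?_) (by positivity)
  have hx : ((Module.finrank (ZMod 2) x.val : ℤ) - 1) = (r : ℤ) - 2 := x.2.2
  have h := spectralExpansion_link_le hr hn x.2.1 (by omega)
  rwa [GaloisField.card 2 b (by omega), Nat.cast_pow, Nat.cast_ofNat] at h
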